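/- All dg algebras are over $\mathbb{C}$, unital, $\mathbb{Z}$-graded, with differential of degree $+1$. Let $\mathrm{Ho}(\mathrm{CDGA})$ (resp. $\mathrm{Ho}(\mathrm{DGA})$) be the homotopy category, i.e. the localization at quasi-isomorphisms, of the category of graded-commutative, nonpositively graded dg algebras (resp. of all associative dg algebras). A *finite polynomial resolution* of a commutative dg algebra $A$ (for example of an ordinary commutative algebra placed in degree $0$) is a quasi-isomorphism $P\to A$ where $P$ is a commutative dg algebra whose underlying graded algebra is the graded polynomial algebra on finitely many generators of nonpositive degrees. For such a $P$ let $\mathcal{D}_P\subset \mathrm{End}_{\mathbb{C}}(P)$ be the algebra of differential operators, generated by the multiplications by elements of $P$ and the homogeneous (super)derivations of $P$; it is a dg algebra with the degree of operators ($\deg\partial_x=-\deg x$) and the differential $[\partial,\cdot\,]$, $\partial$ being the differential of $P$. **Lemma.** The assignment $A\mapsto\mathcal{D}_P$, for $P\to A$ a finite polynomial resolution, defines a functor from the groupoid of isomorphisms of the full subcategory of $\mathrm{Ho}(\mathrm{CDGA})$ on those $A$ that have a finite polynomial resolution to the groupoid of isomorphisms of $\mathrm{Ho}(\mathrm{DGA})$.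 Precisely, there are a functor $F$ between these groupoids and isomorphisms $\iota_{P}\colon F(A)\cong\mathcal{D}_P$ in $\mathrm{Ho}(\mathrm{DGA})$, one for every finite polynomial resolution $P\to A$ of every such $A$, with the following property. Let $\varphi\colon A\to B$ be an isomorphism in $\mathrm{Ho}(\mathrm{CDGA})$, let $p\colon P\to A$, $q\colon Q\to B$ be finite polynomial resolutions, and let $f\colon P\to Q$ be a morphism of dg algebras with $\varphi\circ p=q\circ f$ in $\mathrm{Ho}(\mathrm{CDGA})$. Then for all morphisms of dg algebras $s\colon E\to\mathcal{D}_P$ and $t\colon E\to\mathcal{D}_Q$ such that $f\circ s(e)=t(e)\circ f$ for every $e\in E$ one has $$\iota_Q\circ F(\varphi)\circ\iota_P^{-1}\circ s=t\quad\text{in }\mathrm{Ho}(\mathrm{DGA}).$$ The pair $(F,\iota)$ is unique up to a unique isomorphism of functors compatible with the isomorphisms $\iota_P$. Moreover $\mathcal{D}_P$ is independent of the resolution up to homotopy: for any two finite polynomial resolutions $P\to A\leftarrow Q$ of the same $A$, the dg algebras $\mathcal{D}_P$ and $\mathcal{D}_Q$ are connected by a finite zigzag of quasi-isomorphisms of dg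 algebras. -/

import Mathlib

open CategoryTheory

universe u

/-- A differential graded associative unital `ℂ`-algebra: a `ℤ`-graded algebra with a differential
of degree `+1` satisfying the graded Leibniz rule. -/
structure DGAlg where
  carrier : Type u
  [ring : Ring carrier]
  [algebra : Algebra ℂ carrier]
  grading : ℤ → Submodule ℂ carrier
  [graded : GradedAlgebra grading]
  d : carrier →ₗ[ℂ] carrier
  d_mem : ∀ {n : ℤ} {a : carrier}, a ∈ grading n → d a ∈ grading (n + 1)
  d_d : ∀ a : carrier, d (d a) = 0
  leibniz : ∀ {n : ℤ} {a : carrier}, a ∈ grading n → ∀ b : carrier,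
    d (a * b) = d a * b + (-1 : ℂ) ^ n • (a * d b)

namespace DGAlg

instance : CoeSort DGAlg.{u} (Type u) := ⟨DGAlg.carrier⟩

attribute [instance] DGAlg.ring DGAlg.algebra DGAlg.graded

/-- Morphisms of dg algebras: unital algebra maps that preserve degrees and commute with `d`. -/
@[ext]
structure Hom (A B : DGAlg.{u}) where
  toAlgHom : A →ₐ[ℂ] B
  map_mem : ∀ {n : ℤ} {a : A}, a ∈ A.grading n → toAlgHom a ∈ B.grading n
  map_d : ∀ a : A, toAlgHom (A.d a) = B.d (toAlgHom a)

instance : Category DGAlg.{u} where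
  Hom A B := Hom A B
  id A := { toAlgHom := AlgHom.id ℂ A, map_mem := fun h => h, map_d := fun _ => rfl }
  comp f g :=
    { toAlgHom := g.toAlgHom.comp f.toAlgHom
      map_mem := fun h => g.map_mem (f.map_mem h)
      map_d := fun a => by simp [f.map_d, g.map_d] }

/-- The underlying algebra homomorphism of a morphism of dg algebras. -/
def alg {A B : DGAlg.{u}} (f : A ⟶ B) : A →ₐ[ℂ] B := Hom.toAlgHom f

/-- The (total) cohomology `ker d / im d`; as `d` is homogeneous, it is the direct sum of the
cohomology groups in the various degrees. -/
abbrev Cohomology (A : DGAlg.{u}) : Type u :=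
  LinearMap.ker A.d ⧸ (LinearMap.range A.d).submoduleOf (LinearMap.ker A.d)

/-- The map induced on cohomology by a morphism of dg algebras. -/
def cohomologyMap {A B : DGAlg.{u}} (f : A ⟶ B) : A.Cohomology →ₗ[ℂ] B.Cohomology :=
  Submodule.mapQ _ _
    ((alg f).toLinearMap.restrict (p := LinearMap.ker A.d) (q := LinearMap.ker B.d)
      (fun a ha => by
        rw [LinearMap.mem_ker] at ha ⊢
        exact (Hom.map_d f a).symm.trans (by rw [ha, map_zero])))
    (by
      rintro ⟨a, ha⟩ ⟨c, hc⟩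
      exact ⟨alg f c, (Hom.map_d f c).symm.trans (congrArg (alg f) hc)⟩)

/-- Quasi-isomorphisms of dg algebras: morphisms that induce a bijection on cohomology. -/
def quasiIso : MorphismProperty DGAlg.{u} := fun _ _ f => Function.Bijective (cohomologyMap f)

/-- The homotopy category of dg algebras. -/
abbrev Ho : Type (u + 1) := quasiIso.{u}.Localization

/-- The localization functor. -/
abbrev toHo : DGAlg.{u} ⥤ Ho.{u} := quasiIso.{u}.Q

/-- Commutative (in the graded sense), nonpositively graded dg algebras. -/
def isCommNonpos : ObjectProperty DGAlg.{u} := fun A =>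
  (∀ (m n : ℤ) (a b : A), a ∈ A.grading m → b ∈ A.grading n →
    a * b = (-1 : ℂ) ^ (m * n) • (b * a)) ∧
  ∀ n : ℤ, 0 < n → A.grading n = ⊥

/-- The ordered monomials `x₁^{a₁} ⋯ xₙ^{aₙ}` in elements `xᵢ` of degree `deg i`, in which a variable
of odd degree has exponent at most one. -/
def monomials (A : DGAlg.{u}) {n : ℕ} (deg : Fin n → ℤ) (x : Fin n → A)
    (a : {a : Fin n → ℕ // ∀ i, Odd (deg i) → a i ≤ 1}) : A :=
  (List.ofFn fun i => x i ^ a.1 i).prod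

/-- `A` is, as a graded algebra, the polynomial algebra on finitely many homogeneous generators of
nonpositive degrees (used for graded-commutative `A`): the ordered monomials in the generators, with
exponents at most one at the odd generators, form a basis. -/
def IsFinitePolynomial (A : DGAlg.{u}) : Prop :=
  ∃ (n : ℕ) (deg : Fin n → ℤ) (x : Fin n → A),
    (∀ i, deg i ≤ 0) ∧ (∀ i, x i ∈ A.grading (deg i)) ∧
    LinearIndependent ℂ (A.monomials deg x) ∧
    Submodule.span ℂ (Set.range (A.monomials deg x)) = ⊤

end DGAlg

/-- The category of commutative nonpositively graded dg `ℂ`-algebras. -/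
abbrev CDGAlg : Type (u + 1) := DGAlg.isCommNonpos.{u}.FullSubcategory

namespace CDGAlg

/-- Quasi-isomorphisms of commutative dg algebras. -/
def quasiIso : MorphismProperty CDGAlg.{u} := DGAlg.quasiIso.inverseImage DGAlg.isCommNonpos.ι

/-- The homotopy category of commutative dg algebras. -/
abbrev Ho : Type (u + 1) := quasiIso.{u}.Localization

/-- The localization functor. -/
abbrev toHo : CDGAlg.{u} ⥤ Ho.{u} := quasiIso.{u}.Q

/-- A resolution of `A` by a finitely generated polynomial dg algebra. -/
structure Resolution (A : CDGAlg.{u}) where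
  P : CDGAlg.{u}
  isFinitePolynomial : P.obj.IsFinitePolynomial
  π : P ⟶ A
  quasiIso_π : quasiIso π

/-- The commutative dg algebras that have a finitely generated polynomial resolution. -/
def hasResolution : ObjectProperty CDGAlg.{u} := fun A => Nonempty A.Resolution

/-- The full subcategory of the homotopy category of commutative dg algebras on those that have a
finitely generated polynomial resolution. -/
abbrev HoRes : Type (u + 1) :=
  InducedCategory Ho.{u} (fun A : hasResolution.{u}.FullSubcategory => toHo.obj A.obj)

end CDGAlg

namespace DGAlg

section DiffOps

variable (P : DGAlg.{u})

/-- Linear endomorphisms of degree `n`. -/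
def opDeg (n : ℤ) : Submodule ℂ (Module.End ℂ P) where
  carrier := {D | ∀ (m : ℤ) (p : P), p ∈ P.grading m → D p ∈ P.grading (m + n)}
  add_mem' hD hE m p hp := add_mem (hD m p hp) (hE m p hp)
  zero_mem' _ _ _ := zero_mem _
  smul_mem' c _ hD m p hp := Submodule.smul_mem _ c (hD m p hp)

/-- `D` is a (super)derivation of degree `n`. -/
def IsDerivation (n : ℤ) (D : Module.End ℂ P) : Prop :=
  D ∈ P.opDeg n ∧ ∀ (m : ℤ) (a b : P), a ∈ P.grading m →
    D (a * b) = D a * b + (-1 : ℂ) ^ (n * m) • (a * D b)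

/-- The differential operators on a polynomial dg algebra `P`: the algebra of linear endomorphisms
of `P` generated by the multiplications by elements of `P` and the homogeneous derivations, that
is, by the generators `x` of `P` and the partial derivatives `∂_x`. -/
def diffOps : Subalgebra ℂ (Module.End ℂ P) :=
  Algebra.adjoin ℂ
    (Set.range (LinearMap.mulLeft ℂ (A := P)) ∪ {D | ∃ n, P.IsDerivation n D})

/-- The parity operator `p ↦ (-1)^{deg p} p`. -/
noncomputable def parity : Module.End ℂ P :=
  DirectSum.toModule ℂ ℤ P (fun n => (-1 : ℂ) ^ n • (P.grading n).subtype) ∘ₗ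
    (DirectSum.decomposeLinearEquiv P.grading).toLinearMap

variable {P}

lemma parity_of_mem {n : ℤ} {p : P} (hp : p ∈ P.grading n) : P.parity p = (-1 : ℂ) ^ n • p := by
  have h : (DirectSum.decomposeLinearEquiv P.grading) p
      = DirectSum.lof ℂ ℤ (fun i => P.grading i) n ⟨p, hp⟩ := DirectSum.decompose_of_mem P.grading hp
  simp [parity, h]

lemma end_ext {D E : Module.End ℂ P} (h : ∀ (m : ℤ) (p : P), p ∈ P.grading m → D p = E p) :
    D = E := by
  ext p
  induction p using DirectSum.Decomposition.inductionOn P.grading with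
  | zero => simp
  | homogeneous p => exact h _ _ p.2
  | add a b ha hb => rw [map_add, map_add, ha, hb]

lemma neg_one_zpow_sq (n : ℤ) : (-1 : ℂ) ^ n * (-1 : ℂ) ^ n = 1 := by
  rw [← mul_zpow]; simp

lemma parity_comp_parity : P.parity * P.parity = 1 := by
  refine end_ext fun m p hp => ?_
  simp [parity_of_mem hp, smul_smul, neg_one_zpow_sq]

lemma d_mem_opDeg : P.d ∈ P.opDeg 1 := fun _ _ hp => P.d_mem hp

lemma parity_conj_of_mem {n : ℤ} {D : Module.End ℂ P} (hD : D ∈ P.opDeg n) :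
    P.parity * D * P.parity = (-1 : ℂ) ^ n • D := by
  refine end_ext fun m p hp => ?_
  simp only [Module.End.mul_apply, parity_of_mem hp, map_smul, parity_of_mem (hD m p hp),
    LinearMap.smul_apply, smul_smul]
  rw [zpow_add₀ (by norm_num), ← mul_assoc, neg_one_zpow_sq, one_mul]

variable (P) in
/-- The supercommutator `[d, ·]`: on an operator `D` of degree `n` it is `d ∘ D - (-1)^n D ∘ d`
(`dEnd_of_mem`), since conjugation by the parity operator multiplies `D` by `(-1)^n`. -/
noncomputable def dEnd : Module.End ℂ P →ₗ[ℂ] Module.End ℂ P :=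
  LinearMap.mulLeft ℂ P.d -
    LinearMap.mulRight ℂ P.d ∘ₗ LinearMap.mulLeft ℂ P.parity ∘ₗ LinearMap.mulRight ℂ P.parity

lemma dEnd_apply (D : Module.End ℂ P) :
    P.dEnd D = P.d * D - P.parity * D * P.parity * P.d := by
  simp [dEnd, mul_assoc]

lemma dEnd_of_mem {n : ℤ} {D : Module.End ℂ P} (hD : D ∈ P.opDeg n) :
    P.dEnd D = P.d * D - (-1 : ℂ) ^ n • (D * P.d) := by
  rw [dEnd_apply, parity_conj_of_mem hD, smul_mul_assoc]

lemma d_mul_d : P.d * P.d = 0 := by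
  ext p; simp [P.d_d]

lemma dEnd_dEnd_aux {R : Type*} [Ring R] (s d D : R) (h1 : s * d * s = -d) (h2 : s * s = 1)
    (h3 : d * d = 0) : d * (d * D - s * D * s * d) - s * (d * D - s * D * s * d) * s * d = 0 := by
  have h4 : s * d = -(d * s) := by
    calc s * d = s * d * (s * s) := by rw [h2, mul_one]
      _ = (s * d * s) * s := by simp only [mul_assoc]
      _ = _ := by rw [h1, neg_mul]
  have e : d * (d * D - s * D * s * d) - s * (d * D - s * D * s * d) * s * d
      = (d * d) * D - d * s * D * s * d - (s * d) * D * s * d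
        + (s * s) * D * (s * d * s) * d := by noncomm_ring
  rw [e, h1, h4, h3]
  have e' : s * s * D * -d * d = -(s * s * D * (d * d)) := by noncomm_ring
  rw [e', h3]
  noncomm_ring

lemma dEnd_mul_aux {R : Type*} [Ring R] (s d D E : R) (h2 : s * s = 1) :
    d * (D * E) - s * (D * E) * s * d =
      (d * D - s * D * s * d) * E + (s * D * s) * (d * E - s * E * s * d) := by
  have : (d * D - s * D * s * d) * E + (s * D * s) * (d * E - s * E * s * d)
      = d * (D * E) - s * D * (s * s) * E * s * d := by noncomm_ring
  rw [this, h2]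
  noncomm_ring

lemma dEnd_dEnd (D : Module.End ℂ P) : P.dEnd (P.dEnd D) = 0 := by
  have h1 : P.parity * P.d * P.parity = -P.d := by
    rw [parity_conj_of_mem (d_mem_opDeg (P := P)), zpow_one]
    ext p; simp
  simp only [dEnd_apply]
  exact dEnd_dEnd_aux P.parity P.d D h1 parity_comp_parity d_mul_d

lemma dEnd_mul (D E : Module.End ℂ P) :
    P.dEnd (D * E) = P.dEnd D * E + (P.parity * D * P.parity) * P.dEnd E := by
  simp only [dEnd_apply]
  exact dEnd_mul_aux P.parity P.d D E parity_comp_parity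

lemma opDeg_mul {m n : ℤ} {D E : Module.End ℂ P} (hD : D ∈ P.opDeg m) (hE : E ∈ P.opDeg n) :
    D * E ∈ P.opDeg (m + n) := fun k p hp => by
  have := hD _ _ (hE k p hp)
  rwa [show k + (m + n) = k + n + m by ring]

lemma opDeg_one : (1 : Module.End ℂ P) ∈ P.opDeg 0 := fun k p hp => by simpa using hp

lemma mulLeft_mem_opDeg {n : ℤ} {a : P} (ha : a ∈ P.grading n) :
    LinearMap.mulLeft ℂ a ∈ P.opDeg n := fun m p hp => by
  rw [add_comm m n]; exact SetLike.mul_mem_graded ha hp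

lemma dEnd_mem_opDeg {n : ℤ} {D : Module.End ℂ P} (hD : D ∈ P.opDeg n) :
    P.dEnd D ∈ P.opDeg (n + 1) := by
  rw [dEnd_of_mem hD]
  refine sub_mem ?_ (Submodule.smul_mem _ _ (opDeg_mul hD d_mem_opDeg))
  rw [add_comm n 1]; exact opDeg_mul d_mem_opDeg hD

lemma dEnd_mulLeft {n : ℤ} {a : P} (ha : a ∈ P.grading n) :
    P.dEnd (LinearMap.mulLeft ℂ a) = LinearMap.mulLeft ℂ (P.d a) := by
  rw [dEnd_of_mem (mulLeft_mem_opDeg ha)]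
  ext b
  simp [P.leibniz ha b]

lemma dEnd_isDerivation {n : ℤ} {D : Module.End ℂ P} (hD : P.IsDerivation n D) :
    P.IsDerivation (n + 1) (P.dEnd D) := by
  refine ⟨dEnd_mem_opDeg hD.1, fun m a b ha => ?_⟩
  rw [dEnd_of_mem hD.1]
  simp only [LinearMap.sub_apply, LinearMap.smul_apply, Module.End.mul_apply]
  rw [hD.2 m a b ha, P.leibniz ha, map_add, map_add, map_smul, map_smul,
    P.leibniz (hD.1 m a ha), P.leibniz ha, hD.2 _ _ _ (P.d_mem ha), hD.2 _ _ _ ha]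
  have hn := neg_one_zpow_sq n
  have e1 : (-1 : ℂ) ^ (n * (m + 1)) = (-1 : ℂ) ^ (n * m) * (-1 : ℂ) ^ n := by
    rw [mul_add, mul_one, zpow_add₀ (by norm_num)]
  have e2 : (-1 : ℂ) ^ (m + n) = (-1 : ℂ) ^ m * (-1 : ℂ) ^ n := zpow_add₀ (by norm_num) _ _
  have e3 : (-1 : ℂ) ^ ((n + 1) * m) = (-1 : ℂ) ^ (n * m) * (-1 : ℂ) ^ m := by
    rw [add_mul, one_mul, zpow_add₀ (by norm_num)]
  rw [e1, e2, e3]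
  simp only [smul_add, smul_sub, smul_smul, mul_sub, sub_mul, mul_smul_comm, smul_mul_assoc]
  have h5 : (-1 : ℂ) ^ n * ((-1 : ℂ) ^ (n * m) * (-1 : ℂ) ^ n) = (-1 : ℂ) ^ (n * m) := by
    rw [mul_left_comm, hn, mul_one]
  rw [h5]
  module

lemma mulLeft_mem_diffOps (a : P) : LinearMap.mulLeft ℂ a ∈ P.diffOps :=
  Algebra.subset_adjoin (Or.inl ⟨a, rfl⟩)

lemma isDerivation_mem_diffOps {n : ℤ} {D : Module.End ℂ P} (hD : P.IsDerivation n D) :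
    D ∈ P.diffOps :=
  Algebra.subset_adjoin (Or.inr ⟨n, hD⟩)

variable (P) in
/-- The operators of degree `n` in the algebra of differential operators. -/
def diffOpsDeg (n : ℤ) : Submodule ℂ P.diffOps :=
  (P.opDeg n).comap P.diffOps.val.toLinearMap

instance : SetLike.GradedMonoid P.diffOpsDeg where
  one_mem := opDeg_one
  mul_mem _ _ _ _ hD hE := opDeg_mul hD hE

lemma diffOps_le_range :
    P.diffOps ≤ ((DirectSum.coeAlgHom P.diffOpsDeg).range.map P.diffOps.val) := by
  have key : ∀ {n : ℤ} {D : Module.End ℂ P}, D ∈ P.diffOps → D ∈ P.opDeg n →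
      D ∈ ((DirectSum.coeAlgHom P.diffOpsDeg).range.map P.diffOps.val) := by
    intro n D h1 h2
    refine ⟨⟨D, h1⟩, ⟨DirectSum.of (fun i => P.diffOpsDeg i) n ⟨⟨D, h1⟩, h2⟩, ?_⟩, rfl⟩
    exact DirectSum.coeAlgHom_of _ _ _
  refine Algebra.adjoin_le ?_
  rintro D (⟨a, rfl⟩ | ⟨n, hD⟩)
  · induction a using DirectSum.Decomposition.inductionOn P.grading with
    | zero => rw [LinearMap.mulLeft_zero_eq_zero]; exact zero_mem _
    | homogeneous a => exact key (mulLeft_mem_diffOps _) (mulLeft_mem_opDeg a.2)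
    | add a b ha hb =>
      rw [show LinearMap.mulLeft ℂ (a + b) = LinearMap.mulLeft ℂ a + LinearMap.mulLeft ℂ b from by
        ext; simp [add_mul]]
      exact add_mem ha hb
  · exact key (isDerivation_mem_diffOps hD) hD.1

lemma decompose_coe_apply (x : DirectSum ℤ fun i => P.diffOpsDeg i) (k m : ℤ) (p : P)
    (hp : p ∈ P.grading m) :
    (DirectSum.decompose P.grading
      ((DirectSum.coeAlgHom P.diffOpsDeg x : P.diffOps).1 p) (m + k) : P) = (x k).1.1 p := by
  induction x using DirectSum.induction_on with
  | zero => simp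
  | of i y =>
    rw [DirectSum.coeAlgHom_of]
    have hy : y.1.1 p ∈ P.grading (m + i) := y.2 m p hp
    by_cases h : i = k
    · subst h
      rw [DirectSum.decompose_of_mem_same _ hy, DirectSum.of_eq_same]
    · rw [DirectSum.decompose_of_mem_ne _ hy (by simpa using h),
        DirectSum.of_eq_of_ne _ _ _ (Ne.symm h)]
      simp
  | add x y hx hy =>
    simp only [map_add, DirectSum.add_apply, Subalgebra.coe_add, LinearMap.add_apply,
      DirectSum.decompose_add, Submodule.coe_add] at hx hy ⊢
    rw [hx, hy]

lemma diffOps_isInternal : DirectSum.IsInternal P.diffOpsDeg := by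
  constructor
  · intro x y hxy
    have hxy' : DirectSum.coeAlgHom P.diffOpsDeg x = DirectSum.coeAlgHom P.diffOpsDeg y := hxy
    refine DFinsupp.ext fun k => Subtype.ext (Subtype.ext (end_ext fun m p hp => ?_))
    rw [← decompose_coe_apply x k m p hp, ← decompose_coe_apply y k m p hp, hxy']
  · rintro ⟨D, hD⟩
    obtain ⟨E, ⟨x, hx⟩, hE⟩ := diffOps_le_range hD
    exact ⟨x, hx.trans (Subtype.ext hE)⟩

noncomputable instance : GradedAlgebra P.diffOpsDeg :=
  { (inferInstance : SetLike.GradedMonoid P.diffOpsDeg), diffOps_isInternal.chooseDecomposition with }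

lemma parity_conj_mem {D : Module.End ℂ P} (hD : D ∈ P.diffOps) :
    P.parity * D * P.parity ∈ P.diffOps := by
  suffices h : ∀ D : P.diffOps, P.parity * D.1 * P.parity ∈ P.diffOps from h ⟨D, hD⟩
  intro D
  induction D using DirectSum.Decomposition.inductionOn P.diffOpsDeg with
  | zero => simp
  | homogeneous D =>
    have h : D.1.1 ∈ P.opDeg _ := D.2
    rw [parity_conj_of_mem h]
    exact Subalgebra.smul_mem _ D.1.2 _
  | add D E hD hE =>
    simpa [mul_add, add_mul] using add_mem hD hE

lemma dEnd_mem {D : Module.End ℂ P} (hD : D ∈ P.diffOps) : P.dEnd D ∈ P.diffOps := by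
  induction hD using Algebra.adjoin_induction with
  | mem D hD =>
    rcases hD with ⟨a, rfl⟩ | ⟨n, hD⟩
    · induction a using DirectSum.Decomposition.inductionOn P.grading with
      | zero => simp
      | homogeneous a => rw [dEnd_mulLeft a.2]; exact mulLeft_mem_diffOps _
      | add a b ha hb =>
        rw [show LinearMap.mulLeft ℂ (a + b) = LinearMap.mulLeft ℂ a + LinearMap.mulLeft ℂ b from by
          ext; simp [add_mul], map_add]
        exact add_mem ha hb
    · exact isDerivation_mem_diffOps (dEnd_isDerivation hD)
  | algebraMap r =>
    have : P.dEnd (algebraMap ℂ (Module.End ℂ P) r) = 0 := by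
      rw [Algebra.algebraMap_eq_smul_one, map_smul, dEnd_of_mem opDeg_one]
      simp
    rw [this]; exact zero_mem _
  | add D E _ _ hD hE => rw [map_add]; exact add_mem hD hE
  | mul D E hD' _ hD hE =>
    rw [dEnd_mul]
    exact add_mem (mul_mem hD (by assumption)) (mul_mem (parity_conj_mem hD') hE)

variable (P) in
/-- The dg algebra `D_P` of differential operators on the polynomial dg algebra `P`, with the
differential `[d, ·]`, an operator having degree `n` if it raises degrees by `n`
(so that `deg ∂_x = -deg x`). -/
noncomputable def diffOpAlg : DGAlg.{u} where
  carrier := P.diffOps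
  grading := P.diffOpsDeg
  d := P.dEnd.restrict (p := Subalgebra.toSubmodule P.diffOps)
    (q := Subalgebra.toSubmodule P.diffOps) (fun _ h => dEnd_mem h)
  d_mem h := dEnd_mem_opDeg h
  d_d D := Subtype.ext (dEnd_dEnd D.1)
  leibniz {n D} hD E := Subtype.ext (by
    have h : D.1 ∈ P.opDeg n := hD
    have := dEnd_mul D.1 E.1
    rw [parity_conj_of_mem h, smul_mul_assoc] at this
    exact this)

/-- The operator on `P` underlying an element of `D_P`. -/
def op (D : P.diffOpAlg) : Module.End ℂ P := Subtype.val (p := (· ∈ P.diffOps)) D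

end DiffOps

end DGAlg

/-- `D ∈ D_P` and `E ∈ D_Q` are compatible along `f : P ⟶ Q` if `f ∘ D = E ∘ f`. -/
def DGAlg.Intertwines {P Q : DGAlg.{u}} (f : P ⟶ Q) (D : P.diffOpAlg) (E : Q.diffOpAlg) : Prop :=
  ∀ p : P, DGAlg.alg f (DGAlg.op D p) = DGAlg.op E (DGAlg.alg f p)

/-- A functor `A ↦ D_P` from the homotopy category of commutative dg algebras (that have a finitely
generated polynomial resolution) and isomorphisms to the homotopy category of dg algebras and
isomorphisms. Its value at `A` is identified with `D_P` for every resolution `P → A`, and its action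
on an isomorphism `φ` that is represented by `f : P ⟶ Q` is transport of differential operators along
`f`: for dg algebra maps `s : E ⟶ D_P` and `t : E ⟶ D_Q` with `f ∘ s(e) = t(e) ∘ f` for all `e`, it
carries `s` to `t`. -/
structure DiffOpFunctor where
  functor : Core CDGAlg.HoRes.{u} ⥤ Core DGAlg.Ho.{u}
  comparison : ∀ (A : CDGAlg.hasResolution.{u}.FullSubcategory) (p : A.obj.Resolution),
    (functor.obj ⟨A⟩).of ≅ DGAlg.toHo.obj p.P.obj.diffOpAlg
  transport : ∀ {A B : CDGAlg.hasResolution.{u}.FullSubcategory}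
    (p : A.obj.Resolution) (q : B.obj.Resolution)
    (φ : (⟨A⟩ : Core CDGAlg.HoRes.{u}) ⟶ ⟨B⟩) (f : p.P ⟶ q.P),
    CDGAlg.toHo.map p.π ≫ φ.iso.hom.hom = CDGAlg.toHo.map f ≫ CDGAlg.toHo.map q.π →
    ∀ (E : DGAlg.{u}) (s : E ⟶ p.P.obj.diffOpAlg) (t : E ⟶ q.P.obj.diffOpAlg),
      (∀ e : E, DGAlg.Intertwines f.hom (DGAlg.alg s e) (DGAlg.alg t e)) →
      DGAlg.toHo.map s ≫ (comparison A p).inv ≫ (functor.map φ).iso.hom ≫ (comparison B q).hom =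
        DGAlg.toHo.map t

/-! Let f : P → Q be a quasi-isomorphism of finitely generated polynomial dg algebras. Operators do
not move along f, but `P.diffOpAlg` and `Q.diffOpAlg` both map to the complex `DiffAlong f` of
differential operators from P to Q, by A ↦ f ∘ A and D ↦ D ∘ f. Once both maps are known to be
quasi-isomorphisms, the dg algebra `triangular` of triples (A, H, D), with H a homotopy between f ∘
A and D ∘ f, projects to both sides by quasi-isomorphisms. This span is the zigzag of the theorem,
and in the homotopy category it is an isomorphism `transfer`.

The map A ↦ f ∘ A: operators along h : P → M have a unique normal form ∑ mₐ h ∂^a, and the bracket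
of d with ∂_i only involves those ∂_j with deg x_j < deg x_i. For a suitable filtration by weight
the differential on the graded pieces is therefore d_M acting on coefficients, and a
quasi-isomorphism M → N stays one on operators (`coneAcyclic_post`).

The map D ↦ D ∘ f: if f adjoins contractible pairs w, dw, an explicit contraction exists, because
operators decompose under the bracket with the Euler derivation e = [d, s], where s(dw) = w
(`Extension.preAcyclic_i`). Hence the property is invariant under homotopies parametrized by
cylinders. A quasi-isomorphism between polynomial algebras has a homotopy inverse, and a
two-out-of-six argument concludes (`dualAcyclic_of_quasiIso`).

The homotopy theory needed is obtained by hand. Cylinders, constructed on generators by descending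
degree, lift maps and homotopies along quasi-isomorphisms; hence maps out of P in the localization
are exactly homotopy classes of dg maps (`exists_toHo_map_eq`, `leftHomotopic_of_toHo_eq`).

Functoriality and uniqueness both rest on strict maps, those for which pairs of operators agreeing
exactly along f already suffice to represent `P.diffOpAlg` up to quasi-isomorphism. If f is strict,
a homotopy for g restricts to one for f ≫ g, which gives the composition law. Every
quasi-isomorphism factors through a mapping cylinder into a free inclusion and a retraction, both
strict (`exists_strict_factorization`). Homotopic maps have the same transfer, since the two ends of
a cylinder are sections of one retraction. Conversely the transport law determines a functor on
strict maps, hence on all isomorphisms (`DiffOpFunctor.move_eq`). -/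

section Complexes

/-! ### Chain maps with acyclic cone and their cancellation properties. -/

variable {V W U : Type*} [AddCommGroup V] [Module ℂ V] [AddCommGroup W] [Module ℂ W]
  [AddCommGroup U] [Module ℂ U]

/-- A chain map `φ` with acyclic mapping cone. -/
def ConeAcyclic (dV : V →ₗ[ℂ] V) (dW : W →ₗ[ℂ] W) (φ : V →ₗ[ℂ] W) : Prop :=
  ∀ v w, dV v = 0 → φ v = dW w → ∃ v' w', dV v' = v ∧ φ v' + dW w' = w

/-- `φ` is injective on cohomology. -/
def InjectiveOnCohomology (dV : V →ₗ[ℂ] V) (dW : W →ₗ[ℂ] W) (φ : V →ₗ[ℂ] W) : Prop :=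
  ∀ v w, dV v = 0 → φ v = dW w → ∃ v', dV v' = v

/-- `φ` is surjective on cohomology. -/
def SurjectiveOnCohomology (dV : V →ₗ[ℂ] V) (dW : W →ₗ[ℂ] W) (φ : V →ₗ[ℂ] W) : Prop :=
  ∀ w, dW w = 0 → ∃ v w', dV v = 0 ∧ φ v + dW w' = w

variable {dV : V →ₗ[ℂ] V} {dW : W →ₗ[ℂ] W} {dU : U →ₗ[ℂ] U} {φ : V →ₗ[ℂ] W} {ψ : W →ₗ[ℂ] U}

lemma ConeAcyclic.injective (h : ConeAcyclic dV dW φ) : InjectiveOnCohomology dV dW φ := by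
  intro v w hv hw
  obtain ⟨v', _, h', _⟩ := h v w hv hw
  exact ⟨v', h'⟩

lemma ConeAcyclic.surjective (h : ConeAcyclic dV dW φ) : SurjectiveOnCohomology dV dW φ := by
  intro w hw
  obtain ⟨v', w', h1, h2⟩ := h 0 w (map_zero _) (by rw [map_zero, hw])
  exact ⟨v', w', h1, h2⟩

/-- After v is written as a boundary of v', the remaining error w - φ v' is a cocycle, and
surjectivity absorbs it. The cone condition treats both halves of a quasi-isomorphism at once, which
suits the later induction over a filtration. -/
lemma coneAcyclic_of (hφ : ∀ v, φ (dV v) = dW (φ v)) (hi : InjectiveOnCohomology dV dW φ)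
    (hs : SurjectiveOnCohomology dV dW φ) : ConeAcyclic dV dW φ := by
  intro v w hv hw
  obtain ⟨v', rfl⟩ := hi v w hv hw
  obtain ⟨v'', w', h1, h2⟩ := hs (w - φ v') (by rw [map_sub, ← hw, hφ, sub_self])
  exact ⟨v' + v'', w', by rw [map_add, h1, add_zero], by
    rw [map_add, add_assoc, h2]; abel⟩

/-- The two halves are separated for the two-out-of-six argument, where injectivity comes from one
composite and surjectivity from the other. -/
lemma InjectiveOnCohomology.of_comp (hψ : ∀ v, ψ (dW v) = dU (ψ v))
    (h : InjectiveOnCohomology dV dU (ψ ∘ₗ φ)) : InjectiveOnCohomology dV dW φ := by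
  intro v w hv hw
  exact h v (ψ w) hv (by rw [LinearMap.comp_apply, hw, hψ])

lemma SurjectiveOnCohomology.of_comp (hφ : ∀ v, φ (dV v) = dW (φ v))
    (h : SurjectiveOnCohomology dV dU (ψ ∘ₗ φ)) : SurjectiveOnCohomology dW dU ψ := by
  intro w hw
  obtain ⟨v, w', h1, h2⟩ := h w hw
  exact ⟨φ v, w', by rw [← hφ, h1, map_zero], h2⟩

lemma ConeAcyclic.comp (hφ : ∀ v, φ (dV v) = dW (φ v)) (hψ : ∀ v, ψ (dW v) = dU (ψ v))
    (h1 : ConeAcyclic dV dW φ) (h2 : ConeAcyclic dW dU ψ) : ConeAcyclic dV dU (ψ ∘ₗ φ) := by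
  refine coneAcyclic_of (fun v => by simp [hφ, hψ]) (fun v w hv hw => ?_) (fun w hw => ?_)
  · obtain ⟨v', hv'⟩ := h2.injective (φ v) w (by rw [← hφ, hv, map_zero]) hw
    exact h1.injective v v' hv hv'.symm
  · obtain ⟨v, w', h3, h4⟩ := h2.surjective w hw
    obtain ⟨v', w'', h5, h6⟩ := h1.surjective v h3
    refine ⟨v', w' + ψ w'', h5, ?_⟩
    rw [LinearMap.comp_apply, ← h4, ← h6, map_add, map_add, hψ]; abel

lemma ConeAcyclic.of_comp_left (hφ : ∀ v, φ (dV v) = dW (φ v)) (hψ : ∀ v, ψ (dW v) = dU (ψ v))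
    (h2 : ConeAcyclic dW dU ψ) (h : ConeAcyclic dV dU (ψ ∘ₗ φ)) : ConeAcyclic dV dW φ := by
  refine coneAcyclic_of hφ (h.injective.of_comp hψ) fun w hw => ?_
  obtain ⟨v, u, h3, h4⟩ := h.surjective (ψ w) (by rw [← hψ, hw, map_zero])
  obtain ⟨w', hw'⟩ := h2.injective (w - φ v) u (by rw [map_sub, hw, ← hφ, h3]; simp)
    (by rw [map_sub, ← h4, LinearMap.comp_apply]; abel)
  exact ⟨v, w', h3, by rw [hw']; abel⟩

lemma ConeAcyclic.of_comp_right (hφ : ∀ v, φ (dV v) = dW (φ v)) (hψ : ∀ v, ψ (dW v) = dU (ψ v))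
    (h1 : ConeAcyclic dV dW φ) (h : ConeAcyclic dV dU (ψ ∘ₗ φ)) : ConeAcyclic dW dU ψ := by
  refine coneAcyclic_of hψ (fun w u hw hu => ?_) (h.surjective.of_comp hφ)
  obtain ⟨v, w', h3, h4⟩ := h1.surjective w hw
  obtain ⟨v', hv'⟩ := h.injective v (u - ψ w') h3
    (by rw [map_sub, ← hu, ← h4, map_add, LinearMap.comp_apply, hψ]; abel)
  exact ⟨φ v' + w', by rw [map_add, ← hφ, hv', h4]⟩

/-- A surjective chain map with acyclic kernel is a quasi-isomorphism. -/
lemma coneAcyclic_of_surjective (hφ : ∀ v, φ (dV v) = dW (φ v)) (hd : ∀ v, dV (dV v) = 0)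
    (hs : Function.Surjective φ)
    (hk : ∀ v, φ v = 0 → dV v = 0 → ∃ v', φ v' = 0 ∧ dV v' = v) : ConeAcyclic dV dW φ := by
  intro v w hv hw
  obtain ⟨x, rfl⟩ := hs w
  obtain ⟨v', h1, h2⟩ := hk (v - dV x) (by rw [map_sub, hw, hφ, sub_self])
    (by rw [map_sub, hv, hd, sub_zero])
  exact ⟨x + v', 0, by rw [map_add, h2]; abel, by rw [map_add, h1]; simp⟩

/-- A primitive v' from the cone condition has φ v' exact; surjectivity of φ lifts the correcting
element, whose boundary moves v' into the kernel. -/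
lemma ConeAcyclic.kernel (h : ConeAcyclic dV dW φ) (hφ : ∀ v, φ (dV v) = dW (φ v))
    (hs : Function.Surjective φ) (hd : ∀ v, dV (dV v) = 0)
    (v : V) (h0 : φ v = 0) (hv : dV v = 0) : ∃ v', φ v' = 0 ∧ dV v' = v := by
  obtain ⟨v', w', h1, h2⟩ := h v 0 hv (by rw [h0, map_zero])
  obtain ⟨x, rfl⟩ := hs w'
  exact ⟨v' + dV x, by rw [map_add, hφ, h2], by rw [map_add, h1, hd, add_zero]⟩

lemma coneAcyclic_id : ConeAcyclic dV dV LinearMap.id := by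
  intro v w _ hw
  exact ⟨w, 0, hw.symm, by simp⟩

end Complexes

/-! ### Internal gradings and signs. -/

section Graded

/-- The maps π read off the coefficients of a finite sum, which forces independence. All gradings on
constructed algebras below come from this criterion, except that on free algebras. -/
lemma isInternal_of_components {V : Type*} [AddCommGroup V] [Module ℂ V]
    (𝒜 : ℤ → Submodule ℂ V) (π : ℤ → V →ₗ[ℂ] V) (h1 : ∀ n v, v ∈ 𝒜 n → π n v = v)
    (h2 : ∀ n k v, v ∈ 𝒜 n → k ≠ n → π k v = 0) (h3 : ∀ v, v ∈ ⨆ n, 𝒜 n) :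
    DirectSum.IsInternal 𝒜 := by
  refine DirectSum.isInternal_submodule_of_iSupIndep_of_iSup_eq_top
    (iSupIndep_of_dfinsupp_lsum_injective _ ?_) (eq_top_iff.2 fun v _ => h3 v)
  have key : ∀ (x : Π₀ n, 𝒜 n) (k : ℤ),
      π k (DFinsupp.lsum ℕ (fun i => (𝒜 i).subtype) x) = x k := by
    intro x k
    induction x using DFinsupp.induction with
    | h0 => simp
    | ha i b f _ _ ih =>
      rw [map_add, map_add, ih, DFinsupp.add_apply, Submodule.coe_add]
      congr 1
      simp only [DFinsupp.lsum_single]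
      by_cases h : k = i
      · subst h
        rw [DFinsupp.single_eq_same]
        exact h1 _ _ b.2
      · rw [DFinsupp.single_eq_of_ne h]
        exact h2 i k _ b.2 h
  intro x y hxy
  ext k
  rw [← key, ← key, hxy]

end Graded

lemma neg_one_zpow_even {n : ℤ} (h : Even n) : (-1 : ℂ) ^ n = 1 := h.neg_one_zpow

lemma neg_one_zpow_odd {n : ℤ} (h : Odd n) : (-1 : ℂ) ^ n = -1 := h.neg_one_zpow

lemma neg_one_zpow_add (m n : ℤ) : (-1 : ℂ) ^ (m + n) = (-1 : ℂ) ^ m * (-1 : ℂ) ^ n :=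
  zpow_add₀ (by norm_num) _ _

lemma neg_one_zpow_congr {m n : ℤ} (h : Even (m - n)) : (-1 : ℂ) ^ m = (-1 : ℂ) ^ n := by
  have : m = (m - n) + n := by ring
  rw [this, neg_one_zpow_add, neg_one_zpow_even h, one_mul]

lemma neg_one_zpow_ne_zero (n : ℤ) : (-1 : ℂ) ^ n ≠ 0 := zpow_ne_zero _ (by norm_num)

/-! ### Homogeneous components, quasi-isomorphisms, and derivations along a map. -/

namespace DGAlg

/-- Graded commutativity. -/
def IsComm (A : DGAlg.{u}) : Prop :=
  ∀ (m n : ℤ) (a b : A), a ∈ A.grading m → b ∈ A.grading n → a * b = (-1 : ℂ) ^ (m * n) • (b * a)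

variable {A B C : DGAlg.{u}}

lemma linear_induction (p : A → Prop) (h0 : p 0) (h1 : ∀ n a, a ∈ A.grading n → p a)
    (h2 : ∀ a b, p a → p b → p (a + b)) (a : A) : p a := by
  induction a using DirectSum.Decomposition.inductionOn A.grading with
  | zero => exact h0
  | homogeneous a => exact h1 _ _ a.2
  | add a b ha hb => exact h2 _ _ ha hb

/-- The homogeneous component of degree `n`. -/
noncomputable def comp (A : DGAlg.{u}) (n : ℤ) : A →ₗ[ℂ] A :=
  (A.grading n).subtype ∘ₗ DirectSum.component ℂ ℤ (fun i => A.grading i) n ∘ₗ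
    (DirectSum.decomposeLinearEquiv A.grading).toLinearMap

lemma comp_apply (n : ℤ) (a : A) : A.comp n a = DirectSum.decompose A.grading a n := rfl

lemma comp_mem (n : ℤ) (a : A) : A.comp n a ∈ A.grading n := by
  rw [comp_apply]; exact Subtype.mem _

lemma comp_of_mem {n : ℤ} {a : A} (h : a ∈ A.grading n) : A.comp n a = a := by
  rw [comp_apply, DirectSum.decompose_of_mem_same _ h]

lemma comp_of_mem_ne {n k : ℤ} {a : A} (h : a ∈ A.grading n) (hk : k ≠ n) : A.comp k a = 0 := by
  rw [comp_apply, DirectSum.decompose_of_mem_ne _ h hk.symm]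

lemma linearMap_ext {V : Type*} [AddCommGroup V] [Module ℂ V] {f g : A →ₗ[ℂ] V}
    (h : ∀ n a, a ∈ A.grading n → f a = g a) : f = g := by
  ext a
  refine linear_induction (fun a => f a = g a) (by simp) h (fun a b ha hb => ?_) a
  rw [map_add, map_add, ha, hb]

lemma comp_map {f : A →ₗ[ℂ] B} {k : ℤ} (hf : ∀ n a, a ∈ A.grading n → f a ∈ B.grading (n + k))
    (n : ℤ) (a : A) : B.comp (n + k) (f a) = f (A.comp n a) := by
  refine LinearMap.congr_fun (f := B.comp (n + k) ∘ₗ f) (g := f ∘ₗ A.comp n)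
    (linearMap_ext fun m a ha => ?_) a
  simp only [LinearMap.comp_apply]
  by_cases h : n = m
  · subst h; rw [comp_of_mem ha, comp_of_mem (hf _ _ ha)]
  · rw [comp_of_mem_ne ha h, map_zero, comp_of_mem_ne (hf _ _ ha) (by omega)]

lemma comp_d (n : ℤ) (a : A) : A.comp (n + 1) (A.d a) = A.d (A.comp n a) :=
  comp_map (fun _ _ h => A.d_mem h) n a

lemma eq_of_comp_eq {a b : A} (h : ∀ n, A.comp n a = A.comp n b) : a = b := by
  apply (DirectSum.decompose A.grading).injective
  ext n
  exact h n

lemma mem_grading_of_comp {a : A} {n : ℤ} (h : A.comp n a = a) : a ∈ A.grading n :=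
  h ▸ comp_mem n a

lemma one_mem_grading : (1 : A) ∈ A.grading 0 := SetLike.one_mem_graded _

lemma mul_mem_grading {m n : ℤ} {a b : A} (ha : a ∈ A.grading m) (hb : b ∈ A.grading n) :
    a * b ∈ A.grading (m + n) := SetLike.mul_mem_graded ha hb

/-- A degree preserving algebra homomorphism. -/
def IsGraded (f : A →ₐ[ℂ] B) : Prop := ∀ n a, a ∈ A.grading n → f a ∈ B.grading n

lemma isGraded_alg (f : A ⟶ B) : IsGraded (alg f) := fun _ _ h => Hom.map_mem f h

lemma IsGraded.comp {g : B →ₐ[ℂ] C} {f : A →ₐ[ℂ] B} (hg : IsGraded g) (hf : IsGraded f) :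
    IsGraded (g.comp f) := fun _ _ h => hg _ _ (hf _ _ h)

lemma isGraded_id : IsGraded (AlgHom.id ℂ A) := fun _ _ h => h

lemma alg_d (f : A ⟶ B) (a : A) : alg f (A.d a) = B.d (alg f a) := Hom.map_d f a

@[simp] lemma alg_id : alg (𝟙 A) = AlgHom.id ℂ A := rfl

@[simp] lemma alg_comp (f : A ⟶ B) (g : B ⟶ C) : alg (f ≫ g) = (alg g).comp (alg f) := rfl

lemma hom_ext {f g : A ⟶ B} (h : ∀ a, alg f a = alg g a) : f = g :=
  Hom.ext (AlgHom.ext h)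

/-- The morphism of dg algebras given by a graded algebra map commuting with `d`. -/
def ofAlg (f : A →ₐ[ℂ] B) (hf : IsGraded f) (hd : ∀ a, f (A.d a) = B.d (f a)) : A ⟶ B :=
  (⟨f, fun h => hf _ _ h, hd⟩ : Hom A B)

@[simp] lemma alg_ofAlg (f : A →ₐ[ℂ] B) (hf : IsGraded f) (hd : ∀ a, f (A.d a) = B.d (f a)) :
    alg (ofAlg f hf hd) = f := rfl

lemma quasiIso_iff (f : A ⟶ B) : quasiIso f ↔ ConeAcyclic A.d B.d (alg f).toLinearMap := by
  have hmk : ∀ (a : LinearMap.ker A.d), cohomologyMap f (Submodule.Quotient.mk a) =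
    Submodule.Quotient.mk ⟨alg f a, by
      rw [LinearMap.mem_ker, ← alg_d, LinearMap.mem_ker.1 a.2, map_zero]⟩ := fun a => rfl
  constructor
  · rintro ⟨hi, hs⟩
    refine coneAcyclic_of (fun v => alg_d f v) (fun v w hv hw => ?_) (fun w hw => ?_)
    · have h0 : (Submodule.Quotient.mk ⟨v, hv⟩ : A.Cohomology) = 0 := by
        apply hi
        rw [map_zero, hmk, Submodule.Quotient.mk_eq_zero]
        exact ⟨w, hw.symm⟩
      rw [Submodule.Quotient.mk_eq_zero] at h0
      obtain ⟨v', h'⟩ := h0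
      exact ⟨v', h'⟩
    · obtain ⟨x, hx⟩ := hs (Submodule.Quotient.mk ⟨w, hw⟩)
      obtain ⟨⟨v, hv⟩, rfl⟩ := Submodule.Quotient.mk_surjective _ x
      rw [hmk, eq_comm, Submodule.Quotient.eq] at hx
      obtain ⟨w', h'⟩ := hx
      refine ⟨v, w', hv, ?_⟩
      have : B.d w' = w - alg f v := h'
      rw [this]
      simp
  · intro h
    constructor
    · rw [injective_iff_map_eq_zero]
      intro x hx
      obtain ⟨⟨v, hv⟩, rfl⟩ := Submodule.Quotient.mk_surjective _ x
      rw [hmk, Submodule.Quotient.mk_eq_zero] at hx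
      obtain ⟨w, hw⟩ := hx
      obtain ⟨v', h'⟩ := h.injective v w hv hw.symm
      rw [Submodule.Quotient.mk_eq_zero]
      exact ⟨v', h'⟩
    · intro y
      obtain ⟨⟨w, hw⟩, rfl⟩ := Submodule.Quotient.mk_surjective _ y
      obtain ⟨v, w', h1, h2⟩ := h.surjective w hw
      refine ⟨Submodule.Quotient.mk ⟨v, h1⟩, ?_⟩
      rw [hmk, eq_comm, Submodule.Quotient.eq]
      exact ⟨w', show B.d w' = w - alg f v by rw [← h2]; simp⟩

/-- A homogeneous form of acyclicity of the cone. -/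
lemma homogeneous_of_quasiIso {f : A ⟶ B} (hf : quasiIso f) {n : ℤ} {a : A} {b : B}
    (ha : a ∈ A.grading (n + 1)) (hb : b ∈ B.grading n) (h0 : A.d a = 0) (h : alg f a = B.d b) :
    ∃ a' ∈ A.grading n, ∃ b' ∈ B.grading (n - 1), A.d a' = a ∧ alg f a' + B.d b' = b := by
  obtain ⟨a', b', h1, h2⟩ := (quasiIso_iff f).1 hf a b h0 h
  -- The solution provided by the cone need not be homogeneous; since d and f are, its components of
  -- degrees n and n - 1 solve the same equations.
  refine ⟨A.comp n a', comp_mem _ _, B.comp (n - 1) b', comp_mem _ _, ?_, ?_⟩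
  · rw [← comp_d, h1, comp_of_mem ha]
  · have h3 := comp_map (f := (alg f).toLinearMap) (k := 0)
      (fun n a h => by rw [add_zero]; exact isGraded_alg f _ _ h) n a'
    simp only [add_zero, AlgHom.toLinearMap_apply] at h3 h2
    have h4 := comp_d (n - 1) b'
    rw [sub_add_cancel] at h4
    rw [← h3, ← h4, ← map_add, h2, comp_of_mem hb]

lemma quasiIso_comp {f : A ⟶ B} {g : B ⟶ C} (hf : quasiIso f) (hg : quasiIso g) :
    quasiIso (f ≫ g) := by
  rw [quasiIso_iff] at *
  exact hf.comp (fun v => alg_d f v) (fun v => alg_d g v) hg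

lemma quasiIso_of_comp_right {f : A ⟶ B} {g : B ⟶ C} (hf : quasiIso f) (h : quasiIso (f ≫ g)) :
    quasiIso g := by
  rw [quasiIso_iff] at *
  exact hf.of_comp_right (fun v => alg_d f v) (fun v => alg_d g v) h

lemma quasiIso_of_comp_left {f : A ⟶ B} {g : B ⟶ C} (hg : quasiIso g) (h : quasiIso (f ≫ g)) :
    quasiIso f := by
  rw [quasiIso_iff] at *
  exact hg.of_comp_left (fun v => alg_d f v) (fun v => alg_d g v) h

lemma quasiIso_id (A : DGAlg.{u}) : quasiIso (𝟙 A) := by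
  rw [quasiIso_iff]
  exact coneAcyclic_id

/-- The operator `a ↦ (-1)^{n deg a} a`. -/
noncomputable def twist (A : DGAlg.{u}) (n : ℤ) : A →ₗ[ℂ] A := if Even n then LinearMap.id else A.parity

lemma twist_of_mem (n : ℤ) {m : ℤ} {a : A} (h : a ∈ A.grading m) :
    A.twist n a = (-1 : ℂ) ^ (n * m) • a := by
  unfold twist
  split_ifs with hn
  · rw [neg_one_zpow_even (hn.mul_right m)]; simp
  · rw [parity_of_mem h]
    congr 1
    apply neg_one_zpow_congr
    rw [Int.not_even_iff_odd] at hn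
    obtain ⟨k, rfl⟩ := hn
    exact ⟨-(k * m), by ring⟩

lemma twist_mem (n : ℤ) {m : ℤ} {a : A} (h : a ∈ A.grading m) : A.twist n a ∈ A.grading m := by
  rw [twist_of_mem n h]; exact Submodule.smul_mem _ _ h

lemma twist_mul (n : ℤ) (a b : A) : A.twist n (a * b) = A.twist n a * A.twist n b := by
  refine linear_induction (fun a => A.twist n (a * b) = A.twist n a * A.twist n b) (by simp)
    (fun k a ha => ?_) (fun a a' h h' => by rw [add_mul, map_add, h, h', map_add, add_mul]) a
  refine linear_induction (fun b => A.twist n (a * b) = A.twist n a * A.twist n b) (by simp)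
    (fun l b hb => ?_) (fun a a' h h' => by rw [mul_add, map_add, h, h', map_add, mul_add]) b
  rw [twist_of_mem n ha, twist_of_mem n hb, twist_of_mem n (mul_mem_grading ha hb), mul_add,
    neg_one_zpow_add, smul_mul_smul_comm]

lemma twist_one (n : ℤ) : A.twist n 1 = 1 := by
  rw [twist_of_mem n one_mem_grading]; simp

/-- A derivation of degree `n` along a graded algebra map `g`. -/
structure IsDer (g : A →ₐ[ℂ] B) (n : ℤ) (D : A →ₗ[ℂ] B) : Prop where
  mem : ∀ m a, a ∈ A.grading m → D a ∈ B.grading (m + n)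
  leibniz : ∀ (m : ℤ) (a b : A), a ∈ A.grading m →
    D (a * b) = D a * g b + (-1 : ℂ) ^ (n * m) • (g a * D b)

lemma isDerivation_iff {n : ℤ} {D : Module.End ℂ A} :
    A.IsDerivation n D ↔ IsDer (AlgHom.id ℂ A) n D :=
  ⟨fun h => ⟨h.1, h.2⟩, fun h => ⟨h.1, h.2⟩⟩

lemma IsDer.leibniz_id {n : ℤ} {D : Module.End ℂ A} (hD : IsDer (AlgHom.id ℂ A) n D) {m : ℤ}
    {a : A} (ha : a ∈ A.grading m) (b : A) :
    D (a * b) = D a * b + (-1 : ℂ) ^ (n * m) • (a * D b) := hD.leibniz m a b ha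

lemma isDer_d : IsDer (AlgHom.id ℂ A) 1 A.d :=
  ⟨fun _ _ h => A.d_mem h, fun m a b h => by rw [one_mul]; exact A.leibniz h b⟩

/-- With the sign hidden in `twist` the Leibniz rule needs no homogeneity, so that inductions over
generated subalgebras can use it directly. -/
lemma IsDer.mul {g : A →ₐ[ℂ] B} {n : ℤ} {D : A →ₗ[ℂ] B} (hD : IsDer g n D) (a b : A) :
    D (a * b) = D a * g b + g (A.twist n a) * D b := by
  refine linear_induction (fun a => D (a * b) = D a * g b + g (A.twist n a) * D b) (by simp)
    (fun k a ha => ?_) (fun a a' h h' => ?_) a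
  · rw [hD.leibniz _ _ _ ha, twist_of_mem n ha, map_smul, smul_mul_assoc]
  · simp only [map_add, add_mul, h, h']; abel

lemma IsDer.apply_one {g : A →ₐ[ℂ] B} {n : ℤ} {D : A →ₗ[ℂ] B} (hD : IsDer g n D) : D 1 = 0 := by
  have := hD.mul 1 1
  rw [twist_one] at this
  simpa using this

lemma IsDer.eq_on_adjoin {g : A →ₐ[ℂ] B} {n : ℤ} {D E : A →ₗ[ℂ] B} (hD : IsDer g n D)
    (hE : IsDer g n E) {X : Set A} (h : ∀ x ∈ X, D x = E x) {a : A}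
    (ha : a ∈ Algebra.adjoin ℂ X) : D a = E a := by
  induction ha using Algebra.adjoin_induction with
  | mem x hx => exact h x hx
  | algebraMap r =>
    rw [Algebra.algebraMap_eq_smul_one, map_smul, map_smul, hD.apply_one, hE.apply_one]
  | add a b _ _ h1 h2 => rw [map_add, map_add, h1, h2]
  | mul a b _ _ h1 h2 => rw [hD.mul, hE.mul, h1, h2]

lemma IsDer.ext {g : A →ₐ[ℂ] B} {n : ℤ} {D E : A →ₗ[ℂ] B} (hD : IsDer g n D)
    (hE : IsDer g n E) {X : Set A} (hX : Algebra.adjoin ℂ X = ⊤) (h : ∀ x ∈ X, D x = E x) :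
    D = E :=
  LinearMap.ext fun a => hD.eq_on_adjoin hE h (by rw [hX]; trivial)

lemma isDer_zero {g : A →ₐ[ℂ] B} (n : ℤ) : IsDer g n 0 :=
  ⟨fun _ _ _ => zero_mem _, fun _ _ _ _ => by simp⟩

lemma IsDer.add {g : A →ₐ[ℂ] B} {n : ℤ} {D E : A →ₗ[ℂ] B} (hD : IsDer g n D)
    (hE : IsDer g n E) : IsDer g n (D + E) :=
  ⟨fun m a h => add_mem (hD.mem m a h) (hE.mem m a h), fun m a b h => by
    simp only [LinearMap.add_apply, hD.leibniz m a b h, hE.leibniz m a b h, add_mul, mul_add,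
      smul_add]
    abel⟩

lemma IsDer.smul {g : A →ₐ[ℂ] B} {n : ℤ} {D : A →ₗ[ℂ] B} (hD : IsDer g n D) (c : ℂ) :
    IsDer g n (c • D) :=
  ⟨fun m a h => Submodule.smul_mem _ _ (hD.mem m a h), fun m a b h => by
    simp only [LinearMap.smul_apply, hD.leibniz m a b h, smul_add, smul_mul_assoc, mul_smul_comm]
    rw [smul_comm]⟩

lemma isDer_sum {g : A →ₐ[ℂ] B} {n : ℤ} {ι : Type*} (s : Finset ι) (D : ι → A →ₗ[ℂ] B)
    (hD : ∀ i ∈ s, IsDer g n (D i)) : IsDer g n (∑ i ∈ s, D i) := by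
  classical
  induction s using Finset.induction with
  | empty => simpa using isDer_zero n
  | insert i s hi ih =>
    rw [Finset.sum_insert hi]
    exact (hD i (Finset.mem_insert_self _ _)).add
      (ih fun j hj => hD j (Finset.mem_insert_of_mem hj))

/-- Postcomposition with a graded algebra map. -/
lemma IsDer.comp_left {g : A →ₐ[ℂ] B} {n : ℤ} {D : A →ₗ[ℂ] B} (hD : IsDer g n D)
    {f : B →ₐ[ℂ] C} (hf : IsGraded f) : IsDer (f.comp g) n (f.toLinearMap ∘ₗ D) :=
  ⟨fun m a h => hf _ _ (hD.mem m a h), fun m a b h => by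
    simp [hD.leibniz m a b h]⟩

/-- Precomposition with a graded algebra map. -/
lemma IsDer.comp_right {g : B →ₐ[ℂ] C} {n : ℤ} {D : B →ₗ[ℂ] C} (hD : IsDer g n D)
    {f : A →ₐ[ℂ] B} (hf : IsGraded f) : IsDer (g.comp f) n (D ∘ₗ f.toLinearMap) :=
  ⟨fun m a h => hD.mem m _ (hf _ _ h), fun m a b h => by
    simp [hD.leibniz m _ _ (hf _ _ h)]⟩

/-- Left multiplication of a derivation by a homogeneous element. -/
lemma IsDer.mulLeft (hB : IsComm B) {g : A →ₐ[ℂ] B} (hg : IsGraded g) {n k : ℤ} {D : A →ₗ[ℂ] B}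
    (hD : IsDer g n D) {c : B} (hc : c ∈ B.grading k) :
    IsDer g (k + n) (LinearMap.mulLeft ℂ c ∘ₗ D) :=
  ⟨fun m a h => by
    have := mul_mem_grading hc (hD.mem m a h)
    rwa [show m + (k + n) = k + (m + n) by ring], fun m a b h => by
    simp only [LinearMap.comp_apply, LinearMap.mulLeft_apply, hD.leibniz m a b h, mul_add,
      mul_smul_comm, ← mul_assoc]
    -- Moving c past g a costs (-1)^(k m), exactly the change of sign between derivations of degree
    -- n and of degree k + n.
    rw [hB k m c (g a) hc (hg _ _ h), smul_mul_assoc, smul_smul, add_mul, neg_one_zpow_add,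
      mul_comm ((-1 : ℂ) ^ (k * m))]⟩

end DGAlg

namespace DGAlg

variable {A B C : DGAlg.{u}}

/-- The mixed terms D a · E b cancel. This single fact yields d² = 0 on extensions (through [D, D] =
2D²), the Euler derivation, and the supercommutation of partial derivatives. -/
lemma IsDer.commutator {m n : ℤ} {D E : Module.End ℂ A} (hD : IsDer (AlgHom.id ℂ A) m D)
    (hE : IsDer (AlgHom.id ℂ A) n E) :
    IsDer (AlgHom.id ℂ A) (m + n) (D * E - (-1 : ℂ) ^ (m * n) • (E * D)) := by
  refine ⟨fun k a h => ?_, fun k a b h => ?_⟩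
  · refine sub_mem ?_ (Submodule.smul_mem _ _ ?_)
    · have := hD.mem _ _ (hE.mem k a h)
      rwa [show k + (m + n) = k + n + m by ring]
    · have := hE.mem _ _ (hD.mem k a h)
      rwa [show k + (m + n) = k + m + n by ring]
  · simp only [LinearMap.sub_apply, LinearMap.smul_apply, Module.End.mul_apply, AlgHom.coe_id, id]
    rw [hE.leibniz_id h, hD.leibniz_id h, map_add, map_add, map_smul, map_smul,
      hD.leibniz_id (hE.mem _ _ h), hE.leibniz_id (hD.mem _ _ h), hD.leibniz_id h,
      hE.leibniz_id h]
    simp only [mul_add, add_mul, neg_one_zpow_add, smul_add, smul_sub, mul_sub,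
      sub_mul, smul_smul, smul_mul_assoc, mul_smul_comm]
    have hc := neg_one_zpow_sq (m * n)
    have e : (-1 : ℂ) ^ (m * n) * ((-1 : ℂ) ^ (n * k) * (-1 : ℂ) ^ (n * m)) = (-1 : ℂ) ^ (n * k) := by
      rw [mul_left_comm, mul_comm n m, hc, mul_one]
    rw [e]
    module

/-! ### Square zero extensions. -/

section Eps

/-- The carrier of the (twisted) square zero extension `B ⊕ ε B`, `ε` of degree `-n`. -/
def Eps (B : DGAlg.{u}) (_n : ℤ) : Type u := B × B

variable {n : ℤ}

instance : AddCommGroup (Eps B n) := inferInstanceAs (AddCommGroup (B × B))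
instance : Module ℂ (Eps B n) := inferInstanceAs (Module ℂ (B × B))
-- The second coordinate is the Leibniz rule of degree n, so that a ↦ (g a, D a) is multiplicative
-- precisely when D is a derivation along g.
noncomputable instance : Mul (Eps B n) :=
  ⟨fun x y => (x.1 * y.1, x.2 * y.1 + B.twist n x.1 * y.2)⟩
instance : One (Eps B n) := ⟨((1 : B), (0 : B))⟩

lemma Eps.ext {x y : Eps B n} (h1 : x.1 = y.1) (h2 : x.2 = y.2) : x = y := Prod.ext h1 h2

@[simp] lemma Eps.mul_fst (x y : Eps B n) : (x * y).1 = x.1 * y.1 := rfl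
@[simp] lemma Eps.mul_snd (x y : Eps B n) : (x * y).2 = x.2 * y.1 + B.twist n x.1 * y.2 := rfl
@[simp] lemma Eps.one_fst : (1 : Eps B n).1 = 1 := rfl
@[simp] lemma Eps.one_snd : (1 : Eps B n).2 = 0 := rfl
@[simp] lemma Eps.add_fst (x y : Eps B n) : (x + y).1 = x.1 + y.1 := rfl
@[simp] lemma Eps.add_snd (x y : Eps B n) : (x + y).2 = x.2 + y.2 := rfl
@[simp] lemma Eps.zero_fst : (0 : Eps B n).1 = 0 := rfl
@[simp] lemma Eps.zero_snd : (0 : Eps B n).2 = 0 := rfl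
@[simp] lemma Eps.smul_fst (c : ℂ) (x : Eps B n) : (c • x).1 = c • x.1 := rfl
@[simp] lemma Eps.smul_snd (c : ℂ) (x : Eps B n) : (c • x).2 = c • x.2 := rfl

noncomputable instance : Ring (Eps B n) :=
  { (inferInstance : AddCommGroup (Eps B n)), (inferInstance : Mul (Eps B n)),
    (inferInstance : One (Eps B n)) with
    left_distrib := fun x y z => Eps.ext (by simp [mul_add]) (by simp [mul_add]; abel)
    right_distrib := fun x y z => Eps.ext (by simp [add_mul]) (by simp [add_mul]; abel)
    zero_mul := fun x => Eps.ext (by simp) (by simp)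
    mul_zero := fun x => Eps.ext (by simp) (by simp)
    mul_assoc := fun x y z => Eps.ext (by simp [mul_assoc])
      (by simp [mul_add, add_mul, mul_assoc, twist_mul]; abel)
    one_mul := fun x => Eps.ext (by simp) (by simp [twist_one])
    mul_one := fun x => Eps.ext (by simp) (by simp) }

noncomputable instance : Algebra ℂ (Eps B n) :=
  Algebra.ofModule (fun c x y => Eps.ext (by simp) (by simp))
    (fun c x y => Eps.ext (by simp) (by simp))

/-- The homogeneous elements of `B ⊕ ε B`. -/
def epsGrading (B : DGAlg.{u}) (n m : ℤ) : Submodule ℂ (Eps B n) where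
  carrier := {x | x.1 ∈ B.grading m ∧ x.2 ∈ B.grading (m + n)}
  add_mem' hx hy := ⟨add_mem hx.1 hy.1, add_mem hx.2 hy.2⟩
  zero_mem' := ⟨zero_mem _, zero_mem _⟩
  smul_mem' c _ hx := ⟨Submodule.smul_mem _ c hx.1, Submodule.smul_mem _ c hx.2⟩

instance : SetLike.GradedMonoid (epsGrading B n) where
  one_mem := ⟨one_mem_grading, zero_mem _⟩
  mul_mem k l x y hx hy := ⟨mul_mem_grading hx.1 hy.1, add_mem
    (by have := mul_mem_grading hx.2 hy.1; rwa [show k + l + n = k + n + l by ring])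
    (by have := mul_mem_grading (twist_mem n hx.1) hy.2; rwa [show k + l + n = k + (l + n) by ring])⟩

lemma eps_isInternal : DirectSum.IsInternal (epsGrading B n) := by
  let π : ℤ → Eps B n →ₗ[ℂ] Eps B n := fun m => (B.comp m).prodMap (B.comp (m + n))
  refine isInternal_of_components _ π (fun m x hx => ?_) (fun m k x hx hk => ?_) (fun x => ?_)
  · exact Eps.ext (comp_of_mem hx.1) (comp_of_mem hx.2)
  · exact Eps.ext (comp_of_mem_ne hx.1 hk) (comp_of_mem_ne hx.2 (by omega))
  · let l1 : B →ₗ[ℂ] Eps B n := LinearMap.inl ℂ B.carrier B.carrier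
    let l2 : B →ₗ[ℂ] Eps B n := LinearMap.inr ℂ B.carrier B.carrier
    have e : x = l1 x.1 + l2 x.2 := Eps.ext
      (by change _ = x.1 + 0; simp) (by change _ = 0 + x.2; simp)
    rw [e]
    refine add_mem (linear_induction (fun b => l1 b ∈ ⨆ m, epsGrading B n m)
      ?_ (fun m b hb => ?_) (fun a b ha hb => ?_) _)
      (linear_induction (fun b => l2 b ∈ ⨆ m, epsGrading B n m)
      ?_ (fun m b hb => ?_) (fun a b ha hb => ?_) _)
    · rw [map_zero]; exact zero_mem _
    · exact Submodule.mem_iSup_of_mem m ⟨hb, zero_mem _⟩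
    · rw [map_add]; exact add_mem ha hb
    · rw [map_zero]; exact zero_mem _
    · exact Submodule.mem_iSup_of_mem (m - n) ⟨zero_mem _, by rw [sub_add_cancel]; exact hb⟩
    · rw [map_add]; exact add_mem ha hb

/-- The square zero extension `B ⊕ ε B` with zero differential. -/
noncomputable def epsAlg (B : DGAlg.{u}) (n : ℤ) : DGAlg.{u} where
  carrier := Eps B n
  grading := epsGrading B n
  graded := { (inferInstance : SetLike.GradedMonoid (epsGrading B n)),
    eps_isInternal.chooseDecomposition with }
  d := 0
  d_mem _ := zero_mem _
  d_d _ := rfl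
  leibniz _ _ := by simp

lemma epsAlg_isComm (hB : IsComm B) : IsComm (epsAlg B n) := by
  intro k l x y hx hy
  refine Eps.ext (n := n) (hB k l _ _ hx.1 hy.1) ?_
  change x.2 * y.1 + B.twist n x.1 * y.2 = (-1 : ℂ) ^ (k * l) • (y.2 * x.1 + B.twist n y.1 * x.2)
  rw [twist_of_mem n hx.1, twist_of_mem n hy.1, hB _ _ _ _ hx.2 hy.1, smul_mul_assoc,
    hB _ _ _ _ hx.1 hy.2, smul_mul_assoc, smul_add, smul_smul, smul_smul, add_comm]
  congr 2
  · rw [← neg_one_zpow_add]; exact neg_one_zpow_congr ⟨n * k, by ring⟩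
  · rw [← neg_one_zpow_add]; exact neg_one_zpow_congr ⟨0, by ring⟩

end Eps

/-- As a graded algebra, `A` is the free graded-commutative algebra on elements `x i` of degree
`deg i`. -/
structure IsFree (A : DGAlg.{u}) {ι : Type} (deg : ι → ℤ) (x : ι → A) : Prop where
  mem : ∀ i, x i ∈ A.grading (deg i)
  adjoin_eq_top : Algebra.adjoin ℂ (Set.range x) = ⊤
  lift : ∀ B : DGAlg.{u}, B.IsComm → ∀ b : ι → B, (∀ i, b i ∈ B.grading (deg i)) →
    ∃ F : A →ₐ[ℂ] B, IsGraded F ∧ ∀ i, F (x i) = b i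

/-! ### Derivations out of free graded-commutative algebras. -/

section IsFree

variable {ι : Type} {deg : ι → ℤ} {x : ι → A}

lemma IsFree.algHom_ext (hA : IsFree A deg x) {R : Type*} [Semiring R] [Algebra ℂ R]
    {f g : A →ₐ[ℂ] R} (h : ∀ i, f (x i) = g (x i)) : f = g := by
  refine AlgHom.ext_of_adjoin_eq_top hA.adjoin_eq_top ?_
  rintro _ ⟨i, rfl⟩
  exact h i

/-- A derivation along g is the second coordinate of an algebra map into the square zero extension,
and such a map is given freely on generators. Differentials play no role here. -/
lemma IsFree.exists_isDer (hA : IsFree A deg x) (hB : IsComm B) {g : A →ₐ[ℂ] B} (hg : IsGraded g)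
    (n : ℤ) (y : ι → B) (hy : ∀ i, y i ∈ B.grading (deg i + n)) :
    ∃ D : A →ₗ[ℂ] B, IsDer g n D ∧ ∀ i, D (x i) = y i := by
  obtain ⟨F, hF, hFx⟩ := hA.lift (epsAlg B n) (epsAlg_isComm hB) (fun i => (g (x i), y i))
    fun i => ⟨hg _ _ (hA.mem i), hy i⟩
  let p : epsAlg B n →ₐ[ℂ] B := AlgHom.ofLinearMap (LinearMap.fst ℂ B B) rfl fun _ _ => rfl
  have hp : p.comp F = g := hA.algHom_ext fun i => by
    rw [AlgHom.comp_apply, hFx]; rfl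
  have hp' : ∀ a, (F a).1 = g a := fun a => AlgHom.congr_fun hp a
  refine ⟨LinearMap.snd ℂ B B ∘ₗ F.toLinearMap, ⟨fun m a ha => (hF m a ha).2, fun m a b ha => ?_⟩,
    fun i => ?_⟩
  · change (F (a * b)).2 = (F a).2 * g b + (-1 : ℂ) ^ (n * m) • (g a * (F b).2)
    rw [map_mul]
    change (F a).2 * (F b).1 + B.twist n (F a).1 * (F b).2 = _
    rw [hp', hp', twist_of_mem n (hg _ _ ha), smul_mul_assoc]
  · change (F (x i)).2 = y i
    rw [hFx]

lemma IsFree.isDer_ext (hA : IsFree A deg x) {g : A →ₐ[ℂ] B} {n : ℤ} {D E : A →ₗ[ℂ] B}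
    (hD : IsDer g n D) (hE : IsDer g n E) (h : ∀ i, D (x i) = E (x i)) : D = E := by
  refine hD.ext hE hA.adjoin_eq_top ?_
  rintro _ ⟨i, rfl⟩
  exact h i

end IsFree

/-! ### Construction of the free graded-commutative algebra. -/

section Free

variable {ι : Type} (deg : ι → ℤ)

/-- The relations of graded commutativity. -/
inductive FreeRel : FreeAlgebra ℂ (ULift.{u} ι) → FreeAlgebra ℂ (ULift.{u} ι) → Prop
  | swap (i j : ULift.{u} ι) : FreeRel (FreeAlgebra.ι ℂ i * FreeAlgebra.ι ℂ j)
      ((-1 : ℂ) ^ (deg i.down * deg j.down) • (FreeAlgebra.ι ℂ j * FreeAlgebra.ι ℂ i))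

/-- The free graded-commutative algebra. -/
def FreeComm : Type u := RingQuot (FreeRel.{u} deg)

noncomputable instance : Ring (FreeComm.{u} deg) :=
  inferInstanceAs (Ring (RingQuot (FreeRel.{u} deg)))
noncomputable instance : Algebra ℂ (FreeComm.{u} deg) :=
  inferInstanceAs (Algebra ℂ (RingQuot (FreeRel.{u} deg)))

/-- The quotient map. -/
noncomputable def FreeComm.mk : FreeAlgebra ℂ (ULift.{u} ι) →ₐ[ℂ] FreeComm.{u} deg :=
  RingQuot.mkAlgHom ℂ (FreeRel.{u} deg)

/-- The generators of the free graded-commutative algebra. -/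
noncomputable def FreeComm.gen (i : ι) : FreeComm.{u} deg :=
  FreeComm.mk deg (FreeAlgebra.ι ℂ (ULift.up i))

lemma FreeComm.gen_mul_gen (i j : ι) : FreeComm.gen.{u} deg i * FreeComm.gen deg j =
    (-1 : ℂ) ^ (deg i * deg j) • (FreeComm.gen deg j * FreeComm.gen deg i) := by
  unfold FreeComm.gen
  rw [← map_mul, ← map_mul, ← map_smul]
  exact RingQuot.mkAlgHom_rel ℂ (FreeRel.swap ⟨i⟩ ⟨j⟩)

/-- The map out of the free graded-commutative algebra. -/
noncomputable def FreeComm.lift {R : Type*} [Ring R] [Algebra ℂ R] (b : ι → R)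
    (hb : ∀ i j, b i * b j = (-1 : ℂ) ^ (deg i * deg j) • (b j * b i)) :
    FreeComm.{u} deg →ₐ[ℂ] R :=
  RingQuot.liftAlgHom ℂ ⟨FreeAlgebra.lift ℂ fun i => b i.down, by
    rintro _ _ ⟨i, j⟩
    simp only [map_mul, map_smul, FreeAlgebra.lift_ι_apply]
    exact hb _ _⟩

lemma FreeComm.lift_gen {R : Type*} [Ring R] [Algebra ℂ R] (b : ι → R)
    (hb : ∀ i j, b i * b j = (-1 : ℂ) ^ (deg i * deg j) • (b j * b i)) (i : ι) :
    FreeComm.lift.{u} deg b hb (FreeComm.gen deg i) = b i :=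
  (RingQuot.liftAlgHom_mkAlgHom_apply ℂ _ _ _).trans (FreeAlgebra.lift_ι_apply _ _)

lemma FreeComm.hom_ext {R : Type*} [Ring R] [Algebra ℂ R] {f g : FreeComm.{u} deg →ₐ[ℂ] R}
    (h : ∀ i, f (FreeComm.gen deg i) = g (FreeComm.gen deg i)) : f = g := by
  apply RingQuot.ringQuot_ext'
  apply FreeAlgebra.hom_ext
  ext i
  exact h i.down

/-- Words of a given degree. -/
def FreeComm.words (n : ℤ) : Set (FreeComm.{u} deg) :=
  {a | ∃ l : List ι, (l.map deg).sum = n ∧ a = (l.map (FreeComm.gen deg)).prod}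

/-- The grading of the free graded-commutative algebra. -/
noncomputable def FreeComm.grading (n : ℤ) : Submodule ℂ (FreeComm.{u} deg) :=
  Submodule.span ℂ (FreeComm.words deg n)

instance : SetLike.GradedMonoid (FreeComm.grading.{u} deg) where
  one_mem := Submodule.subset_span ⟨[], rfl, rfl⟩
  mul_mem m n a b ha hb := by
    have : a * b ∈ FreeComm.grading.{u} deg m * FreeComm.grading.{u} deg n :=
      Submodule.mul_mem_mul ha hb
    unfold FreeComm.grading at this
    rw [Submodule.span_mul_span] at this
    refine Submodule.span_mono ?_ this
    rintro _ ⟨_, ⟨l, h1, rfl⟩, _, ⟨l', h2, rfl⟩, rfl⟩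
    exact ⟨l ++ l', by simp [h1, h2], by simp⟩

lemma FreeComm.gen_mem (i : ι) : FreeComm.gen.{u} deg i ∈ FreeComm.grading deg (deg i) :=
  Submodule.subset_span ⟨[i], by simp, by simp⟩

lemma FreeComm.of_congr {m n : ℤ} {a : FreeComm.grading.{u} deg m} {b : FreeComm.grading.{u} deg n}
    (h : m = n) (hab : a.1 = b.1) :
    DirectSum.of (fun i => FreeComm.grading.{u} deg i) m a = DirectSum.of _ n b := by
  subst h
  rw [Subtype.ext hab]

open DirectSum in
/-- The decomposition into homogeneous components. -/
noncomputable def FreeComm.decomposeHom :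
    FreeComm.{u} deg →ₐ[ℂ] ⨁ n, FreeComm.grading.{u} deg n :=
  FreeComm.lift deg (fun i => DirectSum.of (fun n => FreeComm.grading.{u} deg n) (deg i)
    ⟨_, FreeComm.gen_mem deg i⟩) (fun i j => by
      rw [DirectSum.of_mul_of, DirectSum.of_mul_of, ← DirectSum.of_smul]
      exact FreeComm.of_congr deg (add_comm _ _) (FreeComm.gen_mul_gen deg i j))

noncomputable instance : GradedAlgebra (FreeComm.grading.{u} deg) :=
  GradedAlgebra.ofAlgHom _ (FreeComm.decomposeHom deg)
    (FreeComm.hom_ext deg fun i => by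
      rw [AlgHom.comp_apply, FreeComm.decomposeHom, FreeComm.lift_gen, DirectSum.coeAlgHom_of]
      rfl)
    (by
      rintro n ⟨a, ha⟩
      dsimp only
      induction ha using Submodule.span_induction with
      | mem a h =>
        obtain ⟨l, rfl, rfl⟩ := h
        induction l with
        | nil =>
          simp only [List.map_nil, List.prod_nil, map_one]
          exact FreeComm.of_congr deg rfl rfl
        | cons i l ih =>
          have h1 : FreeComm.decomposeHom.{u} deg (FreeComm.gen deg i) =
              DirectSum.of _ (deg i) ⟨_, FreeComm.gen_mem deg i⟩ := by
            rw [FreeComm.decomposeHom, FreeComm.lift_gen]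
          simp only [List.map_cons, List.prod_cons, map_mul]
          rw [ih, h1, DirectSum.of_mul_of]
          exact FreeComm.of_congr deg rfl rfl
      | zero => rw [map_zero]; exact (map_zero (DirectSum.of _ n)).symm
      | add a b ha hb h1 h2 =>
        rw [map_add, h1, h2, ← map_add]; rfl
      | smul c a ha h1 =>
        rw [map_smul, h1, ← DirectSum.of_smul]; rfl)

/-- The free graded-commutative algebra with zero differential. -/
noncomputable def freeAlg : DGAlg.{u} where
  carrier := FreeComm.{u} deg
  grading := FreeComm.grading deg
  d := 0
  d_mem _ := zero_mem _
  d_d _ := rfl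
  leibniz _ _ := by simp

lemma FreeComm.adjoin_eq_top : Algebra.adjoin ℂ (Set.range (FreeComm.gen.{u} deg)) = ⊤ := by
  let S := Algebra.adjoin ℂ (Set.range (FreeComm.gen.{u} deg))
  have hS : ∀ i, FreeComm.gen.{u} deg i ∈ S := fun i => Algebra.subset_adjoin ⟨i, rfl⟩
  let f : FreeComm.{u} deg →ₐ[ℂ] S := FreeComm.lift deg (fun i => ⟨_, hS i⟩)
    (fun i j => Subtype.ext (FreeComm.gen_mul_gen deg i j))
  have h : S.val.comp f = AlgHom.id ℂ _ := FreeComm.hom_ext deg fun i => by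
    rw [AlgHom.comp_apply, FreeComm.lift_gen]; rfl
  rw [eq_top_iff]
  intro a _
  have := AlgHom.congr_fun h a
  rw [← AlgHom.id_apply (R := ℂ) a, ← this]
  exact (f a).2

lemma FreeComm.lift_mem {b : ι → B} (hb : ∀ i, b i ∈ B.grading (deg i))
    (hs : ∀ i j, b i * b j = (-1 : ℂ) ^ (deg i * deg j) • (b j * b i)) {n : ℤ}
    {a : FreeComm.{u} deg} (ha : a ∈ FreeComm.grading deg n) :
    FreeComm.lift deg b hs a ∈ B.grading n := by
  induction ha using Submodule.span_induction with
  | mem a h =>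
    obtain ⟨l, rfl, rfl⟩ := h
    induction l with
    | nil => simp only [List.map_nil, List.prod_nil, map_one]; exact one_mem_grading
    | cons i l ih =>
      simp only [List.map_cons, List.prod_cons, List.sum_cons]
      rw [map_mul, FreeComm.lift_gen]
      exact mul_mem_grading (hb i) ih
  | zero => rw [map_zero]; exact zero_mem _
  | add a b _ _ h1 h2 => rw [map_add]; exact add_mem h1 h2
  | smul c a _ h1 => rw [map_smul]; exact Submodule.smul_mem _ _ h1

end Free

/-- An algebra generated by supercommuting homogeneous elements is graded commutative. -/
lemma isComm_of_adjoin {ι : Type*} {deg : ι → ℤ} {x : ι → A} (hx : ∀ i, x i ∈ A.grading (deg i))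
    (hX : Algebra.adjoin ℂ (Set.range x) = ⊤)
    (h : ∀ i j, x i * x j = (-1 : ℂ) ^ (deg i * deg j) • (x j * x i)) : IsComm A := by
  -- Commutation is extended one factor at a time: first a generator past an arbitrary element, then
  -- a homogeneous element past an arbitrary one, with `twist` carrying the sign through products.
  have h1 : ∀ i b, x i * b = A.twist (deg i) b * x i := by
    intro i b
    have hb : b ∈ Algebra.adjoin ℂ (Set.range x) := by rw [hX]; trivial
    induction hb using Algebra.adjoin_induction with
    | mem b hb =>
      obtain ⟨j, rfl⟩ := hb
      rw [h, twist_of_mem _ (hx j), smul_mul_assoc]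
    | algebraMap r =>
      rw [Algebra.algebraMap_eq_smul_one, map_smul, twist_one]; simp
    | add a b _ _ ha hb => rw [mul_add, ha, hb, map_add, add_mul]
    | mul a b _ _ ha hb => rw [← mul_assoc, ha, mul_assoc, hb, twist_mul, mul_assoc]
  have h2 : ∀ n b, b ∈ A.grading n → ∀ a, b * A.twist n a = a * b := by
    intro n b hb a
    have ha : a ∈ Algebra.adjoin ℂ (Set.range x) := by rw [hX]; trivial
    induction ha using Algebra.adjoin_induction with
    | mem a ha =>
      obtain ⟨i, rfl⟩ := ha
      rw [h1, twist_of_mem _ hb, twist_of_mem _ (hx i), mul_smul_comm, smul_mul_assoc, mul_comm n]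
    | algebraMap r =>
      rw [Algebra.algebraMap_eq_smul_one, map_smul, twist_one]; simp
    | add a c _ _ ha hc => rw [map_add, mul_add, ha, hc, add_mul]
    | mul a c _ _ ha hc => rw [twist_mul, ← mul_assoc, ha, mul_assoc, hc, mul_assoc]
  intro m n a b ha hb
  rw [← h2 n b hb a, twist_of_mem n ha, mul_smul_comm, mul_comm n m]

lemma freeAlg_isComm {ι : Type} (deg : ι → ℤ) : IsComm (freeAlg.{u} deg) :=
  isComm_of_adjoin (A := freeAlg.{u} deg) (FreeComm.gen_mem deg) (FreeComm.adjoin_eq_top deg)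
    (FreeComm.gen_mul_gen deg)

lemma freeAlg_isFree {ι : Type} (deg : ι → ℤ) :
    IsFree (freeAlg.{u} deg) deg (FreeComm.gen.{u} deg) where
  mem := FreeComm.gen_mem deg
  adjoin_eq_top := FreeComm.adjoin_eq_top deg
  lift B hB b hb := by
    have hs : ∀ i j, b i * b j = (-1 : ℂ) ^ (deg i * deg j) • (b j * b i) :=
      fun i j => hB _ _ _ _ (hb i) (hb j)
    exact ⟨FreeComm.lift deg b hs, fun n a ha => FreeComm.lift_mem deg hb hs ha,
      FreeComm.lift_gen deg b hs⟩

lemma exists_free {ι : Type} (deg : ι → ℤ) :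
    ∃ (F : DGAlg.{u}) (x : ι → F), F.IsComm ∧ IsFree F deg x :=
  ⟨freeAlg deg, _, freeAlg_isComm deg, freeAlg_isFree deg⟩

end DGAlg

/-! ### Ordered monomials in supercommuting elements. -/

section OrderedMonomials

variable {R : Type*} [Ring R]

/-- The ordered product `x₁^{a₁} ⋯ xₙ^{aₙ}`. -/
def orderedMonomial {n : ℕ} (x : Fin n → R) (a : Fin n → ℕ) : R := (List.ofFn fun i => x i ^ a i).prod

/-- Exponents that are at most one at odd variables. -/
def ValidExponent {n : ℕ} (deg : Fin n → ℤ) (a : Fin n → ℕ) : Prop := ∀ i, Odd (deg i) → a i ≤ 1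

lemma orderedMonomial_succ {n : ℕ} (x : Fin (n + 1) → R) (a : Fin (n + 1) → ℕ) :
    orderedMonomial x a = x 0 ^ a 0 * orderedMonomial (fun i => x i.succ) (fun i => a i.succ) := by
  simp [orderedMonomial, List.ofFn_succ]

lemma orderedMonomial_zero {n : ℕ} (x : Fin n → R) : orderedMonomial x 0 = 1 := by
  simp [orderedMonomial, List.ofFn_const]

variable [Algebra ℂ R]

lemma map_orderedMonomial {S : Type*} [Ring S] [Algebra ℂ S] (f : R →ₐ[ℂ] S) {n : ℕ}
    (x : Fin n → R) (a : Fin n → ℕ) :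
    f (orderedMonomial x a) = orderedMonomial (fun i => f (x i)) a := by
  unfold orderedMonomial
  rw [map_list_prod, List.map_ofFn]
  congr 2
  ext i
  simp

lemma smul_commute_pow {x y : R} {c : ℂ} (h : x * y = c • (y * x)) (k : ℕ) :
    x * y ^ k = c ^ k • (y ^ k * x) := by
  induction k with
  | zero => simp
  | succ k ih =>
    rw [pow_succ, ← mul_assoc, ih, smul_mul_assoc, mul_assoc, h, mul_smul_comm, smul_smul, pow_succ,
      ← mul_assoc]

/-- Supercommutation of x with itself reads x² = -x², and 2 is invertible. -/
lemma sq_eq_zero_of_odd {x : R} {m : ℤ} (hm : Odd m) (h : x * x = (-1 : ℂ) ^ (m * m) • (x * x)) :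
    x * x = 0 := by
  rw [neg_one_zpow_odd (hm.mul hm)] at h
  have h2 : (2 : ℂ) • (x * x) = 0 := by
    rw [two_smul]; nth_rewrite 1 [h]; simp
  exact (smul_eq_zero.1 h2).resolve_left two_ne_zero

/-- A product of a variable and an ordered monomial is a multiple of an ordered monomial. -/
lemma mul_orderedMonomial {n : ℕ} {deg : Fin n → ℤ} {x : Fin n → R}
    (hx : ∀ i j, x i * x j = (-1 : ℂ) ^ (deg i * deg j) • (x j * x i)) (i : Fin n) {a : Fin n → ℕ}
    (ha : ValidExponent deg a) : x i * orderedMonomial x a = 0 ∨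
      ValidExponent deg (a + Pi.single i 1) ∧
        ∃ c : ℂ, x i * orderedMonomial x a = c • orderedMonomial x (a + Pi.single i 1) := by
  induction n with
  | zero => exact i.elim0
  | succ n ih =>
    rw [orderedMonomial_succ]
    refine Fin.cases ?_ (fun j => ?_) i
    · have e : (fun i : Fin n => (a + Pi.single 0 1 : Fin (n + 1) → ℕ) i.succ) = fun i => a i.succ := by
        ext i; simp
      -- The only way to leave the admissible exponents is to repeat an odd variable, and then the
      -- product vanishes.
      by_cases h : Odd (deg 0) ∧ a 0 = 1
      · left
        rw [← mul_assoc, h.2, pow_one, sq_eq_zero_of_odd h.1 (hx 0 0), zero_mul]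
      · refine Or.inr ⟨fun k => ?_, 1, ?_⟩
        · refine Fin.cases (fun hk => ?_) (fun k hk => ?_) k
          · have := ha 0 hk
            have h' : a 0 ≠ 1 := fun h' => h ⟨hk, h'⟩
            simp only [Pi.add_apply, Pi.single_eq_same]
            omega
          · simpa using ha k.succ hk
        · rw [orderedMonomial_succ, e, one_smul, ← mul_assoc, ← pow_succ']
          simp
    · have e : (fun i : Fin n => (a + Pi.single j.succ 1 : Fin (n + 1) → ℕ) i.succ) =
          (fun i : Fin n => a i.succ) + Pi.single j 1 := by
        ext i; simp [Pi.single_apply]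
      have h0 := smul_commute_pow (hx j.succ 0) (a 0)
      rw [← mul_assoc, h0, smul_mul_assoc, mul_assoc]
      rcases ih (deg := fun i => deg i.succ) (x := fun i => x i.succ) (fun i k => hx i.succ k.succ) j
        (a := fun i => a i.succ) (fun k hk => ha k.succ hk) with h | ⟨h, c, hc⟩
      · left; rw [h]; simp
      · refine Or.inr ⟨fun k => ?_,
          ((-1 : ℂ) ^ (deg j.succ * deg 0)) ^ a 0 * c, ?_⟩
        · refine Fin.cases (fun hk => ?_) (fun k hk => ?_) k
          · simpa using ha 0 hk
          · rw [← e] at h; exact h k hk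
        · rw [hc, mul_smul_comm, smul_smul, orderedMonomial_succ, e]; simp

lemma validExponent_zero {n : ℕ} {deg : Fin n → ℤ} : ValidExponent deg 0 := fun _ _ => by simp

/-- The span contains 1 and is stable under left multiplication by each generator, hence by the
whole generated subalgebra. -/
lemma span_orderedMonomial {n : ℕ} {deg : Fin n → ℤ} {x : Fin n → R}
    (hx : ∀ i j, x i * x j = (-1 : ℂ) ^ (deg i * deg j) • (x j * x i)) :
    ∀ r ∈ Algebra.adjoin ℂ (Set.range x),
      r ∈ Submodule.span ℂ (Set.range fun a : {a // ValidExponent deg a} => orderedMonomial x a.1) := by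
  set M := Submodule.span ℂ (Set.range fun a : {a // ValidExponent deg a} => orderedMonomial x a.1)
  have h1 : ∀ r ∈ Algebra.adjoin ℂ (Set.range x), ∀ m ∈ M, r * m ∈ M := by
    intro r hr
    induction hr using Algebra.adjoin_induction with
    | mem r h =>
      obtain ⟨i, rfl⟩ := h
      intro m hm
      induction hm using Submodule.span_induction with
      | mem m h =>
        obtain ⟨⟨a, ha⟩, rfl⟩ := h
        rcases mul_orderedMonomial hx i ha with h | ⟨h, c, hc⟩
        · simp only [h]; exact zero_mem _
        · simp only [hc]; exact Submodule.smul_mem _ _ (Submodule.subset_span ⟨⟨_, h⟩, rfl⟩)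
      | zero => rw [mul_zero]; exact zero_mem _
      | add a b _ _ h1 h2 => rw [mul_add]; exact add_mem h1 h2
      | smul c a _ h1 => rw [mul_smul_comm]; exact Submodule.smul_mem _ _ h1
    | algebraMap c =>
      intro m hm
      rw [← Algebra.smul_def]; exact Submodule.smul_mem _ _ hm
    | add a b _ _ h1 h2 => intro m hm; rw [add_mul]; exact add_mem (h1 m hm) (h2 m hm)
    | mul a b _ _ h1 h2 => intro m hm; rw [mul_assoc]; exact h1 _ (h2 m hm)
  intro r hr
  rw [← mul_one r]
  exact h1 r hr 1 (Submodule.subset_span ⟨⟨0, validExponent_zero⟩, orderedMonomial_zero x⟩)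

end OrderedMonomials

/-! ### Partial derivatives, and monomial bases versus freeness. -/

namespace DGAlg

variable {A B C : DGAlg.{u}}

/-- A derivation that maps generators into the subalgebra generated by homogeneous `X` preserves it. -/
lemma IsDer.mem_adjoin {g : A →ₐ[ℂ] B} {n : ℤ} {D : A →ₗ[ℂ] B} (hD : IsDer g n D) {X : Set A}
    {S : Subalgebra ℂ B} (hX : ∀ x ∈ X, ∃ m, x ∈ A.grading m)
    (hg : ∀ x ∈ X, g x ∈ S) (h : ∀ x ∈ X, D x ∈ S) {a : A} (ha : a ∈ Algebra.adjoin ℂ X) :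
    D a ∈ S := by
  have ht : ∀ a ∈ Algebra.adjoin ℂ X, g (A.twist n a) ∈ S := by
    intro a ha
    induction ha using Algebra.adjoin_induction with
    | mem x hx =>
      obtain ⟨m, hm⟩ := hX x hx
      rw [twist_of_mem n hm, map_smul]
      exact S.smul_mem (hg x hx) _
    | algebraMap r =>
      rw [Algebra.algebraMap_eq_smul_one, map_smul, twist_one, map_smul, map_one]
      exact S.smul_mem S.one_mem _
    | add a b _ _ h1 h2 => rw [map_add, map_add]; exact add_mem h1 h2
    | mul a b _ _ h1 h2 => rw [twist_mul, map_mul]; exact mul_mem h1 h2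
  have hgS : ∀ a ∈ Algebra.adjoin ℂ X, g a ∈ S := fun a ha =>
    (Algebra.adjoin_le (S := S.comap g) (fun x hx => hg x hx)) ha
  induction ha using Algebra.adjoin_induction with
  | mem x hx => exact h x hx
  | algebraMap r =>
    rw [Algebra.algebraMap_eq_smul_one, map_smul, hD.apply_one, smul_zero]; exact zero_mem _
  | add a b _ _ h1 h2 => rw [map_add]; exact add_mem h1 h2
  | mul a b ha hb h1 h2 =>
    rw [hD.mul]
    exact add_mem (mul_mem h1 (hgS b hb)) (mul_mem (ht a ha) h2)

/-- `D` is a system of partial derivatives for the elements `x i` of degree `deg i`. -/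
structure IsPartials {n : ℕ} (deg : Fin n → ℤ) (x : Fin n → A) (D : Fin n → Module.End ℂ A) :
    Prop where
  mem : ∀ i, x i ∈ A.grading (deg i)
  isDer : ∀ i, IsDer (AlgHom.id ℂ A) (-deg i) (D i)
  apply_self : ∀ i, D i (x i) = 1
  apply_ne : ∀ i j, i ≠ j → D i (x j) = 0

lemma IsPartials.tail {n : ℕ} {deg : Fin (n + 1) → ℤ} {x : Fin (n + 1) → A}
    {D : Fin (n + 1) → Module.End ℂ A} (h : IsPartials deg x D) :
    IsPartials (fun i => deg i.succ) (fun i => x i.succ) (fun i => D i.succ) :=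
  ⟨fun _ => h.mem _, fun _ => h.isDer _, fun _ => h.apply_self _, fun _ _ hij => h.apply_ne _ _
    (fun h => hij (Fin.succ_injective _ h))⟩

lemma pow_mem_grading {m : ℤ} {a : A} (ha : a ∈ A.grading m) (k : ℕ) :
    a ^ k ∈ A.grading (k * m) := by
  have := SetLike.pow_mem_graded k ha
  simpa using this

lemma IsDer.pow_mul_of_eq_zero {n : ℤ} {D : Module.End ℂ A} (hD : IsDer (AlgHom.id ℂ A) n D)
    {m : ℤ} {a : A} (ha : a ∈ A.grading m) (h0 : D a = 0) (k : ℕ) :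
    ∃ c : ℂ, c ≠ 0 ∧ ∀ y, D (a ^ k * y) = c • (a ^ k * D y) := by
  have hp : D (a ^ k) = 0 := by
    have := hD.eq_on_adjoin (isDer_zero n) (X := {a}) (by simpa using h0)
      (pow_mem (Algebra.self_mem_adjoin_singleton ℂ a) k)
    simpa using this
  refine ⟨(-1 : ℂ) ^ (n * (k * m)), neg_one_zpow_ne_zero _, fun y => ?_⟩
  rw [hD.leibniz_id (pow_mem_grading ha k), hp, zero_mul, zero_add]

lemma orderedMonomial_apply_pow_mul {n : ℕ} {D : Fin n → Module.End ℂ A} {e : Fin n → ℤ}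
    (hD : ∀ i, IsDer (AlgHom.id ℂ A) (e i) (D i)) {m : ℤ} {a : A} (ha : a ∈ A.grading m)
    (h0 : ∀ i, D i a = 0) (k : ℕ) (α : Fin n → ℕ) :
    ∃ c : ℂ, c ≠ 0 ∧ ∀ y, orderedMonomial D α (a ^ k * y) = c • (a ^ k * orderedMonomial D α y) := by
  induction n with
  | zero => exact ⟨1, one_ne_zero, fun y => by simp [orderedMonomial]⟩
  | succ n ih =>
    obtain ⟨c, hc, h⟩ := ih (D := fun i => D i.succ) (fun i => hD i.succ) (fun i => h0 i.succ)
      (fun i => α i.succ)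
    obtain ⟨c', hc', h'⟩ := (hD 0).pow_mul_of_eq_zero ha (h0 0) k
    have h'' : ∀ l y, (D 0 ^ l) (a ^ k * y) = c' ^ l • (a ^ k * (D 0 ^ l) y) := by
      intro l
      induction l with
      | zero => simp
      | succ l ihl =>
        intro y
        rw [pow_succ, Module.End.mul_apply, h', map_smul, ihl, smul_smul, Module.End.mul_apply,
          pow_succ']
    refine ⟨c * c' ^ α 0, mul_ne_zero hc (pow_ne_zero _ hc'), fun y => ?_⟩
    rw [orderedMonomial_succ, Module.End.mul_apply, h, map_smul, h'', smul_smul,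
      Module.End.mul_apply]

/-- For even m the constant is k + 1, nonzero in characteristic zero; for odd m only the first power
of a is considered, and the constant is 1. -/
lemma IsDer.apply_pow_mul {m : ℤ} {D : Module.End ℂ A} (hD : IsDer (AlgHom.id ℂ A) (-m) D)
    {a : A} (ha : a ∈ A.grading m) (h1 : D a = 1) (k : ℕ) (hk : Odd m → k = 0) :
    ∃ c : ℂ, c ≠ 0 ∧ ∀ y, D y = 0 → D (a ^ (k + 1) * y) = c • (a ^ k * y) := by
  by_cases hm : Even m
  · have key : ∀ k : ℕ, ∀ y, D y = 0 → D (a ^ (k + 1) * y) = ((k : ℂ) + 1) • (a ^ k * y) := by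
      intro k
      induction k with
      | zero =>
        intro y hy
        rw [zero_add, pow_one, hD.leibniz_id ha, h1, hy]; simp
      | succ k ih =>
        intro y hy
        rw [pow_succ', mul_assoc, hD.leibniz_id ha, h1, one_mul, ih y hy,
          neg_one_zpow_even (hm.mul_left _), one_smul, mul_smul_comm, ← mul_assoc, ← pow_succ']
        push_cast
        module
    exact ⟨k + 1, by exact_mod_cast Nat.succ_ne_zero k, key k⟩
  · rw [hk (Int.not_even_iff_odd.1 hm)]
    refine ⟨1, one_ne_zero, fun y hy => ?_⟩
    rw [zero_add, pow_one, hD.leibniz_id ha, h1, hy]; simp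

lemma IsDer.pow_apply_pow_mul {m : ℤ} {D : Module.End ℂ A} (hD : IsDer (AlgHom.id ℂ A) (-m) D)
    {a : A} (ha : a ∈ A.grading m) (h1 : D a = 1) {y : A} (hy : D y = 0) (l : ℕ) (k : ℕ)
    (hk : Odd m → k ≤ 1) :
    (k < l → (D ^ l) (a ^ k * y) = 0) ∧ (k = l → ∃ c : ℂ, c ≠ 0 ∧ (D ^ l) (a ^ k * y) = c • y) := by
  induction k generalizing l with
  | zero =>
    refine ⟨fun hl => ?_, fun hl => ⟨1, one_ne_zero, by simp [← hl]⟩⟩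
    obtain ⟨l, rfl⟩ := Nat.exists_eq_succ_of_ne_zero hl.ne'
    rw [pow_succ, Module.End.mul_apply, pow_zero, one_mul, hy, map_zero]
  | succ k ih =>
    obtain ⟨c, hc, h⟩ := hD.apply_pow_mul ha h1 k (fun hm => by have := hk hm; omega)
    have ih' := fun l => ih l (fun hm => by have := hk hm; omega)
    refine ⟨fun hl => ?_, fun hl => ?_⟩
    · obtain ⟨l, rfl⟩ := Nat.exists_eq_succ_of_ne_zero (by omega : l ≠ 0)
      rw [pow_succ, Module.End.mul_apply, h y hy, map_smul, (ih' l).1 (by omega), smul_zero]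
    · obtain ⟨l, rfl⟩ := Nat.exists_eq_succ_of_ne_zero (by omega : l ≠ 0)
      obtain ⟨c', hc', h'⟩ := (ih' l).2 (by omega)
      refine ⟨c * c', mul_ne_zero hc hc', ?_⟩
      rw [pow_succ, Module.End.mul_apply, h y hy, map_smul, h', smul_smul]

lemma orderedMonomial_mem_adjoin {n : ℕ} (x : Fin n → A) (b : Fin n → ℕ) :
    orderedMonomial x b ∈ Algebra.adjoin ℂ (Set.range x) := by
  refine list_prod_mem fun y hy => ?_
  rw [List.mem_ofFn] at hy
  obtain ⟨i, rfl⟩ := hy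
  exact pow_mem (Algebra.subset_adjoin (Set.mem_range_self i)) _

/-- The pairing of monomials in the partial derivatives with monomials in the variables. -/
lemma IsPartials.apply_monomial {n : ℕ} {deg : Fin n → ℤ} {x : Fin n → A}
    {D : Fin n → Module.End ℂ A} (h : IsPartials deg x D) (a : Fin n → ℕ) {b : Fin n → ℕ}
    (hb : ValidExponent deg b) :
    (¬ a ≤ b → orderedMonomial D a (orderedMonomial x b) = 0) ∧
      (a = b → ∃ c : ℂ, c ≠ 0 ∧ orderedMonomial D a (orderedMonomial x b) = c • (1 : A)) := by
  induction n with
  | zero =>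
    refine ⟨fun hab => absurd (show a ≤ b from fun i => i.elim0) hab, fun _ => ⟨1, one_ne_zero, ?_⟩⟩
    simp [orderedMonomial]
  | succ n ih =>
    obtain ⟨ih1, ih2⟩ := ih h.tail (fun i => a i.succ) (b := fun i => b i.succ)
      (fun i hi => hb i.succ hi)
    obtain ⟨c, hc, h0⟩ := orderedMonomial_apply_pow_mul (D := fun i => D i.succ)
      (fun i => h.isDer i.succ) (h.mem 0) (fun i => h.apply_ne _ _ (Fin.succ_ne_zero i)) (b 0)
      (fun i => a i.succ)
    -- Partial derivatives in the later variables preserve the subalgebra generated by those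
    -- variables. Hence z below does not involve x 0 and is killed by D 0, so the pairing splits
    -- into the first variable and the rest.
    have hS : ∀ y ∈ Algebra.adjoin ℂ (Set.range fun i : Fin n => x i.succ),
        orderedMonomial (fun i : Fin n => D i.succ) (fun i => a i.succ) y ∈
          Algebra.adjoin ℂ (Set.range fun i : Fin n => x i.succ) := by
      set S := Algebra.adjoin ℂ (Set.range fun i : Fin n => x i.succ)
      have h1 : ∀ i : Fin n, ∀ y ∈ S, D i.succ y ∈ S := by
        intro i y hy
        refine (h.isDer i.succ).mem_adjoin (X := Set.range fun i : Fin n => x i.succ) ?_ ?_ ?_ hy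
        · rintro _ ⟨j, rfl⟩; exact ⟨_, h.mem _⟩
        · rintro _ ⟨j, rfl⟩; exact Algebra.subset_adjoin ⟨j, rfl⟩
        · rintro _ ⟨j, rfl⟩
          dsimp only
          by_cases hij : i.succ = j.succ
          · rw [← hij, h.apply_self]; exact S.one_mem
          · rw [h.apply_ne _ _ hij]; exact zero_mem _
      have h2 : ∀ L : List (Module.End ℂ A), (∀ E ∈ L, ∀ y ∈ S, E y ∈ S) → ∀ y ∈ S, L.prod y ∈ S := by
        intro L hL
        induction L with
        | nil => intro y hy; simpa using hy
        | cons E L ihL =>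
          intro y hy
          rw [List.prod_cons, Module.End.mul_apply]
          exact hL E (by simp) _ (ihL (fun E' hE' => hL E' (by simp [hE'])) y hy)
      refine h2 _ fun E hE => ?_
      rw [List.mem_ofFn] at hE
      obtain ⟨i, rfl⟩ := hE
      have h3 : ∀ k : ℕ, ∀ y ∈ S, (D i.succ ^ k) y ∈ S := by
        intro k
        induction k with
        | zero => intro y hy; simpa using hy
        | succ k ihk => intro y hy; rw [pow_succ, Module.End.mul_apply]; exact ihk _ (h1 i y hy)
      exact h3 _
    set z := orderedMonomial (fun i : Fin n => D i.succ) (fun i => a i.succ)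
      (orderedMonomial (fun i : Fin n => x i.succ) (fun i => b i.succ)) with hz
    have hz0 : D 0 z = 0 := by
      have := (h.isDer 0).eq_on_adjoin (isDer_zero _) (X := Set.range fun i : Fin n => x i.succ)
        (by rintro _ ⟨j, rfl⟩; exact h.apply_ne _ _ (Fin.succ_ne_zero j).symm)
        (hS _ (orderedMonomial_mem_adjoin _ (fun i => b i.succ)))
      simpa using this
    have e : orderedMonomial D a (orderedMonomial x b) = c • (D 0 ^ a 0) (x 0 ^ b 0 * z) := by
      rw [orderedMonomial_succ D, orderedMonomial_succ x, Module.End.mul_apply, h0, map_smul]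
    obtain ⟨k1, k2⟩ := (h.isDer 0).pow_apply_pow_mul (h.mem 0) (h.apply_self 0) hz0 (a 0) (b 0) (hb 0)
    constructor
    · intro hab
      by_cases h' : (fun i : Fin n => a i.succ) ≤ fun i => b i.succ
      · have : b 0 < a 0 := by
          by_contra hlt
          exact hab fun i => Fin.cases (not_lt.1 hlt) (fun j => h' j) i
        rw [e, k1 this, smul_zero]
      · rw [e, ih1 h']; simp
    · rintro rfl
      obtain ⟨c1, hc1, e1⟩ := k2 rfl
      obtain ⟨c2, hc2, e2⟩ := ih2 rfl
      exact ⟨c * (c1 * c2), mul_ne_zero hc (mul_ne_zero hc1 hc2), by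
        rw [e, e1, e2, smul_smul, smul_smul, mul_assoc]⟩

lemma IsFree.exists_partials (hc : IsComm A) {n : ℕ} {deg : Fin n → ℤ} {x : Fin n → A}
    (hA : IsFree A deg x) : ∃ D, IsPartials deg x D := by
  have : ∀ i : Fin n, ∃ D : Module.End ℂ A, IsDer (AlgHom.id ℂ A) (-deg i) D ∧
      ∀ j, D (x j) = (if i = j then (1 : A) else 0) := fun i =>
    hA.exists_isDer hc isGraded_id (-deg i) (fun j => if i = j then 1 else 0) fun j => by
      split_ifs with h
      · rw [h, add_neg_cancel]; exact one_mem_grading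
      · exact zero_mem _
  choose D hD hDx using this
  exact ⟨D, hA.mem, hD, fun i => by rw [hDx]; simp, fun i j hij => by rw [hDx]; simp [hij]⟩

/-- Given a relation, apply ∂^a for an exponent a maximal in its support: ∂^a kills every other
monomial that occurs and sends x^a to a nonzero constant. -/
lemma IsPartials.linearIndependent [Nontrivial A] {n : ℕ} {deg : Fin n → ℤ} {x : Fin n → A}
    {D : Fin n → Module.End ℂ A} (h : IsPartials deg x D) :
    LinearIndependent ℂ fun a : {a // ValidExponent deg a} => orderedMonomial x a.1 := by
  rw [linearIndependent_iff]
  intro l hl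
  by_contra hne
  obtain ⟨a, ha⟩ := l.support.exists_maximal (Finsupp.support_nonempty_iff.2 hne)
  have h1 := congrArg (orderedMonomial (R := Module.End ℂ A) D a.1) hl
  rw [Finsupp.linearCombination_apply, Finsupp.sum, map_sum, map_zero,
    Finset.sum_eq_single_of_mem a ha.1] at h1
  · obtain ⟨c, hc, e⟩ := (h.apply_monomial a.1 a.2).2 rfl
    rw [map_smul, e, smul_smul, smul_eq_zero] at h1
    rcases h1 with h1 | h1
    · exact mul_ne_zero (Finsupp.mem_support_iff.1 ha.1) hc h1
    · exact one_ne_zero h1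
  · intro b hb hba
    rw [map_smul, (h.apply_monomial a.1 b.2).1, smul_zero]
    intro hab
    exact hba (le_antisymm (ha.2 hb hab) hab)

lemma IsFree.reindex {ι κ : Type} {deg : ι → ℤ} {x : ι → A} (hA : IsFree A deg x) (e : κ ≃ ι) :
    IsFree A (deg ∘ e) (x ∘ e) where
  mem i := hA.mem _
  adjoin_eq_top := by rw [e.surjective.range_comp, hA.adjoin_eq_top]
  lift B hB b hb := by
    obtain ⟨F, hF, h⟩ := hA.lift B hB (b ∘ e.symm) (fun i => by
      have := hb (e.symm i); simpa using this)
    exact ⟨F, hF, fun i => by rw [Function.comp_apply, h]; simp⟩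

lemma IsFree.isFinitePolynomial [Nontrivial A] (hc : IsComm A) {ι : Type} [Finite ι] {deg : ι → ℤ}
    {x : ι → A} (hA : IsFree A deg x) (hdeg : ∀ i, deg i ≤ 0) : A.IsFinitePolynomial := by
  obtain ⟨n, ⟨e⟩⟩ := Finite.exists_equiv_fin ι
  have hA' := hA.reindex e.symm
  obtain ⟨D, hD⟩ := hA'.exists_partials hc
  refine ⟨n, _, _, fun i => hdeg _, hA'.mem, hD.linearIndependent, ?_⟩
  rw [eq_top_iff]
  intro a _
  exact span_orderedMonomial (fun i j => hc _ _ _ _ (hA'.mem i) (hA'.mem j)) a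
    (by rw [hA'.adjoin_eq_top]; trivial)

/-- The comparison map from the abstract free algebra is bijective: ordered monomials span its
source, and their images form a basis of its target. The universal property is then transported. -/
lemma IsFinitePolynomial.exists_isFree (hc : IsComm A) (h : A.IsFinitePolynomial) :
    ∃ (n : ℕ) (deg : Fin n → ℤ) (x : Fin n → A), (∀ i, deg i ≤ 0) ∧ IsFree A deg x := by
  obtain ⟨n, deg, x, hdeg, hx, hli, hsp⟩ := h
  refine ⟨n, deg, x, hdeg, hx, ?_, fun B hB b hb => ?_⟩
  · have : ⊤ ≤ Subalgebra.toSubmodule (Algebra.adjoin ℂ (Set.range x)) := by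
      rw [← hsp, Submodule.span_le]
      rintro _ ⟨a, rfl⟩
      exact orderedMonomial_mem_adjoin x a.1
    exact eq_top_iff.2 fun a _ => this trivial
  · obtain ⟨F, g, hFc, hF⟩ := exists_free.{u} deg
    obtain ⟨φ, hφ, hφx⟩ := hF.lift A hc x hx
    obtain ⟨ψ, hψ, hψb⟩ := hF.lift B hB b hb
    have hmon : ∀ a, φ (orderedMonomial (g) a) = orderedMonomial x a := fun a => by
      rw [map_orderedMonomial φ]; congr 1; exact funext hφx
    have hspan : ∀ a : F, a ∈ Submodule.span ℂ (Set.range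
        fun a : {a // ValidExponent deg a} => orderedMonomial (g) a.1) := fun a =>
      span_orderedMonomial (fun i j => hFc _ _ _ _ (hF.mem i) (hF.mem j)) a (by rw [hF.adjoin_eq_top]; trivial)
    have hinj : Function.Injective φ := by
      rw [injective_iff_map_eq_zero]
      intro a ha
      obtain ⟨l, rfl⟩ := (Finsupp.mem_span_range_iff_exists_finsupp).1 (hspan a)
      rw [Finsupp.sum, map_sum] at ha
      have hl : l = 0 := by
        apply linearIndependent_iff.1 hli
        refine (Finsupp.linearCombination_apply ℂ l).trans ?_
        rw [Finsupp.sum, ← ha]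
        refine Finset.sum_congr rfl fun a _ => ?_
        rw [map_smul, hmon]
        rfl
      rw [hl]; simp
    have hsurj : Function.Surjective φ := by
      have : ⊤ ≤ LinearMap.range φ.toLinearMap := by
        rw [← hsp, Submodule.span_le]
        rintro _ ⟨a, rfl⟩
        exact ⟨_, hmon a.1⟩
      exact fun a => this (x := a) trivial
    let e := AlgEquiv.ofBijective φ ⟨hinj, hsurj⟩
    have he : ∀ a, φ (e.symm a) = a := fun a => e.apply_symm_apply a
    refine ⟨ψ.comp e.symm.toAlgHom, fun n a ha => hψ _ _ ?_, fun i => ?_⟩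
    · change e.symm a ∈ _
      -- The inverse preserves degrees because the comparison map commutes with the projections to
      -- components.
      apply mem_grading_of_comp
      apply hinj
      have := comp_map (f := φ.toLinearMap) (k := 0)
        (fun n a h => by rw [add_zero]; exact hφ _ _ h) n (e.symm a)
      simp only [add_zero, AlgHom.toLinearMap_apply, he] at this
      rw [← this, comp_of_mem ha, he]
    · rw [AlgHom.comp_apply, ← hψb i]
      congr 1
      apply hinj
      rw [hφx]
      exact he _

end DGAlg

/-! ### Nonpositive free algebras and extensions by contractible pairs. -/

namespace DGAlg

variable {A B C : DGAlg.{u}}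

/-- Nonpositively graded. -/
def IsNonpos (A : DGAlg.{u}) : Prop := ∀ n : ℤ, 0 < n → A.grading n = ⊥

lemma IsFree.isNonpos {ι : Type} {deg : ι → ℤ} {x : ι → A} (hA : IsFree A deg x)
    (hdeg : ∀ i, deg i ≤ 0) : IsNonpos A := by
  have key : ∀ a : A, ∀ n : ℤ, 0 < n → A.comp n a = 0 := by
    have h1 : ∀ q ∈ Algebra.adjoin ℂ (Set.range x), ∀ p : A, (∀ n : ℤ, 0 < n → A.comp n p = 0) →
        ∀ n : ℤ, 0 < n → A.comp n (q * p) = 0 := by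
      intro q hq
      induction hq using Algebra.adjoin_induction with
      | mem q h =>
        obtain ⟨i, rfl⟩ := h
        intro p hp n hn
        have := comp_map (f := LinearMap.mulLeft ℂ (x i)) (k := deg i)
          (fun m a ha => by rw [add_comm]; exact mul_mem_grading (hA.mem i) ha) (n - deg i) p
        rw [sub_add_cancel, LinearMap.mulLeft_apply, LinearMap.mulLeft_apply,
          hp _ (by have := hdeg i; omega), mul_zero] at this
        exact this
      | algebraMap r =>
        intro p hp n hn
        rw [← Algebra.smul_def, map_smul, hp n hn, smul_zero]
      | add a b _ _ h1 h2 =>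
        intro p hp n hn
        rw [add_mul, map_add, h1 p hp n hn, h2 p hp n hn, add_zero]
      | mul a b _ _ h1 h2 =>
        intro p hp n hn
        rw [mul_assoc]
        exact h1 _ (h2 p hp) n hn
    intro a n hn
    rw [← mul_one a]
    exact h1 a (by rw [hA.adjoin_eq_top]; trivial) 1
      (fun n hn => comp_of_mem_ne one_mem_grading hn.ne') n hn
  intro n hn
  rw [eq_bot_iff]
  intro a ha
  rw [← comp_of_mem ha, key a n hn]
  exact zero_mem _

lemma IsNonpos.eq_zero (h : IsNonpos A) {n : ℤ} (hn : 0 < n) {a : A} (ha : a ∈ A.grading n) :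
    a = 0 := by
  rw [h n hn] at ha; exact ha

/-- Elements of degree `m` only involve generators of degree at least `m`. -/
lemma IsFree.mem_adjoin_of_mem_grading {ι : Type} {deg : ι → ℤ} {x : ι → A} (hA : IsFree A deg x)
    (hdeg : ∀ i, deg i ≤ 0) {m : ℤ} {a : A} (ha : a ∈ A.grading m) :
    a ∈ Algebra.adjoin ℂ (x '' {i | m ≤ deg i}) := by
  have hn := hA.isNonpos hdeg
  have hmono : ∀ m m' : ℤ, m ≤ m' → Algebra.adjoin ℂ (x '' {i | m' ≤ deg i}) ≤
      Algebra.adjoin ℂ (x '' {i | m ≤ deg i}) := fun m m' h =>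
    Algebra.adjoin_mono (Set.image_mono fun i (hi : m' ≤ deg i) => h.trans hi)
  have h1 : ∀ q ∈ Algebra.adjoin ℂ (Set.range x), ∀ p : A,
      (∀ m, A.comp m p ∈ Algebra.adjoin ℂ (x '' {i | m ≤ deg i})) →
      ∀ m, A.comp m (q * p) ∈ Algebra.adjoin ℂ (x '' {i | m ≤ deg i}) := by
    intro q hq
    induction hq using Algebra.adjoin_induction with
    | mem q h =>
      obtain ⟨i, rfl⟩ := h
      intro p hp m
      have := comp_map (f := LinearMap.mulLeft ℂ (x i)) (k := deg i)
        (fun m a ha => by rw [add_comm]; exact mul_mem_grading (hA.mem i) ha) (m - deg i) p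
      rw [sub_add_cancel, LinearMap.mulLeft_apply, LinearMap.mulLeft_apply] at this
      rw [this]
      by_cases hi : m ≤ deg i
      · exact mul_mem (Algebra.subset_adjoin ⟨i, hi, rfl⟩)
          (hmono m (m - deg i) (by have := hdeg i; omega) (hp _))
      -- Here m - deg i is positive, so the complementary factor lies in a vanishing component.
      · rw [hn.eq_zero (by omega) (comp_mem (m - deg i) p), mul_zero]
        exact zero_mem _
    | algebraMap r =>
      intro p hp m
      rw [← Algebra.smul_def, map_smul]
      exact Subalgebra.smul_mem _ (hp m) _
    | add a b _ _ h1 h2 =>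
      intro p hp m
      rw [add_mul, map_add]
      exact add_mem (h1 p hp m) (h2 p hp m)
    | mul a b _ _ h1 h2 =>
      intro p hp m
      rw [mul_assoc]
      exact h1 _ (h2 p hp) m
  rw [← comp_of_mem ha, ← mul_one a]
  refine h1 a (by rw [hA.adjoin_eq_top]; trivial) 1 (fun m => ?_) m
  by_cases hm : m = 0
  · rw [hm, comp_of_mem one_mem_grading]; exact Subalgebra.one_mem _
  · rw [comp_of_mem_ne one_mem_grading hm]; exact zero_mem _

lemma isDer_d_comp {F : A →ₐ[ℂ] B} (hF : IsGraded F) : IsDer F 1 (B.d ∘ₗ F.toLinearMap) :=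
  isDer_d.comp_right (g := AlgHom.id ℂ B) hF

lemma isDer_comp_d {F : A →ₐ[ℂ] B} (hF : IsGraded F) : IsDer F 1 (F.toLinearMap ∘ₗ A.d) :=
  isDer_d.comp_left (g := AlgHom.id ℂ A) hF

/-- A graded algebra map that commutes with `d` on generators commutes with `d`. -/
lemma d_map_of_adjoin {F : A →ₐ[ℂ] B} (hF : IsGraded F) {X : Set A}
    (h : ∀ x ∈ X, B.d (F x) = F (A.d x)) {a : A} (ha : a ∈ Algebra.adjoin ℂ X) :
    B.d (F a) = F (A.d a) :=
  (isDer_d_comp hF).eq_on_adjoin (isDer_comp_d hF) h ha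

lemma algHom_eq_on_adjoin {R S : Type*} [Semiring R] [Algebra ℂ R] [Semiring S] [Algebra ℂ S]
    {f g : R →ₐ[ℂ] S} {X : Set R} (h : ∀ x ∈ X, f x = g x) {a : R} (ha : a ∈ Algebra.adjoin ℂ X) :
    f a = g a :=
  Algebra.adjoin_le (S := AlgHom.equalizer f g) h ha

lemma map_mem_adjoin {R S : Type*} [Semiring R] [Algebra ℂ R] [Semiring S] [Algebra ℂ S]
    {f : R →ₐ[ℂ] S} {X : Set R} {T : Subalgebra ℂ S} (h : ∀ x ∈ X, f x ∈ T) {a : R}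
    (ha : a ∈ Algebra.adjoin ℂ X) : f a ∈ T :=
  Algebra.adjoin_le (S := T.comap f) h ha

/-- Triangular change of generators. -/
lemma IsFree.triangular {ι : Type} [Finite ι] {deg : ι → ℤ} {x x' : ι → A} (hA : IsFree A deg x)
    (hx' : ∀ i, x' i ∈ A.grading (deg i)) (ρ : ι → ℕ)
    (h : ∀ i, x' i - x i ∈ Algebra.adjoin ℂ (x '' {k | ρ k < ρ i})) : IsFree A deg x' := by
  refine ⟨hx', ?_, fun B hB b hb => ?_⟩
  · rw [eq_top_iff, ← hA.adjoin_eq_top, Algebra.adjoin_le_iff]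
    have : ∀ m : ℕ, ∀ i, ρ i < m → x i ∈ Algebra.adjoin ℂ (Set.range x') := by
      intro m
      induction m with
      | zero => intro i hi; omega
      | succ m ih =>
        intro i hi
        rw [show x i = x' i - (x' i - x i) by abel]
        refine sub_mem (Algebra.subset_adjoin ⟨i, rfl⟩) (Algebra.adjoin_le ?_ (h i))
        rintro _ ⟨k, hk, rfl⟩
        exact ih k (by have : ρ k < ρ i := hk; omega)
    rintro _ ⟨i, rfl⟩
    exact this (ρ i + 1) i (Nat.lt_succ_self _)
  · have : ∀ m : ℕ, ∃ F : A →ₐ[ℂ] B, IsGraded F ∧ ∀ i, ρ i < m → F (x' i) = b i := by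
      intro m
      induction m with
      | zero =>
        obtain ⟨F, hF, _⟩ := hA.lift B hB b hb
        exact ⟨F, hF, fun i hi => by omega⟩
      | succ m ih =>
        obtain ⟨F, hF, hFb⟩ := ih
        obtain ⟨F', hF', hF'x⟩ := hA.lift B hB
          -- Below rank m the old values are kept. Elsewhere the value on x i is the one forced by
          -- x' i ↦ b i, given the old map on the correction x' i - x i; at rank m that correction
          -- involves only generators whose values did not change.
          (fun i => if ρ i < m then F (x i) else b i - F (x' i - x i)) fun i => by
            split_ifs
            · exact hF _ _ (hA.mem i)
            · exact sub_mem (hb i) (hF _ _ (sub_mem (hx' i) (hA.mem i)))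
        have heq : ∀ i, ρ i < m + 1 → F' (x' i - x i) = F (x' i - x i) := by
          intro i hi
          refine algHom_eq_on_adjoin ?_ (h i)
          rintro _ ⟨k, hk, rfl⟩
          rw [hF'x, if_pos (by have : ρ k < ρ i := hk; omega)]
        refine ⟨F', hF', fun i hi => ?_⟩
        rw [show x' i = x i + (x' i - x i) by abel, map_add, heq i hi, hF'x]
        split_ifs with hm
        · rw [← map_add, ← hFb i hm]; congr 1; abel
        · abel
    obtain ⟨N, hN⟩ := (Set.finite_range ρ).bddAbove
    obtain ⟨F, hF, hFb⟩ := this (N + 1)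
    exact ⟨F, hF, fun i => hFb i (Nat.lt_succ_of_le (hN ⟨i, rfl⟩))⟩

/-- The extension `Q[w k, dw k]` of the free algebra `Q` by contractible pairs of generators. -/
structure Extension (Q : DGAlg.{u}) {ι : Type} (deg : ι → ℤ) (x : ι → Q) {κ : Type}
    (c : κ → ℤ) where
  Z : DGAlg.{u}
  i : Q ⟶ Z
  w : κ → Z
  comm : IsComm Z
  free : IsFree Z (Sum.elim deg (Sum.elim c fun k => c k + 1))
    (Sum.elim (fun a => alg i (x a)) (Sum.elim w fun k => Z.d (w k)))

/-- The differential is the derivation prescribed by d_Q on Q, w ↦ dw and dw ↦ 0. Twice its square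
is its commutator with itself, so it is enough that the square vanishes on generators. -/
lemma exists_extension {Q : DGAlg.{u}} {ι : Type} {deg : ι → ℤ} {x : ι → Q} (hQ : IsFree Q deg x)
    {κ : Type} (c : κ → ℤ) : Nonempty (Extension Q deg x c) := by
  obtain ⟨F, g, hFc, hF⟩ := exists_free.{u} (Sum.elim deg (Sum.elim c fun k => c k + 1))
  obtain ⟨i, hi, hix⟩ := hQ.lift F hFc (fun a => g (Sum.inl a)) fun a => hF.mem (Sum.inl a)
  obtain ⟨D, hD, hDg⟩ := hF.exists_isDer hFc isGraded_id 1
    (Sum.elim (fun a => i (Q.d (x a))) (Sum.elim (fun k => g (Sum.inr (Sum.inr k))) fun _ => 0)) (by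
      rintro (a | k | k)
      · exact hi _ _ (Q.d_mem (hQ.mem a))
      · exact hF.mem (Sum.inr (Sum.inr k))
      · exact zero_mem _)
  have hDi : ∀ q, D (i q) = i (Q.d q) := fun q => by
    refine LinearMap.congr_fun (hQ.isDer_ext (hD.comp_right (g := AlgHom.id ℂ F) hi)
      (isDer_comp_d hi) fun a => ?_) q
    change D (i (x a)) = i (Q.d (x a))
    rw [hix, hDg]; rfl
  have hDD : ∀ a, D (D a) = 0 := by
    have h2 : D * D - (-1 : ℂ) ^ ((1 : ℤ) * 1) • (D * D) = (2 : ℂ) • (D * D) := by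
      rw [one_mul, zpow_one]; module
    have h := hD.commutator hD
    rw [h2] at h
    have h0 := hF.isDer_ext h (isDer_zero _) (by
      rintro (a | k | k)
      · rw [LinearMap.smul_apply, Module.End.mul_apply, hDg, Sum.elim_inl, hDi, Q.d_d, map_zero]
        simp
      · rw [LinearMap.smul_apply, Module.End.mul_apply, hDg, Sum.elim_inr, Sum.elim_inl, hDg]
        simp
      · rw [LinearMap.smul_apply, Module.End.mul_apply, hDg]
        simp)
    intro a
    have := LinearMap.congr_fun h0 a
    rw [LinearMap.smul_apply, LinearMap.zero_apply, smul_eq_zero] at this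
    exact this.resolve_left two_ne_zero
  let Z : DGAlg.{u} :=
    { carrier := F, grading := F.grading, d := D, d_mem := fun h => hD.mem _ _ h, d_d := hDD
      leibniz := fun h b => by have := hD.leibniz_id h b; rwa [one_mul] at this }
  have hZF : IsFree Z (Sum.elim deg (Sum.elim c fun k => c k + 1)) g := ⟨hF.mem, hF.adjoin_eq_top, hF.lift⟩
  refine ⟨⟨Z, ofAlg (B := Z) i hi fun q => (hDi q).symm, fun k => g (Sum.inr (Sum.inl k)), hFc, ?_⟩⟩
  convert hZF using 1
  ext (a | k | k)
  · exact hix a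
  · rfl
  · exact hDg (Sum.inr (Sum.inl k))

/-! ### Contracting an extension with the Euler derivation. -/

namespace Extension

variable {Q : DGAlg.{u}} {ι : Type} {deg : ι → ℤ} {x : ι → Q} {κ : Type} {c : κ → ℤ}
  (E : Extension Q deg x c)

lemma w_mem (k : κ) : E.w k ∈ E.Z.grading (c k) := E.free.mem (Sum.inr (Sum.inl k))

/-- The w k are free parameters in the dg sense: their images may be any elements of the right
degrees, and those of the dw k are then forced. -/
lemma exists_desc (hB : IsComm B) (g : Q ⟶ B) (b : κ → B) (hb : ∀ k, b k ∈ B.grading (c k)) 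
    (hQ : IsFree Q deg x) : ∃ G : E.Z ⟶ B, E.i ≫ G = g ∧ ∀ k, alg G (E.w k) = b k := by
  obtain ⟨G, hG, hGx⟩ := E.free.lift B hB
    (Sum.elim (fun a => alg g (x a)) (Sum.elim b fun k => B.d (b k))) (by
      rintro (a | k | k)
      · exact isGraded_alg g _ _ (hQ.mem a)
      · exact hb k
      · exact B.d_mem (hb k))
  have hGi : G.comp (alg E.i) = alg g := hQ.algHom_ext fun a => hGx (Sum.inl a)
  refine ⟨ofAlg G hG fun z => ?_, hom_ext fun q => AlgHom.congr_fun hGi q,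
    fun k => hGx (Sum.inr (Sum.inl k))⟩
  refine (d_map_of_adjoin hG ?_ (by rw [E.free.adjoin_eq_top]; trivial)).symm
  rintro _ ⟨a | k | k, rfl⟩
  · change B.d (G.comp (alg E.i) (x a)) = G (E.Z.d (alg E.i (x a)))
    rw [hGi, ← alg_d, ← alg_d, ← hGi]; rfl
  · have h1 := hGx (Sum.inr (Sum.inl k))
    have h2 := hGx (Sum.inr (Sum.inr k))
    simp only [Sum.elim_inr, Sum.elim_inl] at h1 h2 ⊢
    rw [h1, h2]
  · have h2 := hGx (Sum.inr (Sum.inr k))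
    simp only [Sum.elim_inr] at h2 ⊢
    rw [h2, B.d_d, E.Z.d_d, map_zero]

lemma desc_ext {G G' : E.Z ⟶ B} (hi : E.i ≫ G = E.i ≫ G')
    (hw : ∀ k, alg G (E.w k) = alg G' (E.w k)) : G = G' := by
  refine hom_ext fun z => AlgHom.congr_fun (E.free.algHom_ext ?_) z
  rintro (a | k | k)
  · exact AlgHom.congr_fun (congrArg alg hi) (x a)
  · exact hw k
  · simp only [Sum.elim_inr]
    rw [alg_d, alg_d, hw]

/-- The ordered generators involving only the pairs in `L`. -/
def gens (L : Set κ) : Set E.Z :=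
  Set.range (fun a => alg E.i (x a)) ∪ E.w '' L ∪ (fun k => E.Z.d (E.w k)) '' L

lemma homogeneous_of_mem_gens {L : Set κ} {z : E.Z} (hz : z ∈ E.gens L) :
    ∃ m, z ∈ E.Z.grading m := by
  rcases hz with (⟨a, rfl⟩ | ⟨k, _, rfl⟩) | ⟨k, _, rfl⟩
  · exact ⟨_, E.free.mem (Sum.inl a)⟩
  · exact ⟨_, E.w_mem k⟩
  · exact ⟨_, E.Z.d_mem (E.w_mem k)⟩

/-- The derivation `s` with `s (dw) = w` and its bracket with `d`, the Euler derivation. -/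
structure IsHomotopy (s : Module.End ℂ E.Z) : Prop where
  isDer : IsDer (AlgHom.id ℂ E.Z) (-1) s
  apply_i : ∀ q, s (alg E.i q) = 0
  apply_w : ∀ k, s (E.w k) = 0
  apply_dw : ∀ k, s (E.Z.d (E.w k)) = E.w k

lemma exists_isHomotopy (hQ : IsFree Q deg x) : ∃ s, E.IsHomotopy s := by
  obtain ⟨s, hs, hsx⟩ := E.free.exists_isDer E.comm isGraded_id (-1)
    (Sum.elim (fun _ => 0) (Sum.elim (fun _ => 0) E.w)) (by
      rintro (a | k | k)
      · exact zero_mem _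
      · exact zero_mem _
      · simp only [Sum.elim_inr, add_neg_cancel_right]; exact E.w_mem k)
  refine ⟨s, hs, fun q => ?_, fun k => hsx (Sum.inr (Sum.inl k)), fun k => hsx (Sum.inr (Sum.inr k))⟩
  exact LinearMap.congr_fun (hQ.isDer_ext (hs.comp_right (g := AlgHom.id ℂ E.Z) (isGraded_alg E.i))
    (isDer_zero _) fun a => hsx (Sum.inl a)) q

/-- The Euler derivation. -/
def euler (s : Module.End ℂ E.Z) : Module.End ℂ E.Z := E.Z.d * s + s * E.Z.d

variable {E} {s : Module.End ℂ E.Z}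

namespace IsHomotopy

lemma isDer_euler (hs : E.IsHomotopy s) : IsDer (AlgHom.id ℂ E.Z) 0 (E.euler s) := by
  have := (isDer_d (A := E.Z)).commutator hs.isDer
  rw [show (1 : ℤ) + -1 = 0 by ring, show (1 : ℤ) * -1 = -1 by ring] at this
  rwa [show E.Z.d * s - (-1 : ℂ) ^ (-1 : ℤ) • (s * E.Z.d) = E.euler s by
    rw [zpow_neg_one, show (-1 : ℂ)⁻¹ = -1 by norm_num, euler]; module] at this

lemma euler_i (hs : E.IsHomotopy s) (q : Q) : E.euler s (alg E.i q) = 0 := by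
  simp [euler, hs.apply_i, ← alg_d]

lemma euler_w (hs : E.IsHomotopy s) (k : κ) : E.euler s (E.w k) = E.w k := by
  simp [euler, hs.apply_w, hs.apply_dw]

lemma euler_dw (hs : E.IsHomotopy s) (k : κ) : E.euler s (E.Z.d (E.w k)) = E.Z.d (E.w k) := by
  simp [euler, hs.apply_dw, E.Z.d_d]

lemma euler_comm_d : Commute (E.euler s) E.Z.d := by
  change (E.Z.d * s + s * E.Z.d) * E.Z.d = E.Z.d * (E.Z.d * s + s * E.Z.d)
  rw [add_mul, mul_add, mul_assoc s, ← mul_assoc E.Z.d E.Z.d, d_mul_d]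
  simp [mul_assoc]

lemma comp_s (hs : E.IsHomotopy s) {r : E.Z ⟶ B} (hr : ∀ k, alg r (E.w k) = 0) (z : E.Z) :
    alg r (s z) = 0 := by
  refine LinearMap.congr_fun (E.free.isDer_ext (hs.isDer.comp_left (g := AlgHom.id ℂ E.Z)
    (isGraded_alg r)) (isDer_zero _) ?_) z
  rintro (a | k | k)
  · change alg r (s (alg E.i (x a))) = 0
    rw [hs.apply_i, map_zero]
  · change alg r (s (E.w k)) = 0
    rw [hs.apply_w, map_zero]
  · change alg r (s (E.Z.d (E.w k))) = 0
    rw [hs.apply_dw, hr]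

lemma comp_euler (hs : E.IsHomotopy s) {r : E.Z ⟶ B} (hr : ∀ k, alg r (E.w k) = 0) (z : E.Z) :
    alg r (E.euler s z) = 0 := by
  change alg r (E.Z.d (s z) + s (E.Z.d z)) = 0
  rw [map_add, alg_d, hs.comp_s hr, hs.comp_s hr]; simp

lemma euler_mul (hs : E.IsHomotopy s) (a b : E.Z) :
    E.euler s (a * b) = E.euler s a * b + a * E.euler s b := by
  have := hs.isDer_euler.mul a b
  simpa [twist] using this

/-- The Euler derivation counts the letters w and dw, so Z is the sum of the image of i and of
eigenspaces with eigenvalues k + 1. A finite product of factors X - (k + 1) kills the second part,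
and it does not vanish at 0. -/
lemma exists_polynomial (hs : E.IsHomotopy s) (z : E.Z) :
    ∃ q : Q, ∃ p : Polynomial ℂ, p.eval 0 ≠ 0 ∧ Polynomial.aeval (E.euler s) p (z - alg E.i q) = 0 := by
  let W : Submodule ℂ E.Z := ⨆ k : ℕ, LinearMap.ker (E.euler s - ((k : ℂ) + 1) • 1)
  have hW : ∀ u ∈ W, ∃ p : Polynomial ℂ, p.eval 0 ≠ 0 ∧ Polynomial.aeval (E.euler s) p u = 0 := by
    intro u hu
    induction hu using Submodule.iSup_induction' with
    | mem k u hu =>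
      refine ⟨Polynomial.X - Polynomial.C ((k : ℂ) + 1), ?_, ?_⟩
      · simp only [Polynomial.eval_sub, Polynomial.eval_X, Polynomial.eval_C, zero_sub, ne_eq,
          neg_eq_zero]
        exact_mod_cast Nat.succ_ne_zero k
      · rw [map_sub, Polynomial.aeval_X, Polynomial.aeval_C, Algebra.algebraMap_eq_smul_one]
        exact hu
    | zero => exact ⟨1, by simp, by simp⟩
    | add u v _ _ hu hv =>
      obtain ⟨p, hp, hp'⟩ := hu
      obtain ⟨p₂, hp₂, hp₂'⟩ := hv
      refine ⟨p * p₂, by simp [hp, hp₂], ?_⟩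
      rw [map_add]
      nth_rewrite 1 [mul_comm p]
      rw [map_mul, map_mul, Module.End.mul_apply, Module.End.mul_apply, hp', hp₂']
      simp
  let M : Submodule ℂ E.Z := LinearMap.range (alg E.i).toLinearMap ⊔ W
  have hker : ∀ {k : ℂ} {u : E.Z}, u ∈ LinearMap.ker (E.euler s - k • 1) ↔ E.euler s u = k • u := by
    intro k u
    rw [LinearMap.mem_ker, LinearMap.sub_apply, sub_eq_zero]; rfl
  have h1 : ∀ q ∈ Algebra.adjoin ℂ (Set.range (Sum.elim (fun a => alg E.i (x a))
      (Sum.elim E.w fun k => E.Z.d (E.w k)))), ∀ m ∈ M, q * m ∈ M := by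
    -- A generator of eigenvalue one sends the image of i into the first eigenspace and raises all
    -- other eigenvalues by one.
    have hgen : ∀ v, E.euler s v = v → ∀ m ∈ M, v * m ∈ M := by
      intro v hv m hm
      obtain ⟨_, ⟨q, rfl⟩, u, hu, rfl⟩ := Submodule.mem_sup.1 hm
      rw [mul_add]
      refine add_mem (Submodule.mem_sup_right (Submodule.mem_iSup_of_mem 0 (hker.2 ?_)))
        (Submodule.mem_sup_right ?_)
      · clear hm
        rw [hs.euler_mul, hv, AlgHom.toLinearMap_apply, hs.euler_i]; simp
      · clear hm
        induction hu using Submodule.iSup_induction' with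
        | mem k u hu =>
          refine Submodule.mem_iSup_of_mem (k + 1) (hker.2 ?_)
          rw [hs.euler_mul, hv, hker.1 hu, mul_smul_comm]
          push_cast
          module
        | zero => rw [mul_zero]; exact zero_mem _
        | add u v _ _ hu hv => rw [mul_add]; exact add_mem hu hv
    intro q hq
    induction hq using Algebra.adjoin_induction with
    | mem q h =>
      obtain ⟨a | k | k, rfl⟩ := h
      · intro m hm
        obtain ⟨_, ⟨q, rfl⟩, u, hu, rfl⟩ := Submodule.mem_sup.1 hm
        rw [mul_add]
        refine add_mem (Submodule.mem_sup_left ⟨x a * q, by simp⟩) (Submodule.mem_sup_right ?_)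
        clear hm
        induction hu using Submodule.iSup_induction' with
        | mem k u hu =>
          refine Submodule.mem_iSup_of_mem k (hker.2 ?_)
          rw [hs.euler_mul, Sum.elim_inl, hs.euler_i, hker.1 hu]; simp
        | zero => rw [mul_zero]; exact zero_mem _
        | add u v _ _ hu hv => rw [mul_add]; exact add_mem hu hv
      · exact hgen _ (hs.euler_w k)
      · exact hgen _ (hs.euler_dw k)
    | algebraMap r =>
      intro m hm
      rw [← Algebra.smul_def]; exact Submodule.smul_mem _ _ hm
    | add a b _ _ h1 h2 => intro m hm; rw [add_mul]; exact add_mem (h1 m hm) (h2 m hm)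
    | mul a b _ _ h1 h2 => intro m hm; rw [mul_assoc]; exact h1 _ (h2 m hm)
  have hz : z ∈ M := by
    rw [← mul_one z]
    exact h1 z (by rw [E.free.adjoin_eq_top]; trivial) 1 (Submodule.mem_sup_left ⟨1, map_one (alg E.i)⟩)
  obtain ⟨_, ⟨q, rfl⟩, u, hu, rfl⟩ := Submodule.mem_sup.1 hz
  obtain ⟨p, hp, hp'⟩ := hW u hu
  exact ⟨q, p, hp, by simpa using hp'⟩

/-- On the kernel of the retraction, the Euler derivation is invertible by a polynomial in itself. -/
lemma exists_inverse (hs : E.IsHomotopy s) {r : E.Z ⟶ Q} (hir : E.i ≫ r = 𝟙 Q)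
    (hr : ∀ k, alg r (E.w k) = 0) {z : E.Z} (hz : alg r z = 0) :
    ∃ t : Polynomial ℂ, z = E.euler s (Polynomial.aeval (E.euler s) t z) := by
  obtain ⟨q, p, hp, h⟩ := hs.exists_polynomial z
  have hir' : ∀ q, alg r (alg E.i q) = q := fun q => AlgHom.congr_fun (congrArg alg hir) q
  -- Splitting off the constant term p(0) ≠ 0 shows that, up to the nonzero scalar p(0), the element
  -- is minus the Euler derivation of a polynomial in it.
  have e : Polynomial.aeval (E.euler s) p =
      p.eval 0 • (1 : Module.End ℂ E.Z) + E.euler s * Polynomial.aeval (E.euler s) p.divX := by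
    conv_lhs => rw [← Polynomial.X_mul_divX_add p]
    rw [map_add, map_mul, Polynomial.aeval_X, Polynomial.aeval_C, Polynomial.coeff_zero_eq_eval_zero,
      Algebra.algebraMap_eq_smul_one, add_comm]
  rw [e] at h
  have h' : p.eval 0 • (z - alg E.i q) +
    E.euler s (Polynomial.aeval (E.euler s) p.divX (z - alg E.i q)) = 0 := h
  -- The retraction annihilates the image of the Euler derivation, so applying it leaves p(0) q = 0
  -- up to sign.
  have hq : q = 0 := by
    have := congrArg (alg r) h'
    rw [map_add, hs.comp_euler hr, map_smul, map_sub, hz, hir', map_zero, add_zero, zero_sub,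
      smul_neg, neg_eq_zero, smul_eq_zero] at this
    exact this.resolve_left hp
  rw [hq, map_zero, sub_zero] at h'
  refine ⟨-(Polynomial.C (p.eval 0)⁻¹ * p.divX), ?_⟩
  rw [map_neg, map_mul, Polynomial.aeval_C, Algebra.algebraMap_eq_smul_one, smul_mul_assoc, one_mul,
    LinearMap.neg_apply, LinearMap.smul_apply, map_neg, map_smul]
  have h3 := eq_neg_of_add_eq_zero_right h'
  rw [h3, smul_neg, neg_neg, smul_smul, inv_mul_cancel₀ hp, one_smul]

lemma commute_aeval_euler (t : Polynomial ℂ) :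
    Commute (Polynomial.aeval (E.euler s) t) E.Z.d := by
  induction t using Polynomial.induction_on' with
  | add p q hp hq => rw [map_add]; exact hp.add_left hq
  | monomial n a =>
    rw [Polynomial.aeval_monomial]
    exact (show Commute _ _ from Algebra.commutes a _).mul_left (euler_comm_d.pow_left n)

lemma aeval_euler_mem (t : Polynomial ℂ) (M : Submodule ℂ E.Z)
    (hM : ∀ z ∈ M, E.euler s z ∈ M) {z : E.Z} (hz : z ∈ M) :
    Polynomial.aeval (E.euler s) t z ∈ M := by
  induction t using Polynomial.induction_on' generalizing z with
  | add p q hp hq => rw [map_add]; exact add_mem (hp hz) (hq hz)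
  | monomial n a =>
    rw [Polynomial.aeval_monomial, Algebra.algebraMap_eq_smul_one, smul_mul_assoc, one_mul]
    refine Submodule.smul_mem _ _ ?_
    induction n generalizing z with
    | zero => simpa using hz
    | succ n ih => rw [pow_succ, Module.End.mul_apply]; exact ih (hM z hz)

/-- Cocycles in the kernel of the retraction are coboundaries, without new generators. -/
lemma exists_primitive (hs : E.IsHomotopy s) {r : E.Z ⟶ Q} (hir : E.i ≫ r = 𝟙 Q)
    (hr : ∀ k, alg r (E.w k) = 0) (L : Set κ) {n : ℤ} {z : E.Z} (hz : alg r z = 0)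
    (hd : E.Z.d z = 0) (hn : z ∈ E.Z.grading (n + 1)) (hL : z ∈ Algebra.adjoin ℂ (E.gens L)) :
    ∃ h ∈ E.Z.grading n, h ∈ Algebra.adjoin ℂ (E.gens L) ∧ E.Z.d h = z ∧ alg r h = 0 := by
  obtain ⟨t, ht⟩ := hs.exists_inverse hir hr hz
  set T := Polynomial.aeval (E.euler s) t
  have hTd : E.Z.d (T z) = 0 := by
    have h := LinearMap.congr_fun (commute_aeval_euler (s := s) t).eq z
    rw [Module.End.mul_apply, Module.End.mul_apply, hd, map_zero] at h
    exact h.symm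
  -- T is the polynomial inverting the Euler derivation e on z. It commutes with d, so d(Tz) = 0 and
  -- z = e(Tz) = d(s(Tz)). Both s and e preserve the subalgebra on the pairs in L, so no new
  -- generators enter.
  refine ⟨s (T z), ?_, ?_, ?_, hs.comp_s hr _⟩
  · have h1 := hs.isDer.mem (n + 1) (T z) (aeval_euler_mem t (E.Z.grading (n + 1))
      (fun z hz => by simpa using hs.isDer_euler.mem _ z hz) hn)
    rwa [add_neg_cancel_right] at h1
  · have hsub : ∀ y ∈ E.gens L, (AlgHom.id ℂ E.Z) y ∈ Algebra.adjoin ℂ (E.gens L) :=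
      fun y hy => Algebra.subset_adjoin hy
    have h1 : ∀ y ∈ Subalgebra.toSubmodule (Algebra.adjoin ℂ (E.gens L)),
        E.euler s y ∈ Subalgebra.toSubmodule (Algebra.adjoin ℂ (E.gens L)) := fun y hy => by
      refine hs.isDer_euler.mem_adjoin (fun y hy => E.homogeneous_of_mem_gens hy) hsub ?_ hy
      rintro y ((⟨a, rfl⟩ | ⟨k, hk, rfl⟩) | ⟨k, hk, rfl⟩)
      · rw [hs.euler_i]; exact zero_mem _
      · rw [hs.euler_w]; exact Algebra.subset_adjoin (Or.inl (Or.inr ⟨k, hk, rfl⟩))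
      · simp only [hs.euler_dw]; exact Algebra.subset_adjoin (Or.inr ⟨k, hk, rfl⟩)
    refine hs.isDer.mem_adjoin (fun y hy => E.homogeneous_of_mem_gens hy) hsub ?_
      (aeval_euler_mem t _ h1 hL)
    rintro y ((⟨a, rfl⟩ | ⟨k, hk, rfl⟩) | ⟨k, hk, rfl⟩)
    · rw [hs.apply_i]; exact zero_mem _
    · rw [hs.apply_w]; exact zero_mem _
    · simp only [hs.apply_dw]; exact Algebra.subset_adjoin (Or.inl (Or.inr ⟨k, hk, rfl⟩))
  · conv_rhs => rw [ht]
    change _ = E.Z.d (s (T z)) + s (E.Z.d (T z))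
    rw [hTd, map_zero, add_zero]

end IsHomotopy

end Extension

end DGAlg

namespace DGAlg

variable {A B C : DGAlg.{u}}

namespace Extension

variable {Q : DGAlg.{u}} {ι : Type} {deg : ι → ℤ} {x : ι → Q} {κ : Type} {c : κ → ℤ}

lemma exists_retraction (E : Extension Q deg x c) (hQ : IsFree Q deg x) (hc : IsComm Q) :
    ∃ r : E.Z ⟶ Q, E.i ≫ r = 𝟙 Q ∧ ∀ k, alg r (E.w k) = 0 :=
  E.exists_desc hc (𝟙 Q) (fun _ => 0) (fun _ => zero_mem _) hQ

/-- The retraction gives injectivity on cohomology. For a cocycle z the difference z - i(r z) is a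
cocycle killed by r, hence a boundary via s and the inverse of the Euler derivation. -/
lemma quasiIso_i (E : Extension Q deg x c) (hQ : IsFree Q deg x) (hc : IsComm Q) :
    quasiIso E.i := by
  obtain ⟨r, hir, hr⟩ := E.exists_retraction hQ hc
  obtain ⟨s, hs⟩ := E.exists_isHomotopy hQ
  have hir' : ∀ q, alg r (alg E.i q) = q := fun q => AlgHom.congr_fun (congrArg alg hir) q
  rw [quasiIso_iff]
  refine coneAcyclic_of (fun v => alg_d E.i v) (fun v w hv hw => ⟨alg r w, ?_⟩) fun z hz => ?_
  · rw [← alg_d, ← hw]; exact hir' v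
  · have h0 : alg r (z - alg E.i (alg r z)) = 0 := by rw [map_sub, hir', sub_self]
    have hd : E.Z.d (z - alg E.i (alg r z)) = 0 := by
      rw [map_sub, ← alg_d, ← alg_d, hz, map_zero, map_zero, sub_self]
    obtain ⟨t, ht⟩ := hs.exists_inverse hir hr h0
    refine ⟨alg r z, s (Polynomial.aeval (E.euler s) t (z - alg E.i (alg r z))), ?_, ?_⟩
    · rw [← alg_d, hz, map_zero]
    · have h := LinearMap.congr_fun (IsHomotopy.commute_aeval_euler (s := s) t).eq
        (z - alg E.i (alg r z))
      rw [Module.End.mul_apply, Module.End.mul_apply, hd, map_zero] at h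
      have h2 : E.euler s (Polynomial.aeval (E.euler s) t (z - alg E.i (alg r z))) =
        E.Z.d (s (Polynomial.aeval (E.euler s) t (z - alg E.i (alg r z)))) +
        s (E.Z.d (Polynomial.aeval (E.euler s) t (z - alg E.i (alg r z)))) := rfl
      rw [← h, map_zero, add_zero] at h2
      rw [AlgHom.toLinearMap_apply, ← h2, ← ht]
      abel

lemma range_i_le (E : Extension Q deg x c) (hQ : IsFree Q deg x) (L : Set κ) (q : Q) :
    alg E.i q ∈ Algebra.adjoin ℂ (E.gens L) := by
  refine map_mem_adjoin (X := Set.range x) ?_ (by rw [hQ.adjoin_eq_top]; trivial)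
  rintro _ ⟨a, rfl⟩
  exact Algebra.subset_adjoin (Or.inl (Or.inl ⟨a, rfl⟩))

lemma gens_mono (E : Extension Q deg x c) {L L' : Set κ} (h : L ⊆ L') : E.gens L ⊆ E.gens L' :=
  Set.union_subset_union (Set.union_subset_union_right _ (Set.image_mono h)) (Set.image_mono h)

end Extension

/-! ### Mapping cylinders and lifting up to homotopy. -/

section Cylinder

variable {P Q : DGAlg.{u}} {ι κ : Type} {deg : ι → ℤ} {x : ι → Q} {degP : κ → ℤ} {y : κ → P}

/-- `j` is a second end of the (relative) mapping cylinder `E` of `f : P ⟶ Q`, agreeing with `f` on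
the generators in `J`. -/
def IsCylinderMap (E : Extension Q deg x fun k => degP k - 1) (y : κ → P) (f : P ⟶ Q) (J : Set κ)
    (j : P ⟶ E.Z) : Prop :=
  ∀ k, (k ∈ J → alg j (y k) = alg E.i (alg f (y k))) ∧
    (k ∉ J → ∃ h ∈ Algebra.adjoin ℂ (E.gens {l | degP k < degP l}),
      alg j (y k) = alg E.i (alg f (y k)) + E.Z.d (E.w k) + h)

lemma exists_neg_lt [Finite κ] (degP : κ → ℤ) : ∃ m : ℕ, ∀ k, -(m : ℤ) < degP k := by
  obtain ⟨N, hN⟩ := (Set.finite_range fun k => (-degP k).toNat).bddAbove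
  refine ⟨N + 1, fun k => ?_⟩
  have : (-degP k).toNat ≤ N := hN ⟨k, rfl⟩
  push_cast
  omega

/-- The second end is defined on generators y by descending degree. The element j(dy) - i f(dy) is a
cocycle killed by r, so it is dh with h built from pairs already treated; put j(y) = i f(y) + dw +
h. Controlling the generators in h makes the later change of generators triangular. On J, which is
closed under d, the two ends coincide. -/
lemma exists_isCylinderMap [Finite κ] (hP : IsFree P degP y) (hdeg : ∀ k, degP k ≤ 0)
    (hQ : IsFree Q deg x)
    (E : Extension Q deg x fun k => degP k - 1) {r : E.Z ⟶ Q} (hir : E.i ≫ r = 𝟙 Q)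
    (hr : ∀ k, alg r (E.w k) = 0) (f : P ⟶ Q) {J : Set κ}
    (hJ : ∀ k ∈ J, P.d (y k) ∈ Algebra.adjoin ℂ (y '' J)) :
    ∃ j : P ⟶ E.Z, j ≫ r = f ∧ IsCylinderMap E y f J j := by
  obtain ⟨s, hs⟩ := E.exists_isHomotopy hQ
  have hir' : ∀ q, alg r (alg E.i q) = q := fun q => AlgHom.congr_fun (congrArg alg hir) q
  -- At stage m the map is only required to commute with d on J and on generators of degree greater
  -- than -m. For a generator of degree -m its differential involves only those of larger degree,
  -- which are settled.
  have key : ∀ m : ℕ, ∃ F : P →ₐ[ℂ] E.Z, IsGraded F ∧ (alg r).comp F = alg f ∧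
      (∀ k ∈ J, F (y k) = alg E.i (alg f (y k))) ∧
      (∀ k, k ∉ J → -(m : ℤ) < degP k → ∃ h ∈ Algebra.adjoin ℂ (E.gens {l | degP k < degP l}),
        F (y k) = alg E.i (alg f (y k)) + E.Z.d (E.w k) + h) ∧
      ∀ k, k ∈ J ∨ -(m : ℤ) < degP k → E.Z.d (F (y k)) = F (P.d (y k)) := by
    intro m
    induction m with
    | zero =>
      refine ⟨(alg E.i).comp (alg f), (isGraded_alg _).comp (isGraded_alg _), ?_, fun _ _ => rfl,
        fun k _ hk => ?_, fun k _ => ?_⟩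
      · ext p; exact hir' _
      · have := hdeg k; push_cast at hk; omega
      · simp only [AlgHom.comp_apply, alg_d]
    | succ m ih =>
      obtain ⟨F, hF, hrF, hFJ, hFm, hFd⟩ := ih
      have hrF' : ∀ p, alg r (F p) = alg f p := fun p => AlgHom.congr_fun hrF p
      have hdy : ∀ k, degP k = -(m : ℤ) → P.d (y k) ∈ Algebra.adjoin ℂ (y '' {l | -(m : ℤ) < degP l}) := by
        intro k hk
        have := hP.mem_adjoin_of_mem_grading hdeg (P.d_mem (hP.mem k))
        refine Algebra.adjoin_mono (Set.image_mono fun l hl => ?_) this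
        have hl : degP k + 1 ≤ degP l := hl
        change -(m : ℤ) < degP l
        omega
      have hprim : ∀ k, k ∉ J → degP k = -(m : ℤ) → ∃ h ∈ E.Z.grading (degP k),
          h ∈ Algebra.adjoin ℂ (E.gens {l | degP k < degP l}) ∧
          E.Z.d h = F (P.d (y k)) - alg E.i (alg f (P.d (y k))) ∧ alg r h = 0 := by
        intro k hkJ hk
        refine hs.exists_primitive hir hr _ ?_ ?_ ?_ ?_
        · rw [map_sub, hrF', hir', sub_self]
        · rw [map_sub, ← alg_d, ← alg_d, P.d_d, map_zero, map_zero, sub_zero]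
          rw [d_map_of_adjoin hF ?_ (hdy k hk), P.d_d, map_zero]
          rintro _ ⟨l, hl, rfl⟩
          exact hFd l (Or.inr hl)
        · have hd := P.d_mem (hP.mem k)
          exact sub_mem (hF _ _ hd) (isGraded_alg _ _ _ (isGraded_alg _ _ _ hd))
        · refine sub_mem (map_mem_adjoin ?_ (hdy k hk)) (E.range_i_le hQ _ _)
          rintro _ ⟨l, hl, rfl⟩
          have hl : -(m : ℤ) < degP l := hl
          have hkl : degP k < degP l := by omega
          by_cases hlJ : l ∈ J
          · rw [hFJ l hlJ]; exact E.range_i_le hQ _ _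
          · obtain ⟨h, hh, e⟩ := hFm l hlJ hl
            rw [e]
            refine add_mem (add_mem (E.range_i_le hQ _ _)
              (Algebra.subset_adjoin (Or.inr ⟨l, hkl, rfl⟩))) ?_
            exact Algebra.adjoin_mono (E.gens_mono fun l' (hl' : degP l < degP l') =>
              hkl.trans hl') hh
      classical
      choose! h hh1 hh2 hh3 hh4 using hprim
      obtain ⟨F', hF', hF'y⟩ := hP.lift E.Z E.comm
        (fun k => if k ∉ J ∧ degP k = -(m : ℤ) then alg E.i (alg f (y k)) + E.Z.d (E.w k) + h k
          else F (y k)) (fun k => by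
            split_ifs with hk
            · refine add_mem (add_mem (isGraded_alg _ _ _ (isGraded_alg _ _ _ (hP.mem k))) ?_)
                (hh1 k hk.1 hk.2)
              have := E.Z.d_mem (E.w_mem k)
              rwa [sub_add_cancel] at this
            · exact hF _ _ (hP.mem k))
      have hold : ∀ k, k ∈ J ∨ -(m : ℤ) < degP k → F' (y k) = F (y k) := by
        intro k hk
        rw [hF'y, if_neg]
        rintro ⟨h1, h2⟩
        rcases hk with hk | hk
        · exact h1 hk
        · omega
      have hnew : ∀ k, k ∉ J → degP k = -(m : ℤ) →
          F' (y k) = alg E.i (alg f (y k)) + E.Z.d (E.w k) + h k := fun k h1 h2 => by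
        rw [hF'y, if_pos ⟨h1, h2⟩]
      have hrF'' : (alg r).comp F' = alg f := hP.algHom_ext fun k => by
        rw [AlgHom.comp_apply, hF'y]
        split_ifs with hk
        · rw [map_add, map_add, hir', alg_d, hr, hh4 k hk.1 hk.2]; simp
        · exact hrF' _
      have hm : ∀ k, -((m + 1 : ℕ) : ℤ) < degP k → degP k = -(m : ℤ) ∨ -(m : ℤ) < degP k := by
        intro k hk; push_cast at hk; omega
      refine ⟨F', hF', hrF'', fun k hk => by rw [hold k (Or.inl hk), hFJ k hk], fun k hkJ hk => ?_,
        fun k hk => ?_⟩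
      · rcases hm k hk with hk | hk
        · exact ⟨h k, hh2 k hkJ hk, hnew k hkJ hk⟩
        · rw [hold k (Or.inr hk)]; exact hFm k hkJ hk
      · have hcase : (k ∉ J ∧ degP k = -(m : ℤ)) ∨ k ∈ J ∨ -(m : ℤ) < degP k := by
          by_cases hkJ : k ∈ J
          · exact Or.inr (Or.inl hkJ)
          · rcases hm k (hk.resolve_left hkJ) with h | h
            · exact Or.inl ⟨hkJ, h⟩
            · exact Or.inr (Or.inr h)
        rcases hcase with ⟨hkJ, hk⟩ | hk
        · rw [hnew k hkJ hk, map_add, map_add, E.Z.d_d, hh3 k hkJ hk, ← alg_d, ← alg_d, add_zero,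
            add_sub_cancel]
          refine algHom_eq_on_adjoin ?_ (hdy k hk)
          rintro _ ⟨l, hl, rfl⟩
          exact (hold l (Or.inr hl)).symm
        · rw [hold k hk, hFd k hk]
          rcases hk with hk | hk
          · refine algHom_eq_on_adjoin ?_ (hJ k hk)
            rintro _ ⟨l, hl, rfl⟩
            exact (hold l (Or.inl hl)).symm
          · have := hP.mem_adjoin_of_mem_grading hdeg (P.d_mem (hP.mem k))
            refine algHom_eq_on_adjoin ?_ this
            rintro _ ⟨l, hl, rfl⟩
            have hl : degP k + 1 ≤ degP l := hl
            exact (hold l (Or.inr (by omega))).symm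
  obtain ⟨N, hN⟩ := exists_neg_lt degP
  obtain ⟨F, hF, hrF, hFJ, hFm, hFd⟩ := key N
  refine ⟨ofAlg F hF fun p => (d_map_of_adjoin hF ?_ (X := Set.range y)
    (by rw [hP.adjoin_eq_top]; trivial)).symm, hom_ext fun p => AlgHom.congr_fun hrF p,
    fun k => ⟨hFJ k, fun hk => hFm k hk (hN k)⟩⟩
  rintro _ ⟨k, rfl⟩
  exact hFd k (Or.inr (hN k))

/-- The generators of the cylinder may be replaced by those of its two ends and the `w k`. -/
lemma IsCylinderMap.isFree [Finite ι] [Finite κ] {E : Extension Q deg x fun k => degP k - 1}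
    (hP : IsFree P degP y) (hdeg : ∀ k, degP k ≤ 0)
    (hQ : IsFree Q deg x) {f : P ⟶ Q} {j : P ⟶ E.Z} (hj : IsCylinderMap E y f ∅ j) :
    IsFree E.Z (Sum.elim deg (Sum.elim (fun k => degP k - 1) degP))
      (Sum.elim (fun a => alg E.i (x a)) (Sum.elim E.w fun k => alg j (y k))) := by
  have hE := E.free
  simp only [sub_add_cancel] at hE
  -- The generator dw k gets rank 1 - deg y k and all others rank 0: the correction h involves dw l
  -- only when deg y l > deg y k, and the shift by one puts i f(y k) below dw k even in degree 0.
  refine hE.triangular ?_ (Sum.elim (fun _ => 0) (Sum.elim (fun _ => 0)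
    fun k => (-degP k).toNat + 1)) ?_
  · rintro (a | k | k)
    · exact hE.mem (Sum.inl a)
    · exact hE.mem (Sum.inr (Sum.inl k))
    · exact isGraded_alg j _ _ (hP.mem k)
  · rintro (a | k | k)
    · simp only [Sum.elim_inl, sub_self]; exact zero_mem _
    · simp only [Sum.elim_inl, Sum.elim_inr, sub_self]; exact zero_mem _
    · obtain ⟨h, hh, e⟩ := (hj k).2 (fun h => h)
      simp only [Sum.elim_inr]
      rw [e]
      have hsub : Algebra.adjoin ℂ (E.gens {l | degP k < degP l}) ≤ Algebra.adjoin ℂ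
          ((Sum.elim (fun a => alg E.i (x a)) (Sum.elim E.w fun k => E.Z.d (E.w k))) ''
          {k' | Sum.elim (fun _ => 0) (Sum.elim (fun _ => 0) fun k => (-degP k).toNat + 1) k' <
            (-degP k).toNat + 1}) := by
        refine Algebra.adjoin_mono ?_
        rintro z ((⟨a, rfl⟩ | ⟨l, hl, rfl⟩) | ⟨l, hl, rfl⟩)
        · exact ⟨Sum.inl a, Nat.succ_pos _, rfl⟩
        · exact ⟨Sum.inr (Sum.inl l), Nat.succ_pos _, rfl⟩
        · refine ⟨Sum.inr (Sum.inr l), ?_, rfl⟩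
          have hl : degP k < degP l := hl
          have := hdeg l
          change (-degP l).toNat + 1 < (-degP k).toNat + 1
          omega
      refine hsub ?_
      rw [show alg E.i (alg f (y k)) + E.Z.d (E.w k) + h - E.Z.d (E.w k) =
        alg E.i (alg f (y k)) + h by abel]
      exact add_mem (E.range_i_le hQ _ _) hh

/-- Lifting up to homotopy along quasi-isomorphisms, relative to the generators in `J`. -/
lemma exists_lift_homotopy [Finite κ] {R : DGAlg.{u}} {degR : κ → ℤ} {y : κ → R}
    (hR : IsFree R degR y) (hdeg : ∀ k, degR k ≤ 0) (hA : IsComm A) (hB : IsComm B)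
    {E : Extension R degR y fun k => degR k - 1}
    {J : Set κ} (hJ : ∀ k ∈ J, R.d (y k) ∈ Algebra.adjoin ℂ (y '' J))
    {j : R ⟶ E.Z} (hj : IsCylinderMap E y (𝟙 R) J j)
    {w : A ⟶ B} (hw : quasiIso w) (F : R ⟶ B) (a : κ → A)
    (ha : ∀ k ∈ J, a k ∈ A.grading (degR k)) (haF : ∀ k ∈ J, alg w (a k) = alg F (y k))
    (had : ∀ G : R →ₐ[ℂ] A, IsGraded G → (∀ k ∈ J, G (y k) = a k) →
      ∀ k ∈ J, A.d (a k) = G (R.d (y k))) :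
    ∃ (G : R ⟶ A) (H : E.Z ⟶ B), E.i ≫ H = F ∧ j ≫ H = G ≫ w ∧ ∀ k ∈ J, alg G (y k) = a k := by
  classical
  -- The lift G and the homotopy H are corrected together by descending degree; H is a dg map at
  -- every stage because the images of the w k are arbitrary.
  have key : ∀ m : ℕ, ∃ (G : R →ₐ[ℂ] A) (H : E.Z ⟶ B), IsGraded G ∧ E.i ≫ H = F ∧
      (∀ k ∈ J, G (y k) = a k) ∧
      ∀ k, k ∈ J ∨ -(m : ℤ) < degR k → A.d (G (y k)) = G (R.d (y k)) ∧
        alg w (G (y k)) = alg H (alg j (y k)) := by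
    intro m
    induction m with
    | zero =>
      obtain ⟨G, hG, hGy⟩ := hR.lift A hA (fun k => if k ∈ J then a k else 0) fun k => by
        split_ifs with hk
        · exact ha k hk
        · exact zero_mem _
      obtain ⟨H, hH, -⟩ := E.exists_desc hB F (fun _ => 0) (fun _ => zero_mem _) hR
      have hGJ : ∀ k ∈ J, G (y k) = a k := fun k hk => by rw [hGy, if_pos hk]
      refine ⟨G, H, hG, hH, hGJ, fun k hk => ?_⟩
      have hk : k ∈ J := hk.resolve_right (by have := hdeg k; push_cast; omega)
      refine ⟨by rw [hGJ k hk]; exact had G hG hGJ k hk, ?_⟩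
      rw [hGJ k hk, haF k hk, (hj k).1 hk, ← hH]; rfl
    | succ m ih =>
      obtain ⟨G, H, hG, hH, hGJ, hGm⟩ := ih
      have hdy : ∀ k, degR k = -(m : ℤ) → R.d (y k) ∈ Algebra.adjoin ℂ (y '' {l | -(m : ℤ) < degR l}) := by
        intro k hk
        have := hR.mem_adjoin_of_mem_grading hdeg (R.d_mem (hR.mem k))
        refine Algebra.adjoin_mono (Set.image_mono fun l hl => ?_) this
        have hl : degR k + 1 ≤ degR l := hl
        change -(m : ℤ) < degR l
        omega
      have hjk : ∀ k, ∃ h : E.Z, k ∉ J → h ∈ Algebra.adjoin ℂ (E.gens {l | degR k < degR l}) ∧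
          alg j (y k) = alg E.i (y k) + E.Z.d (E.w k) + h := by
        intro k
        by_cases hk : k ∈ J
        · exact ⟨0, fun h => absurd hk h⟩
        · obtain ⟨h, h1, h2⟩ := (hj k).2 hk
          exact ⟨h, fun _ => ⟨h1, h2⟩⟩
      choose h hh1 hh2 using fun k => hjk k
      -- The pair (G(dy), F(y) + H(h)) is a cocycle in the cone of w, so it is the boundary of some
      -- (a', b'). Setting G(y) = a' and H(w k) = -b' gives H(j y) = F(y) - db' + H(h) = w(a').
      have hex : ∀ k, k ∉ J → degR k = -(m : ℤ) → ∃ a' ∈ A.grading (degR k),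
          ∃ b' ∈ B.grading (degR k - 1), A.d a' = G (R.d (y k)) ∧
            alg w a' + B.d b' = alg F (y k) + alg H (h k) := by
        intro k hkJ hk
        have hhm : h k ∈ E.Z.grading (degR k) := by
          have e : h k = alg j (y k) - alg E.i (y k) - E.Z.d (E.w k) := by
            rw [hh2 k hkJ]; abel
          rw [e]
          have h1 := E.Z.d_mem (E.w_mem k)
          rw [sub_add_cancel] at h1
          exact sub_mem (sub_mem (isGraded_alg _ _ _ (hR.mem k)) (isGraded_alg _ _ _ (hR.mem k))) h1
        refine homogeneous_of_quasiIso hw (hG _ _ (R.d_mem (hR.mem k)))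
          (add_mem (isGraded_alg _ _ _ (hR.mem k)) (isGraded_alg _ _ _ hhm)) ?_ ?_
        · rw [d_map_of_adjoin hG ?_ (hdy k hk), R.d_d, map_zero]
          rintro _ ⟨l, hl, rfl⟩
          exact (hGm l (Or.inr hl)).1
        · have h1 : alg w (G (R.d (y k))) = alg H (alg j (R.d (y k))) := by
            refine algHom_eq_on_adjoin (f := (alg w).comp G) (g := (alg H).comp (alg j)) ?_ (hdy k hk)
            rintro _ ⟨l, hl, rfl⟩
            exact (hGm l (Or.inr hl)).2
          rw [h1, alg_d, alg_d, hh2 k hkJ, map_add, map_add, map_add, map_add, alg_d H (E.w k),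
            B.d_d, ← hH]
          simp
      choose! a' ha' b' hb' hda hwb using hex
      obtain ⟨G', hG', hG'y⟩ := hR.lift A hA
        (fun k => if k ∉ J ∧ degR k = -(m : ℤ) then a' k else G (y k)) fun k => by
          split_ifs with hk
          · exact ha' k hk.1 hk.2
          · exact hG _ _ (hR.mem k)
      obtain ⟨H', hH', hH'w⟩ := E.exists_desc hB F
        (fun k => if k ∉ J ∧ degR k = -(m : ℤ) then -b' k else alg H (E.w k)) (fun k => by
          split_ifs with hk
          · exact neg_mem (hb' k hk.1 hk.2)
          · exact isGraded_alg _ _ _ (E.w_mem k)) hR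
      have hold : ∀ k, k ∈ J ∨ -(m : ℤ) < degR k → G' (y k) = G (y k) := by
        intro k hk
        rw [hG'y, if_neg]
        rintro ⟨h1, h2⟩
        rcases hk with hk | hk
        · exact h1 hk
        · omega
      have hi : ∀ q, alg H' (alg E.i q) = alg H (alg E.i q) := fun q =>
        AlgHom.congr_fun (congrArg alg (hH'.trans hH.symm)) q
      have hHold : ∀ k, -(m : ℤ) ≤ degR k → ∀ z ∈ Algebra.adjoin ℂ (E.gens {l | degR k < degR l}),
          alg H' z = alg H z := by
        intro k hk z hz
        refine algHom_eq_on_adjoin ?_ hz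
        have hwl : ∀ l, degR k < degR l → alg H' (E.w l) = alg H (E.w l) := fun l hl => by
          rw [hH'w, if_neg]; rintro ⟨_, h2⟩; omega
        rintro z ((⟨b, rfl⟩ | ⟨l, hl, rfl⟩) | ⟨l, hl, rfl⟩)
        · exact hi _
        · exact hwl l hl
        · simp only [alg_d]; rw [hwl l hl]
      have hHj : ∀ k, k ∈ J ∨ -(m : ℤ) < degR k → alg H' (alg j (y k)) = alg H (alg j (y k)) := by
        intro k hk
        by_cases hkJ : k ∈ J
        · rw [(hj k).1 hkJ]; exact hi _
        · have hk := hk.resolve_left hkJ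
          have hwk : alg H' (E.w k) = alg H (E.w k) := by
            rw [hH'w, if_neg]; rintro ⟨_, h2⟩; omega
          rw [hh2 k hkJ]
          simp only [map_add, alg_d]
          rw [hi, hwk, hHold k hk.le _ (hh1 k hkJ)]
      refine ⟨G', H', hG', hH', fun k hk => by rw [hold k (Or.inl hk), hGJ k hk], fun k hk => ?_⟩
      have hcase : (k ∉ J ∧ degR k = -(m : ℤ)) ∨ k ∈ J ∨ -(m : ℤ) < degR k := by
        by_cases hkJ : k ∈ J
        · exact Or.inr (Or.inl hkJ)
        · have := hk.resolve_left hkJ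
          push_cast at this
          have : degR k = -(m : ℤ) ∨ -(m : ℤ) < degR k := by omega
          rcases this with h | h
          · exact Or.inl ⟨hkJ, h⟩
          · exact Or.inr (Or.inr h)
      rcases hcase with ⟨hkJ, hk⟩ | hk
      · have hGk : G' (y k) = a' k := by rw [hG'y, if_pos ⟨hkJ, hk⟩]
        constructor
        · rw [hGk, hda k hkJ hk]
          refine algHom_eq_on_adjoin ?_ (hdy k hk)
          rintro _ ⟨l, hl, rfl⟩
          exact (hold l (Or.inr hl)).symm
        · rw [hGk, hh2 k hkJ, map_add, map_add, alg_d, hH'w, if_pos ⟨hkJ, hk⟩,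
            hHold k hk.ge _ (hh1 k hkJ), map_neg]
          have e : alg H' (alg E.i (y k)) = alg F (y k) := AlgHom.congr_fun (congrArg alg hH') (y k)
          rw [e, ← add_sub_cancel_right (alg w (a' k)) (B.d (b' k)), hwb k hkJ hk]
          abel
      · rw [hold k hk, hHj k hk]
        refine ⟨(hGm k hk).1.trans ?_, (hGm k hk).2⟩
        rcases hk with hk | hk
        · refine algHom_eq_on_adjoin ?_ (hJ k hk)
          rintro _ ⟨l, hl, rfl⟩
          exact (hold l (Or.inl hl)).symm
        · have := hR.mem_adjoin_of_mem_grading hdeg (R.d_mem (hR.mem k))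
          refine algHom_eq_on_adjoin ?_ this
          rintro _ ⟨l, hl, rfl⟩
          have hl : degR k + 1 ≤ degR l := hl
          exact (hold l (Or.inr (by omega))).symm
  obtain ⟨N, hN⟩ := exists_neg_lt degR
  obtain ⟨G, H, hG, hH, hGJ, hGm⟩ := key N
  refine ⟨ofAlg G hG fun p => (d_map_of_adjoin hG ?_ (X := Set.range y)
    (by rw [hR.adjoin_eq_top]; trivial)).symm, H, hH, hom_ext fun p => ?_, hGJ⟩
  · rintro _ ⟨k, rfl⟩
    exact (hGm k (Or.inr (hN k))).1
  · exact AlgHom.congr_fun (hR.algHom_ext (f := (alg H).comp (alg j)) (g := (alg w).comp G)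
      fun k => (hGm k (Or.inr (hN k))).2.symm) p

end Cylinder

end DGAlg

/-! ### Polynomial dg algebras and their cylinder objects. -/

namespace DGAlg

variable {A B C P Q : DGAlg.{u}}

/-- A graded-commutative dg algebra that is free on finitely many generators of nonpositive
degrees. -/
def IsPoly (P : DGAlg.{u}) : Prop :=
  IsComm P ∧ ∃ (ι : Type) (_ : Finite ι) (deg : ι → ℤ) (x : ι → P), (∀ i, deg i ≤ 0) ∧ IsFree P deg x

/-- `i` adjoins finitely many contractible pairs of generators to a polynomial algebra. -/
def IsExtension (i : Q ⟶ A) : Prop :=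
  ∃ (ι : Type) (_ : Finite ι) (deg : ι → ℤ) (x : ι → Q) (κ : Type) (_ : Finite κ) (c : κ → ℤ)
    (w : κ → A), (∀ a, deg a ≤ 0) ∧ (∀ k, c k ≤ -1) ∧ IsFree Q deg x ∧ IsComm A ∧
    IsFree A (Sum.elim deg (Sum.elim c fun k => c k + 1))
      (Sum.elim (fun a => alg i (x a)) (Sum.elim w fun k => A.d (w k)))

lemma IsExtension.isPoly {i : Q ⟶ A} (h : IsExtension i) : IsPoly A := by
  obtain ⟨ι, _, deg, x, κ, _, c, w, hdeg, hc, -, hA, hf⟩ := h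
  refine ⟨hA, _, inferInstance, _, _, ?_, hf⟩
  rintro (a | k | k)
  · exact hdeg a
  · exact (hc k).trans (by norm_num)
  · have := hc k; simp only [Sum.elim_inr]; omega

lemma IsPoly.isNonpos (h : IsPoly P) : IsNonpos P := by
  obtain ⟨-, ι, _, deg, x, hdeg, hf⟩ := h
  exact hf.isNonpos hdeg

lemma IsExtension.quasiIso {i : Q ⟶ A} (h : IsExtension i) (hQ : IsComm Q) : quasiIso i := by
  obtain ⟨ι, _, deg, x, κ, _, c, w, hdeg, hc, hx, hA, hf⟩ := h
  let E : Extension Q deg x c := ⟨A, i, w, hA, hf⟩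
  exact E.quasiIso_i hx hQ

lemma quasiIso_of_retraction {i : Q ⟶ A} {r : A ⟶ Q} (h : i ≫ r = 𝟙 Q) (hi : quasiIso i) :
    quasiIso r :=
  quasiIso_of_comp_right hi (h ▸ quasiIso_id Q)

/-- A cylinder object with its lifting properties. -/
structure CylinderObject (P : DGAlg.{u}) where
  Z : DGAlg.{u}
  i : P ⟶ Z
  j : P ⟶ Z
  r : Z ⟶ P
  i_r : i ≫ r = 𝟙 P
  j_r : j ≫ r = 𝟙 P
  isExtension : IsExtension i
  lift : ∀ {A B : DGAlg.{u}}, IsComm A → IsComm B → ∀ w : A ⟶ B, DGAlg.quasiIso w → ∀ F : P ⟶ B,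
    ∃ (G : P ⟶ A) (H : Z ⟶ B), i ≫ H = F ∧ j ≫ H = G ≫ w
  lift_homotopy : ∀ {A B : DGAlg.{u}}, IsComm A → IsComm B → ∀ w : A ⟶ B, DGAlg.quasiIso w →
    ∀ (f g : P ⟶ A) (K : Z ⟶ B), i ≫ K = f ≫ w → j ≫ K = g ≫ w →
      ∃ K' : Z ⟶ A, i ≫ K' = f ∧ j ≫ K' = g
  euclidean : ∀ {A : DGAlg.{u}}, IsComm A → ∀ K L : Z ⟶ A, i ≫ K = i ≫ L →
    ∃ M : Z ⟶ A, i ≫ M = j ≫ K ∧ j ≫ M = j ≫ L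

section

variable {ι : Type} [Finite ι] {deg : ι → ℤ} {x : ι → P}

/-- The cylinder is itself free on the generators of its two ends and the w k. The relative lifting
statement applies to it, with the lift prescribed on both ends by f and g; this calls for a second
cylinder, on the first one, relative to J. -/
lemma cylinder_lift_homotopy (hP : IsFree P deg x) (hdeg : ∀ a, deg a ≤ 0)
    (E : Extension P deg x fun k => deg k - 1) {j : P ⟶ E.Z} (hj : IsCylinderMap E x (𝟙 P) ∅ j)
    (hA : IsComm A) (hB : IsComm B) {w : A ⟶ B} (hw : quasiIso w) (f g : P ⟶ A) (K : E.Z ⟶ B)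
    (hf : E.i ≫ K = f ≫ w) (hg : j ≫ K = g ≫ w) : ∃ K' : E.Z ⟶ A, E.i ≫ K' = f ∧ j ≫ K' = g := by
  have hfree := hj.isFree hP hdeg hP
  have hdeg' : ∀ k, Sum.elim deg (Sum.elim (fun k => deg k - 1) deg) k ≤ 0 := by
    rintro (a | a | a)
    · exact hdeg a
    · have := hdeg a; simp only [Sum.elim_inr, Sum.elim_inl]; omega
    · exact hdeg a
  set y := Sum.elim (fun a => alg E.i (x a)) (Sum.elim E.w fun k => alg j (x k)) with hy
  let J : Set (ι ⊕ (ι ⊕ ι)) := Set.range Sum.inl ∪ Set.range (Sum.inr ∘ Sum.inr)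
  have hi : ∀ p, alg E.i p ∈ Algebra.adjoin ℂ (y '' J) := fun p => by
    refine map_mem_adjoin (X := Set.range x) ?_ (by rw [hP.adjoin_eq_top]; trivial)
    rintro _ ⟨a, rfl⟩
    exact Algebra.subset_adjoin ⟨Sum.inl a, Or.inl ⟨a, rfl⟩, rfl⟩
  have hjp : ∀ p, alg j p ∈ Algebra.adjoin ℂ (y '' J) := fun p => by
    refine map_mem_adjoin (X := Set.range x) ?_ (by rw [hP.adjoin_eq_top]; trivial)
    rintro _ ⟨a, rfl⟩
    exact Algebra.subset_adjoin ⟨Sum.inr (Sum.inr a), Or.inr ⟨a, rfl⟩, rfl⟩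
  have hJ : ∀ k ∈ J, E.Z.d (y k) ∈ Algebra.adjoin ℂ (y '' J) := by
    rintro k (⟨a, rfl⟩ | ⟨a, rfl⟩)
    · change E.Z.d (alg E.i (x a)) ∈ _
      rw [← alg_d]; exact hi _
    · change E.Z.d (alg j (x a)) ∈ _
      rw [← alg_d]; exact hjp _
  obtain ⟨E'⟩ := exists_extension hfree fun k =>
    Sum.elim deg (Sum.elim (fun k => deg k - 1) deg) k - 1
  obtain ⟨r', hir', hr'⟩ := E'.exists_retraction hfree E.comm
  obtain ⟨j', -, hj'⟩ := exists_isCylinderMap hfree hdeg' hfree E' hir' hr' (𝟙 E.Z) hJ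
  obtain ⟨G, -, -, -, hG⟩ := exists_lift_homotopy hfree hdeg' hA hB hJ hj' hw K
    (Sum.elim (fun a => alg f (x a)) (Sum.elim (fun _ => 0) fun a => alg g (x a)))
    (by
      rintro k (⟨a, rfl⟩ | ⟨a, rfl⟩)
      · exact isGraded_alg f _ _ (hP.mem a)
      · exact isGraded_alg g _ _ (hP.mem a))
    (by
      rintro k (⟨a, rfl⟩ | ⟨a, rfl⟩)
      · exact (AlgHom.congr_fun (congrArg alg hf) (x a)).symm
      · exact (AlgHom.congr_fun (congrArg alg hg) (x a)).symm)
    (by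
      intro G _ hGJ
      have h1 : G.comp (alg E.i) = alg f := hP.algHom_ext fun a => hGJ _ (Or.inl ⟨a, rfl⟩)
      have h2 : G.comp (alg j) = alg g := hP.algHom_ext fun a => hGJ _ (Or.inr ⟨a, rfl⟩)
      rintro k (⟨a, rfl⟩ | ⟨a, rfl⟩)
      · change A.d (alg f (x a)) = G (E.Z.d (alg E.i (x a)))
        rw [← alg_d, ← alg_d, ← h1]; rfl
      · change A.d (alg g (x a)) = G (E.Z.d (alg j (x a)))
        rw [← alg_d, ← alg_d, ← h2]; rfl)
  refine ⟨G, hom_ext fun p => ?_, hom_ext fun p => ?_⟩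
  · exact AlgHom.congr_fun (hP.algHom_ext (f := alg (E.i ≫ G)) (g := alg f)
      fun a => hG _ (Or.inl ⟨a, rfl⟩)) p
  · exact AlgHom.congr_fun (hP.algHom_ext (f := alg (j ≫ G)) (g := alg g)
      fun a => hG _ (Or.inr ⟨a, rfl⟩)) p

/-- Two copies of the cylinder are glued along the end i, and K, L combine to a map KL on the
result. The two free ends both become the identity after the quasi-isomorphism r₂ ≫ r to P, so the
homotopy r between them lifts to the glued algebra; composing with KL yields the claim. -/
lemma cylinder_euclidean (hP : IsFree P deg x) (hPc : IsComm P) (hdeg : ∀ a, deg a ≤ 0)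
    (E : Extension P deg x fun k => deg k - 1) {r : E.Z ⟶ P} (hir : E.i ≫ r = 𝟙 P)
    (hr : ∀ k, alg r (E.w k) = 0) {j : P ⟶ E.Z} (hjr : j ≫ r = 𝟙 P)
    (hj : IsCylinderMap E x (𝟙 P) ∅ j) (hA : IsComm A) (K L : E.Z ⟶ A) (h : E.i ≫ K = E.i ≫ L) :
    ∃ M : E.Z ⟶ A, E.i ≫ M = j ≫ K ∧ j ≫ M = j ≫ L := by
  obtain ⟨E₂⟩ := exists_extension E.free fun k => deg k - 1
  obtain ⟨r₂, hir₂, hr₂⟩ := E₂.exists_retraction E.free E.comm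
  obtain ⟨κ, hκi, hκw⟩ := E.exists_desc E₂.comm (E.i ≫ E₂.i) E₂.w E₂.w_mem hP
  obtain ⟨KL, hKLi, hKLw⟩ := E₂.exists_desc hA K (fun k => alg L (E.w k))
    (fun k => isGraded_alg L _ _ (E.w_mem k)) E.free
  have h1 : κ ≫ r₂ ≫ r = r := by
    refine E.desc_ext ?_ fun k => ?_
    · rw [← Category.assoc, hκi, Category.assoc, reassoc_of% hir₂]
    · simp only [alg_comp, AlgHom.comp_apply]
      rw [hκw, hr₂, map_zero, hr]
  have h2 : κ ≫ KL = L := by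
    refine E.desc_ext ?_ fun k => ?_
    · rw [← Category.assoc, hκi, Category.assoc, hKLi, h]
    · simp only [alg_comp, AlgHom.comp_apply]
      rw [hκw, hKLw]
  have hq : quasiIso (r₂ ≫ r) :=
    quasiIso_comp (quasiIso_of_retraction hir₂ (E₂.quasiIso_i E.free E.comm))
      (quasiIso_of_retraction hir (E.quasiIso_i hP hPc))
  obtain ⟨M, hM1, hM2⟩ := cylinder_lift_homotopy hP hdeg E hj E₂.comm hPc hq (j ≫ E₂.i) (j ≫ κ) r
    (by rw [hir, Category.assoc, reassoc_of% hir₂, hjr]) (by rw [Category.assoc, h1])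
  refine ⟨M ≫ KL, ?_, ?_⟩
  · rw [← Category.assoc, hM1, Category.assoc, hKLi]
  · rw [← Category.assoc, hM2, Category.assoc, h2]

end

lemma IsPoly.exists_cylinderObject (hP : IsPoly P) : Nonempty (CylinderObject P) := by
  obtain ⟨hPc, ι, _, deg, x, hdeg, hx⟩ := hP
  obtain ⟨E⟩ := exists_extension hx fun k => deg k - 1
  obtain ⟨r, hir, hr⟩ := E.exists_retraction hx hPc
  obtain ⟨j, hjr, hj⟩ := exists_isCylinderMap hx hdeg hx E hir hr (𝟙 P) (J := ∅) (by simp)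
  refine ⟨⟨E.Z, E.i, j, r, hir, hjr, ⟨ι, inferInstance, deg, x, ι, inferInstance, _, E.w, hdeg,
    fun k => by have := hdeg k; omega, hx, E.comm, E.free⟩, fun hA hB w hw F => ?_,
    fun hA hB w hw f g K => cylinder_lift_homotopy hx hdeg E hj hA hB hw f g K,
    fun hA K L => cylinder_euclidean hx hPc hdeg E hir hr hjr hj hA K L⟩⟩
  obtain ⟨G, H, h1, h2, -⟩ := exists_lift_homotopy hx hdeg hA hB (J := ∅) (by simp) hj hw F
    (fun _ => 0) (by simp) (by simp) (by simp)
  exact ⟨G, H, h1, h2⟩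

/-- `f` factors through a mapping cylinder: `f = j ≫ r`, where `i ≫ r = 𝟙`, `i` is an extension by
contractible pairs, and `Z` is freely generated by `P` and further generators. -/
lemma IsPoly.exists_mappingCylinder (hP : IsPoly P) (hQ : IsPoly Q) (f : P ⟶ Q) :
    ∃ (Z : DGAlg.{u}) (i : Q ⟶ Z) (j : P ⟶ Z) (r : Z ⟶ Q), i ≫ r = 𝟙 Q ∧ j ≫ r = f ∧
      IsExtension i ∧ ∃ (κ ι : Type) (deg : κ → ℤ) (y : κ → P) (deg' : ι → ℤ) (x : ι → Z),
        IsFree P deg y ∧ Finite κ ∧ Finite ι ∧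
        IsFree Z (Sum.elim deg' deg) (Sum.elim x fun k => alg j (y k)) := by
  obtain ⟨hPc, κ, _, degP, y, hdegP, hy⟩ := hP
  obtain ⟨hQc, ι, _, deg, x, hdeg, hx⟩ := hQ
  obtain ⟨E⟩ := exists_extension hx fun k => degP k - 1
  obtain ⟨r, hir, hr⟩ := E.exists_retraction hx hQc
  obtain ⟨j, hjr, hj⟩ := exists_isCylinderMap hy hdegP hx E hir hr f (J := ∅) (by simp)
  refine ⟨E.Z, E.i, j, r, hir, hjr, ⟨ι, inferInstance, deg, x, κ, inferInstance, _, E.w, hdeg,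
    fun k => by have := hdegP k; omega, hx, E.comm, E.free⟩, κ, ι ⊕ κ, degP, y,
    Sum.elim deg fun k => degP k - 1, Sum.elim (fun a => alg E.i (x a)) E.w, hy, inferInstance, inferInstance, ?_⟩
  have h := (hj.isFree hy hdegP hx).reindex (Equiv.sumAssoc ι κ κ)
  convert h using 1
  · ext ((a | a) | a) <;> rfl
  · ext ((a | a) | a) <;> rfl

end DGAlg

/-! ### Maps out of a polynomial algebra in the homotopy category. -/

namespace CDGAlg

open DGAlg

lemma isComm (A : CDGAlg.{u}) : IsComm A.obj := A.property.1

/-- The object of `CDGAlg` given by a polynomial algebra. -/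
def ofPoly {P : DGAlg.{u}} (hP : IsPoly P) : CDGAlg.{u} := ⟨P, hP.1, hP.isNonpos⟩

/-- A morphism of dg algebras as a morphism of commutative dg algebras. -/
def homMk {A B : CDGAlg.{u}} (f : A.obj ⟶ B.obj) : A ⟶ B := ObjectProperty.homMk f

lemma lift_map_toHo {D : Type*} [Category D] (G : CDGAlg.{u} ⥤ D) (hG : quasiIso.IsInvertedBy G)
    {A B : CDGAlg.{u}} (k : A ⟶ B) :
    (Localization.Construction.lift G hG).map (toHo.map k) = G.map k := by
  have h := Functor.congr_hom (Localization.Construction.fac G hG) k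
  rw [Functor.comp_map] at h
  refine h.trans ?_
  erw [eqToHom_refl, eqToHom_refl, Category.comp_id, Category.id_comp]

section Homotopy

variable {P : CDGAlg.{u}} (c : CylinderObject P.obj)

/-- Left homotopy with respect to a cylinder object. -/
def LeftHomotopic {A : CDGAlg.{u}} (f g : P ⟶ A) : Prop :=
  ∃ K : c.Z ⟶ A.obj, c.i ≫ K = f.hom ∧ c.j ≫ K = g.hom

/-- The retraction gives reflexivity, and a reflexive Euclidean relation is an equivalence relation.
-/
lemma leftHomotopic_equivalence (A : CDGAlg.{u}) :
    Equivalence (LeftHomotopic c (A := A)) := by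
  have hr : ∀ f : P ⟶ A, LeftHomotopic c f f := fun f =>
    ⟨c.r ≫ f.hom, by rw [← Category.assoc, c.i_r, Category.id_comp],
      by rw [← Category.assoc, c.j_r, Category.id_comp]⟩
  have he : ∀ f g k : P ⟶ A, LeftHomotopic c f g → LeftHomotopic c f k → LeftHomotopic c g k := by
    rintro f g k ⟨K, h1, h2⟩ ⟨L, h3, h4⟩
    obtain ⟨M, h5, h6⟩ := c.euclidean (isComm A) K L (h1.trans h3.symm)
    exact ⟨M, h5.trans h2, h6.trans h4⟩
  exact ⟨hr, fun {f g} h => he f g f h (hr f), fun {f g k} h h' =>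
    he g f k (he f g f h (hr f)) h'⟩

lemma LeftHomotopic.comp {A B : CDGAlg.{u}} {f g : P ⟶ A} (h : LeftHomotopic c f g) (k : A ⟶ B) :
    LeftHomotopic c (f ≫ k) (g ≫ k) := by
  obtain ⟨K, h1, h2⟩ := h
  exact ⟨K ≫ k.hom, by rw [← Category.assoc, h1]; rfl, by rw [← Category.assoc, h2]; rfl⟩

/-- The functor of homotopy classes of maps out of `P`. -/
def homotopyClasses : CDGAlg.{u} ⥤ Type u where
  obj A := Quot (LeftHomotopic c (A := A))
  map k := ↾(Quot.map (· ≫ k) fun _ _ h => h.comp c k)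
  map_id A := by
    ext ⟨f⟩
    exact congrArg (Quot.mk _) (Category.comp_id f)
  map_comp k l := by
    ext ⟨f⟩
    exact congrArg (Quot.mk _) (Category.assoc f k l).symm

lemma quot_eq_iff {A : CDGAlg.{u}} {f g : P ⟶ A} :
    Quot.mk (LeftHomotopic c) f = Quot.mk (LeftHomotopic c) g ↔ LeftHomotopic c f g := by
  rw [Quot.eq, (leftHomotopic_equivalence c A).eqvGen_iff]

/-- Surjectivity is lifting of maps up to homotopy; injectivity is lifting of homotopies. -/
lemma homotopyClasses_inverts : quasiIso.IsInvertedBy (homotopyClasses c) := by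
  intro A B w hw
  rw [isIso_iff_bijective]
  constructor
  · rintro ⟨f⟩ ⟨g⟩ h
    obtain ⟨K, h1, h2⟩ := (quot_eq_iff c).1 h
    exact (quot_eq_iff c).2 (c.lift_homotopy (isComm A) (isComm B) w.hom hw f.hom g.hom K h1 h2)
  · rintro ⟨F⟩
    obtain ⟨G, H, h1, h2⟩ := c.lift (isComm A) (isComm B) w.hom hw F.hom
    refine ⟨Quot.mk _ (homMk G), ?_⟩
    exact (quot_eq_iff c).2 ((leftHomotopic_equivalence c B).symm ⟨H, h1, h2⟩)

/-- Homotopy classes of maps out of P factor through the localization; the class of the identity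
then recovers each map from its image there. -/
lemma leftHomotopic_of_toHo_eq {A : CDGAlg.{u}} {f g : P ⟶ A} (h : toHo.map f = toHo.map g) :
    LeftHomotopic c f g := by
  rw [← quot_eq_iff]
  have h1 := congrArg (fun φ => (Localization.Construction.lift (homotopyClasses c)
    (homotopyClasses_inverts c)).map φ) h
  have h2 : (homotopyClasses c).map f = (homotopyClasses c).map g :=
    (lift_map_toHo _ (homotopyClasses_inverts c) f).symm.trans
      (h1.trans (lift_map_toHo _ (homotopyClasses_inverts c) g))
  have h3 := congrArg (fun φ => φ (Quot.mk _ (𝟙 P))) h2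
  have e2 : ∀ k : P ⟶ A, (homotopyClasses c).map k (Quot.mk _ (𝟙 P)) = Quot.mk _ k := fun k =>
    congrArg (Quot.mk _) (Category.id_comp k)
  exact (e2 f).symm.trans (h3.trans (e2 g))

/-- The common retraction of the two ends becomes invertible, so the ends become equal. -/
lemma toHo_eq_of_leftHomotopic {A : CDGAlg.{u}} {f g : P ⟶ A} (h : LeftHomotopic c f g) :
    toHo.map f = toHo.map g := by
  obtain ⟨K, h1, h2⟩ := h
  let Z : CDGAlg.{u} := ofPoly c.isExtension.isPoly
  let i : P ⟶ Z := homMk c.i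
  let j : P ⟶ Z := homMk c.j
  let r : Z ⟶ P := homMk c.r
  let K' : Z ⟶ A := homMk K
  have hr : quasiIso r := quasiIso_of_retraction c.i_r (c.isExtension.quasiIso (isComm P))
  have : IsIso (toHo.map r) := Localization.inverts toHo quasiIso r hr
  have e1 : i ≫ r = 𝟙 P := InducedCategory.hom_ext c.i_r
  have e2 : j ≫ r = 𝟙 P := InducedCategory.hom_ext c.j_r
  have e3 : i ≫ K' = f := InducedCategory.hom_ext h1
  have e4 : j ≫ K' = g := InducedCategory.hom_ext h2
  have e5 : toHo.map i = toHo.map j := by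
    rw [← cancel_mono (toHo.map r), ← Functor.map_comp, ← Functor.map_comp, e1, e2]
  rw [← e3, ← e4, Functor.map_comp, Functor.map_comp, e5]

end Homotopy

/-- Every map out of a polynomial algebra in the homotopy category is represented by a morphism. -/
lemma exists_toHo_map_eq {P : CDGAlg.{u}} (hP : IsPoly P.obj) {A : CDGAlg.{u}}
    (φ : toHo.obj P ⟶ toHo.obj A) : ∃ f : P ⟶ A, toHo.map f = φ := by
  obtain ⟨c⟩ := hP.exists_cylinderObject
  -- S consists of the ψ whose composite with any represented map out of P is again represented. It
  -- is stable under composition and contains the images of morphisms and, by lifting, the formal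
  -- inverses; hence it is everything. The localization has the same objects, whence the transports
  -- along equalities.
  let S : MorphismProperty Ho.{u} := fun X Y ψ => ∀ (A B : CDGAlg.{u}) (hA : toHo.obj A = X)
    (hB : toHo.obj B = Y) (f : P ⟶ A),
    ∃ g : P ⟶ B, toHo.map g = toHo.map f ≫ eqToHom hA ≫ ψ ≫ eqToHom hB.symm
  have hobj : ∀ A B : CDGAlg.{u}, toHo.obj A = toHo.obj B → A = B := fun A B h =>
    (Localization.Construction.objEquiv quasiIso).injective h
  have hS : S = ⊤ := by
    have : S.IsStableUnderComposition := ⟨fun {X Y Z} ψ χ h1 h2 A B hA hB f => by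
      obtain ⟨Y', rfl⟩ := (Localization.Construction.objEquiv quasiIso).surjective Y
      obtain ⟨g, hg⟩ := h1 A Y' hA rfl f
      obtain ⟨k, hk⟩ := h2 Y' B rfl hB g
      refine ⟨k, ?_⟩
      rw [hk, hg]
      simp only [Category.assoc]
      congr 3
      erw [eqToHom_trans_assoc, eqToHom_refl, Category.id_comp]⟩
    refine Localization.Construction.morphismProperty_eq_top S (fun X Y k A B hA hB f => ?_)
      (fun X Y w hw A B hA hB f => ?_)
    · obtain rfl := hobj _ _ hA
      obtain rfl := hobj _ _ hB
      exact ⟨f ≫ k, by simp⟩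
    · obtain rfl := hobj _ _ hA
      obtain rfl := hobj _ _ hB
      obtain ⟨G, H, h1, h2⟩ := c.lift (isComm _) (isComm _) w.hom hw f.hom
      have e : toHo.map f = toHo.map (homMk G ≫ w) := toHo_eq_of_leftHomotopic c ⟨H, h1, h2⟩
      refine ⟨homMk G, ?_⟩
      rw [e, Functor.map_comp, eqToHom_refl, eqToHom_refl, Category.id_comp, Category.comp_id,
        Category.assoc]
      exact ((Category.comp_id _).symm.trans
        (congrArg _ (Localization.Construction.wIso w hw).hom_inv_id.symm))
  have hφ : S φ := by rw [hS]; trivial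
  obtain ⟨g, hg⟩ := hφ P A rfl rfl (𝟙 P)
  exact ⟨g, by simpa using hg⟩

/-- The cohomology functor. -/
def cohomologyFunctor : CDGAlg.{u} ⥤ Type u where
  obj A := A.obj.Cohomology
  map f := ↾(cohomologyMap f.hom)
  map_id A := by
    ext x
    obtain ⟨a, rfl⟩ := Submodule.Quotient.mk_surjective _ x
    rfl
  map_comp f g := by
    ext x
    obtain ⟨a, rfl⟩ := Submodule.Quotient.mk_surjective _ x
    rfl

/-- Cohomology inverts quasi-isomorphisms, so it factors through the localization and sends f to a
bijection. -/
lemma quasiIso_of_isIso_toHo {A B : CDGAlg.{u}} (f : A ⟶ B) [IsIso (toHo.map f)] : quasiIso f := by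
  have hinv : quasiIso.IsInvertedBy cohomologyFunctor.{u} := fun A B w hw =>
    (isIso_iff_bijective _).2 hw
  have h1 : IsIso ((Localization.Construction.lift cohomologyFunctor hinv).map (toHo.map f)) :=
    inferInstance
  have h2 : IsIso (cohomologyFunctor.map f) := by
    rwa [← lift_map_toHo _ hinv f]
  exact (isIso_iff_bijective _).1 h2

end CDGAlg

/-! ### Normal form of differential operators and the weight filtration. -/

namespace DGAlg

variable {A B M N P Q R : DGAlg.{u}}

lemma parity_mul (a b : A) : A.parity (a * b) = A.parity a * A.parity b := by
  have := A.twist_mul 1 a b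
  simpa [twist] using this

lemma parity_map (f : A ⟶ B) (a : A) : alg f (A.parity a) = B.parity (alg f a) := by
  refine LinearMap.congr_fun (f := (alg f).toLinearMap ∘ₗ A.parity)
    (g := B.parity ∘ₗ (alg f).toLinearMap) (linearMap_ext fun n a ha => ?_) a
  simp only [LinearMap.comp_apply, AlgHom.toLinearMap_apply]
  rw [parity_of_mem ha, parity_of_mem (isGraded_alg f _ _ ha), map_smul]

lemma parity_parity (a : A) : A.parity (A.parity a) = a :=
  LinearMap.congr_fun (parity_comp_parity (P := A)) a

lemma parity_d (a : A) : A.parity (A.d a) = -A.d (A.parity a) := by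
  refine LinearMap.congr_fun (f := A.parity ∘ₗ A.d) (g := -(A.d ∘ₗ A.parity))
    (linearMap_ext fun n a ha => ?_) a
  simp only [LinearMap.comp_apply, LinearMap.neg_apply]
  rw [parity_of_mem ha, parity_of_mem (A.d_mem ha), map_smul, neg_one_zpow_add]
  simp

lemma d_mul (a b : A) : A.d (a * b) = A.d a * b + A.parity a * A.d b := by
  have := (isDer_d (A := A)).mul a b
  simpa [twist] using this

/-- Any derivation out of a free algebra is a combination of the partial derivatives. -/
lemma IsPartials.isDer_eq {n : ℕ} {deg : Fin n → ℤ} {x : Fin n → P} {D : Fin n → Module.End ℂ P}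
    (hD : IsPartials deg x D) (hx : IsFree P deg x) (hB : IsComm B) {g : P →ₐ[ℂ] B}
    (hg : IsGraded g) {m : ℤ} {δ : P →ₗ[ℂ] B} (hδ : IsDer g m δ) :
    δ = ∑ i, LinearMap.mulLeft ℂ (δ (x i)) ∘ₗ g.toLinearMap ∘ₗ D i := by
  classical
  refine hx.isDer_ext hδ (isDer_sum _ _ fun i _ => ?_) fun j => ?_
  · have := (((hD.isDer i).comp_left hg).mulLeft hB hg (hδ.mem _ _ (hD.mem i)))
    rwa [show deg i + m + -deg i = m by ring] at this
  · rw [LinearMap.sum_apply, Finset.sum_eq_single j]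
    · simp [hD.apply_self]
    · intro i _ hij
      simp [hD.apply_ne i j hij]
    · simp

lemma IsPartials.swap {n : ℕ} {deg : Fin n → ℤ} {x : Fin n → P} {D : Fin n → Module.End ℂ P}
    (hD : IsPartials deg x D) (hx : IsFree P deg x) (i j : Fin n) :
    D i * D j = (-1 : ℂ) ^ (deg i * deg j) • (D j * D i) := by
  have h := (hD.isDer i).commutator (hD.isDer j)
  rw [neg_mul_neg] at h
  refine sub_eq_zero.1 (hx.isDer_ext h (isDer_zero _) fun k => ?_)
  have h1 : ∀ i j k, D i (D j (x k)) = 0 := fun i j k => by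
    by_cases hjk : j = k
    · rw [hjk, hD.apply_self, (hD.isDer i).apply_one]
    · rw [hD.apply_ne j k hjk, map_zero]
  simp [h1]

section Weight

variable {n : ℕ}

/-- The weight of a multi-exponent. -/
def weight (ω : Fin n → ℕ) (a : Fin n → ℕ) : ℕ := ∑ i, a i * ω i

lemma weight_add_single (ω a : Fin n → ℕ) (i : Fin n) :
    weight ω (a + Pi.single i 1) = weight ω a + ω i := by
  simp [weight, add_mul, Finset.sum_add_distrib, Pi.single_apply]

/-- The operators of weight less than `k`. -/
def weightLT (deg : Fin n → ℤ) (D : Fin n → Module.End ℂ P) (ω : Fin n → ℕ) (k : ℕ) :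
    Submodule ℂ (Module.End ℂ P) :=
  Submodule.span ℂ {T | ∃ (p : P) (a : Fin n → ℕ), ValidExponent deg a ∧ weight ω a < k ∧
    T = LinearMap.mulLeft ℂ p * orderedMonomial D a}

variable {deg : Fin n → ℤ} {x : Fin n → P} {D : Fin n → Module.End ℂ P} {ω : Fin n → ℕ}

lemma weightLT_mono {k l : ℕ} (h : k ≤ l) : weightLT deg D ω k ≤ weightLT deg D ω l :=
  Submodule.span_mono fun _ ⟨p, a, h1, h2, h3⟩ => ⟨p, a, h1, h2.trans_le h, h3⟩

lemma mul_mem_of_span {S : Set (Module.End ℂ P)} {M : Submodule ℂ (Module.End ℂ P)}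
    {X T : Module.End ℂ P} (h : ∀ T ∈ S, X * T ∈ M) (hT : T ∈ Submodule.span ℂ S) : X * T ∈ M :=
  Submodule.span_le (p := M.comap (LinearMap.mulLeft ℂ X)).2 h hT

lemma mulLeft_mul_mem_weightLT (q : P) {k : ℕ} {T : Module.End ℂ P} (hT : T ∈ weightLT deg D ω k) :
    LinearMap.mulLeft ℂ q * T ∈ weightLT deg D ω k := by
  refine mul_mem_of_span ?_ hT
  rintro _ ⟨p, a, h1, h2, rfl⟩
  refine Submodule.subset_span ⟨q * p, a, h1, h2, ?_⟩
  rw [← mul_assoc]; congr 1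
  ext; simp

lemma IsPartials.mul_mem_weightLT (hD : IsPartials deg x D) (hx : IsFree P deg x) (i : Fin n)
    {k : ℕ} {T : Module.End ℂ P} (hT : T ∈ weightLT deg D ω k) :
    D i * T ∈ weightLT deg D ω (k + ω i) := by
  refine mul_mem_of_span ?_ hT
  rintro _ ⟨p, a, h1, h2, rfl⟩
  have e : D i * (LinearMap.mulLeft ℂ p * orderedMonomial D a) =
      LinearMap.mulLeft ℂ (D i p) * orderedMonomial D a +
      LinearMap.mulLeft ℂ (P.twist (-deg i) p) * (D i * orderedMonomial D a) := by
    ext z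
    simp [(hD.isDer i).mul]
  rw [e]
  refine add_mem (Submodule.subset_span ⟨_, a, h1, by omega, rfl⟩) ?_
  rcases mul_orderedMonomial (hD.swap hx) i h1 with h | ⟨h3, c, hc⟩
  · rw [h, mul_zero]; exact zero_mem _
  · rw [hc, mul_smul_comm]
    refine Submodule.smul_mem _ _ (Submodule.subset_span ⟨_, _, h3, ?_, rfl⟩)
    rw [weight_add_single]; omega

/-- Operators that raise weights by at most `v`, with bracket with `d` of smaller weight. -/
structure HasWeight (deg : Fin n → ℤ) (D : Fin n → Module.End ℂ P) (ω : Fin n → ℕ) (v : ℕ)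
    (X : Module.End ℂ P) : Prop where
  conj : ∃ c : ℂ, P.parity * X * P.parity = c • X
  mul : ∀ k, ∀ T ∈ weightLT deg D ω k, X * T ∈ weightLT deg D ω (k + v)
  dEnd_mul : ∀ k, ∀ T ∈ weightLT deg D ω (k + 1), P.dEnd X * T ∈ weightLT deg D ω (k + v)

lemma hasWeight_one : HasWeight deg D ω 0 1 where
  conj := ⟨1, by rw [mul_one, one_smul, parity_comp_parity]⟩
  mul k T hT := by rwa [one_mul]
  dEnd_mul k T _ := by
    rw [dEnd_of_mem opDeg_one]; simp

/-- In the Leibniz rule for [d, XY] exactly one factor is replaced by its bracket, so the gain of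
one in weight survives. -/
lemma HasWeight.mul' {v w : ℕ} {X Y : Module.End ℂ P} (hX : HasWeight deg D ω v X)
    (hY : HasWeight deg D ω w Y) : HasWeight deg D ω (w + v) (X * Y) := by
  obtain ⟨c, hc⟩ := hX.conj
  obtain ⟨c', hc'⟩ := hY.conj
  refine ⟨⟨c * c', ?_⟩, fun k T hT => ?_, fun k T hT => ?_⟩
  · calc P.parity * (X * Y) * P.parity
        = P.parity * X * (P.parity * P.parity) * Y * P.parity := by
          rw [parity_comp_parity]; noncomm_ring
      _ = (P.parity * X * P.parity) * (P.parity * Y * P.parity) := by noncomm_ring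
      _ = _ := by rw [hc, hc', smul_mul_smul_comm]
  · rw [mul_assoc, ← add_assoc]
    exact hX.mul _ _ (hY.mul _ _ hT)
  · rw [DGAlg.dEnd_mul, hc, add_mul, mul_assoc, mul_assoc, smul_mul_assoc]
    refine add_mem ?_ (Submodule.smul_mem _ _ ?_)
    · rw [← add_assoc]
      refine hX.dEnd_mul _ _ ?_
      rw [show k + w + 1 = k + 1 + w by ring]
      exact hY.mul _ _ hT
    · rw [← add_assoc]
      exact hX.mul _ _ (hY.dEnd_mul _ _ hT)

lemma HasWeight.pow {v : ℕ} {X : Module.End ℂ P} (hX : HasWeight deg D ω v X) (m : ℕ) :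
    HasWeight deg D ω (m * v) (X ^ m) := by
  induction m with
  | zero => simpa using hasWeight_one
  | succ m ih => rw [pow_succ', add_mul, one_mul]; exact hX.mul' ih

lemma HasWeight.orderedMonomial {m : ℕ} {v : Fin m → ℕ} {X : Fin m → Module.End ℂ P}
    (hX : ∀ i, HasWeight deg D ω (v i) (X i)) (a : Fin m → ℕ) :
    HasWeight deg D ω (weight v a) (orderedMonomial X a) := by
  induction m with
  | zero => simpa [_root_.orderedMonomial, weight] using hasWeight_one
  | succ m ih =>
    rw [orderedMonomial_succ, weight, Fin.sum_univ_succ, add_comm]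
    exact ((hX 0).pow _).mul' (ih (fun i => hX i.succ) fun i => a i.succ)

/-- [d, ∂_i] is a derivation whose coefficient at ∂_j has degree deg x_j - deg x_i + 1. Unless deg
x_j < deg x_i this is positive and the coefficient vanishes, so only ∂_j of strictly smaller weight
occur. -/
lemma IsPartials.hasWeight (hD : IsPartials deg x D) (hx : IsFree P deg x) (hc : IsComm P)
    (hn : IsNonpos P) (hω : ∀ i k, deg k < deg i → ω k < ω i) (i : Fin n) :
    HasWeight deg D ω (ω i) (D i) where
  conj := ⟨_, parity_conj_of_mem (hD.isDer i).mem⟩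
  mul k T hT := hD.mul_mem_weightLT hx i hT
  dEnd_mul k T hT := by
    have h := isDerivation_iff.1 (dEnd_isDerivation (isDerivation_iff.2 (hD.isDer i)))
    rw [hD.isDer_eq hx hc isGraded_id h, Finset.sum_mul]
    refine sum_mem fun j _ => ?_
    by_cases hj : deg j < deg i
    · have := mulLeft_mul_mem_weightLT (P.dEnd (D i) (x j))
        (hD.mul_mem_weightLT hx j hT (ω := ω))
      refine weightLT_mono ?_ this
      have := hω i j hj
      omega
    · have h0 : P.dEnd (D i) (x j) = 0 :=
        hn.eq_zero (n := deg j + (-deg i + 1)) (by omega) (h.mem _ _ (hD.mem j))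
      rw [h0]
      simp

lemma IsPartials.orderedMonomial_hasWeight (hD : IsPartials deg x D) (hx : IsFree P deg x)
    (hc : IsComm P) (hn : IsNonpos P) (hω : ∀ i k, deg k < deg i → ω k < ω i) (a : Fin n → ℕ) :
    P.dEnd (orderedMonomial D a) ∈ weightLT deg D ω (weight ω a) := by
  -- Applied to the identity operator, of weight 0 and so less than 1, the estimate says that the
  -- bracket of d with ∂^a has weight strictly below that of ∂^a.
  have h := (HasWeight.orderedMonomial (hD.hasWeight hx hc hn hω) a).dEnd_mul 0 1
    (Submodule.subset_span ⟨1, 0, validExponent_zero, by simp [weight], by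
      rw [orderedMonomial_zero]; simp; rfl⟩)
  rwa [mul_one, zero_add] at h

/-- Every differential operator is a combination of the `p ∂^a`. -/
lemma IsPartials.mem_span (hD : IsPartials deg x D) (hx : IsFree P deg x) (hc : IsComm P)
    {X : Module.End ℂ P} (hX : X ∈ P.diffOps) :
    X ∈ Submodule.span ℂ {T | ∃ (p : P) (a : Fin n → ℕ), ValidExponent deg a ∧
      T = LinearMap.mulLeft ℂ p * orderedMonomial D a} := by
  set S := Submodule.span ℂ {T | ∃ (p : P) (a : Fin n → ℕ), ValidExponent deg a ∧
      T = LinearMap.mulLeft ℂ p * orderedMonomial D a} with hS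
  have h1 : (1 : Module.End ℂ P) ∈ S := Submodule.subset_span ⟨1, 0, validExponent_zero, by
    rw [orderedMonomial_zero]; simp; rfl⟩
  -- With all variables of weight zero the filtration step is the full span, so the closure lemmas
  -- for weights apply.
  have hsup : S = weightLT deg D 0 1 := by
    refine le_antisymm (Submodule.span_mono ?_) (Submodule.span_mono ?_)
    · rintro _ ⟨p, a, h1, rfl⟩
      exact ⟨p, a, h1, by simp [weight], rfl⟩
    · rintro _ ⟨p, a, h1, _, rfl⟩
      exact ⟨p, a, h1, rfl⟩
  have key : ∀ T ∈ S, X * T ∈ S := by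
    induction hX using Algebra.adjoin_induction with
    | mem X hX =>
      intro T hT
      rw [hsup] at hT ⊢
      rcases hX with ⟨q, rfl⟩ | ⟨m, hX⟩
      · exact mulLeft_mul_mem_weightLT q hT
      · rw [hD.isDer_eq hx hc isGraded_id (isDerivation_iff.1 hX), Finset.sum_mul]
        exact sum_mem fun j _ => mulLeft_mul_mem_weightLT (X (x j)) (hD.mul_mem_weightLT hx j hT)
    | algebraMap c =>
      intro T hT
      rw [Algebra.algebraMap_eq_smul_one, smul_mul_assoc, one_mul]
      exact S.smul_mem _ hT
    | add X Y _ _ hX hY => intro T hT; rw [add_mul]; exact add_mem (hX T hT) (hY T hT)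
    | mul X Y _ _ hX hY => intro T hT; rw [mul_assoc]; exact hX _ (hY T hT)
  simpa using key 1 h1

end Weight

end DGAlg

/-! ### Differential operators along a morphism. -/

namespace DGAlg

variable {A B M N P Q R : DGAlg.{u}}

/-- The differential `T ↦ d T - (-1)^{deg T} T d` on linear maps. -/
noncomputable def homD (P M : DGAlg.{u}) : (P →ₗ[ℂ] M) →ₗ[ℂ] (P →ₗ[ℂ] M) where
  toFun T := M.d ∘ₗ T - M.parity ∘ₗ T ∘ₗ P.parity ∘ₗ P.d
  map_add' S T := by ext p; simp; abel
  map_smul' c T := by ext p; simp [smul_sub]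

lemma homD_apply (T : P →ₗ[ℂ] M) (p : P) :
    homD P M T p = M.d (T p) - M.parity (T (P.parity (P.d p))) := rfl

lemma dEnd_eq_homD (T : Module.End ℂ P) : P.dEnd T = homD P P T := by
  rw [dEnd_apply]; rfl

/-- `(-1)^{deg T} T`. -/
noncomputable def homParity (P M : DGAlg.{u}) : (P →ₗ[ℂ] M) →ₗ[ℂ] (P →ₗ[ℂ] M) where
  toFun T := M.parity ∘ₗ T ∘ₗ P.parity
  map_add' S T := by ext p; simp
  map_smul' c T := by ext p; simp

lemma homParity_apply (T : P →ₗ[ℂ] M) (p : P) :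
    homParity P M T p = M.parity (T (P.parity p)) := rfl

lemma homParity_homParity (T : P →ₗ[ℂ] M) : homParity P M (homParity P M T) = T := by
  ext p; simp [homParity_apply, parity_parity]

lemma homD_homD (T : P →ₗ[ℂ] M) : homD P M (homD P M T) = 0 := by
  ext p
  simp [homD_apply, M.d_d, parity_d, P.d_d]

lemma homD_homParity (T : P →ₗ[ℂ] M) : homD P M (homParity P M T) = -homParity P M (homD P M T) := by
  ext p
  simp [homD_apply, homParity_apply, parity_d, parity_parity]
  abel

lemma homD_comp (S : Q →ₗ[ℂ] M) (T : P →ₗ[ℂ] Q) :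
    homD P M (S ∘ₗ T) = homD Q M S ∘ₗ T + homParity Q M S ∘ₗ homD P Q T := by
  ext p
  simp [homD_apply, homParity_apply, parity_parity, parity_d]

lemma homParity_comp (S : Q →ₗ[ℂ] M) (T : P →ₗ[ℂ] Q) :
    homParity P M (S ∘ₗ T) = homParity Q M S ∘ₗ homParity P Q T := by
  ext p
  simp [homParity_apply, parity_parity]

lemma homD_alg (f : P ⟶ Q) : homD P Q (alg f).toLinearMap = 0 := by
  ext p
  simp [homD_apply, parity_parity, ← parity_map, alg_d]

lemma homParity_alg (f : P ⟶ Q) : homParity P Q (alg f).toLinearMap = (alg f).toLinearMap := by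
  ext p
  simp [homParity_apply, parity_parity, ← parity_map]

lemma homD_mulLeft (m : M) : homD M M (LinearMap.mulLeft ℂ m) = LinearMap.mulLeft ℂ (M.d m) := by
  ext p
  simp [homD_apply, d_mul, parity_mul, parity_parity]

lemma homParity_mulLeft (m : M) :
    homParity M M (LinearMap.mulLeft ℂ m) = LinearMap.mulLeft ℂ (M.parity m) := by
  ext p
  simp [homParity_apply, parity_mul, parity_parity]

/-- Differential operators along a morphism `h : P ⟶ M`. -/
def Diff (h : P ⟶ M) : Submodule ℂ (P →ₗ[ℂ] M) :=
  Submodule.span ℂ {T | ∃ (m : M) (D : Module.End ℂ P), D ∈ P.diffOps ∧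
    T = LinearMap.mulLeft ℂ m ∘ₗ (alg h).toLinearMap ∘ₗ D}

variable {h : P ⟶ M}

lemma mem_diff (m : M) {D : Module.End ℂ P} (hD : D ∈ P.diffOps) :
    LinearMap.mulLeft ℂ m ∘ₗ (alg h).toLinearMap ∘ₗ D ∈ Diff h :=
  Submodule.subset_span ⟨m, D, hD, rfl⟩

lemma alg_comp_mem_diff {D : Module.End ℂ P} (hD : D ∈ P.diffOps) :
    (alg h).toLinearMap ∘ₗ D ∈ Diff h := by
  have := mem_diff (h := h) 1 hD
  rwa [LinearMap.mulLeft_one, LinearMap.id_comp] at this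

lemma diff_le_of {S : Submodule ℂ (P →ₗ[ℂ] M)} (hS : ∀ (m : M), ∀ D ∈ P.diffOps,
    LinearMap.mulLeft ℂ m ∘ₗ (alg h).toLinearMap ∘ₗ D ∈ S) {T : P →ₗ[ℂ] M} (hT : T ∈ Diff h) :
    T ∈ S := by
  refine Submodule.span_le.2 ?_ hT
  rintro _ ⟨m, D, hD, rfl⟩
  exact hS m D hD

lemma mulLeft_comp_mem_diff (m : M) {T : P →ₗ[ℂ] M} (hT : T ∈ Diff h) :
    LinearMap.mulLeft ℂ m ∘ₗ T ∈ Diff h := by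
  refine diff_le_of (S := (Diff h).comap (LinearMap.compRight ℂ (LinearMap.mulLeft ℂ m)))
    (fun m' D hD => ?_) hT
  have := mem_diff (h := h) (m * m') hD
  rwa [LinearMap.mulLeft_mul] at this

lemma comp_mem_diff {T : P →ₗ[ℂ] M} (hT : T ∈ Diff h) {D : Module.End ℂ P} (hD : D ∈ P.diffOps) :
    T ∘ₗ D ∈ Diff h := by
  refine diff_le_of (S := (Diff h).comap (LinearMap.lcomp ℂ M D)) (fun m E hE => ?_) hT
  exact mem_diff m (mul_mem hE hD)

lemma post_mem_diff (w : M ⟶ N) {k : P ⟶ N} (e : h ≫ w = k) {T : P →ₗ[ℂ] M} (hT : T ∈ Diff h) :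
    (alg w).toLinearMap ∘ₗ T ∈ Diff k := by
  subst e
  refine diff_le_of (S := (Diff (h ≫ w)).comap (LinearMap.compRight ℂ (alg w).toLinearMap))
    (fun m E hE => ?_) hT
  have := mem_diff (h := h ≫ w) (alg w m) hE
  rwa [show LinearMap.mulLeft ℂ (alg w m) ∘ₗ (alg (h ≫ w)).toLinearMap ∘ₗ E = (alg w).toLinearMap ∘ₗ
    LinearMap.mulLeft ℂ m ∘ₗ (alg h).toLinearMap ∘ₗ E by ext p; simp] at this

lemma homD_mem_diff {T : P →ₗ[ℂ] M} (hT : T ∈ Diff h) : homD P M T ∈ Diff h := by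
  refine diff_le_of (S := (Diff h).comap (homD P M)) (fun m E hE => ?_) hT
  rw [Submodule.mem_comap, homD_comp, homD_mulLeft, homParity_mulLeft, homD_comp, homD_alg,
    homParity_alg, LinearMap.zero_comp, zero_add, ← dEnd_eq_homD]
  exact add_mem (mem_diff _ hE) (mem_diff _ (dEnd_mem hE))

lemma homParity_mem_diff {T : P →ₗ[ℂ] M} (hT : T ∈ Diff h) : homParity P M T ∈ Diff h := by
  refine diff_le_of (S := (Diff h).comap (homParity P M)) (fun m E hE => ?_) hT
  rw [Submodule.mem_comap, homParity_comp, homParity_mulLeft, homParity_comp, homParity_alg]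
  exact mem_diff _ (parity_conj_mem hE)

lemma mem_diff_id {T : Module.End ℂ P} : T ∈ Diff (𝟙 P) ↔ T ∈ P.diffOps := by
  constructor
  · refine diff_le_of (h := 𝟙 P) (S := Subalgebra.toSubmodule P.diffOps) (fun m E hE => ?_)
    exact P.diffOps.mul_mem (mulLeft_mem_diffOps m) hE
  · exact fun hT => alg_comp_mem_diff (h := 𝟙 P) hT

/-- The space `Diff h` as a type. -/
def DiffAlong (h : P ⟶ M) : Type u := Diff h

instance : AddCommGroup (DiffAlong h) := inferInstanceAs (AddCommGroup (Diff h))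
instance : Module ℂ (DiffAlong h) := inferInstanceAs (Module ℂ (Diff h))

/-- The differential on `DiffAlong h`. -/
noncomputable def diffD (h : P ⟶ M) : DiffAlong h →ₗ[ℂ] DiffAlong h :=
  (homD P M).restrict (p := Diff h) (q := Diff h) fun _ hT => homD_mem_diff hT

lemma diffD_diffD (T : DiffAlong h) : diffD h (diffD h T) = 0 := Subtype.ext (homD_homD T.1)

/-- Postcomposition. -/
def post (w : M ⟶ N) {k : P ⟶ N} (e : h ≫ w = k) : DiffAlong h →ₗ[ℂ] DiffAlong k :=
  (LinearMap.compRight ℂ (alg w).toLinearMap).restrict (p := Diff h) (q := Diff k) fun _ hT => post_mem_diff w e hT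

lemma homD_post (w : M ⟶ N) (T : P →ₗ[ℂ] M) :
    homD P N ((alg w).toLinearMap ∘ₗ T) = (alg w).toLinearMap ∘ₗ homD P M T := by
  rw [homD_comp, homD_alg, homParity_alg, LinearMap.zero_comp, zero_add]

lemma homD_pre (f : P ⟶ Q) (T : Q →ₗ[ℂ] M) :
    homD P M (T ∘ₗ (alg f).toLinearMap) = homD Q M T ∘ₗ (alg f).toLinearMap := by
  rw [homD_comp, homD_alg, LinearMap.comp_zero, add_zero]

lemma post_diffD (w : M ⟶ N) {k : P ⟶ N} (e : h ≫ w = k) (T : DiffAlong h) :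
    post w e (diffD h T) = diffD k (post w e T) :=
  Subtype.ext (homD_post w T.1).symm

lemma IsPoly.exists_fin (hP : IsPoly P) : ∃ (n : ℕ) (deg : Fin n → ℤ) (x : Fin n → P),
    (∀ i, deg i ≤ 0) ∧ IsFree P deg x := by
  obtain ⟨-, ι, _, deg, x, hdeg, hx⟩ := hP
  obtain ⟨n, ⟨e⟩⟩ := Finite.exists_equiv_fin ι
  exact ⟨n, _, _, fun i => hdeg _, hx.reindex e.symm⟩

/-- The chain rule. -/
lemma diffOps_comp_mem_diff (hP : IsPoly P) (hM : IsComm M) {D : Module.End ℂ M}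
    (hD : D ∈ M.diffOps) {T : P →ₗ[ℂ] M} (hT : T ∈ Diff h) : D ∘ₗ T ∈ Diff h := by
  obtain ⟨n, deg, x, hdeg, hx⟩ := hP.exists_fin
  obtain ⟨δ, hδ⟩ := hx.exists_partials hP.1
  induction hD using Algebra.adjoin_induction generalizing T with
  | mem D hD =>
    rcases hD with ⟨m, rfl⟩ | ⟨l, hD⟩
    · exact mulLeft_comp_mem_diff m hT
    · rw [isDerivation_iff] at hD
      refine diff_le_of (S := (Diff h).comap (LinearMap.compRight ℂ D)) (fun m E hE => ?_) hT
      have hDh := hD.comp_right (isGraded_alg h)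
      -- Restricted along h, a derivation of M is a derivation from P to M, hence a combination of
      -- the h ∂_i with coefficients D(h x_i).
      have e := hδ.isDer_eq hx hM (isGraded_alg h) hDh
      have e1 : D ∘ₗ (LinearMap.mulLeft ℂ m ∘ₗ (alg h).toLinearMap ∘ₗ E) =
          LinearMap.mulLeft ℂ (D m) ∘ₗ (alg h).toLinearMap ∘ₗ E +
          LinearMap.mulLeft ℂ (M.twist l m) ∘ₗ (D ∘ₗ (alg h).toLinearMap) ∘ₗ E := by
        ext p; simp [hD.mul]
      change D ∘ₗ (LinearMap.mulLeft ℂ m ∘ₗ (alg h).toLinearMap ∘ₗ E) ∈ Diff h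
      rw [e1, e]
      refine add_mem (mem_diff _ hE) (mulLeft_comp_mem_diff _ ?_)
      rw [show ∀ F : Fin n → P →ₗ[ℂ] M, (∑ i, F i) ∘ₗ E = ∑ i, F i ∘ₗ E from fun F => by
        ext p; simp]
      refine Submodule.sum_mem (Diff h) fun i _ => ?_
      exact mem_diff _ (P.diffOps.mul_mem (isDerivation_mem_diffOps (isDerivation_iff.2 (hδ.isDer i))) hE)
  | algebraMap c =>
    rw [Algebra.algebraMap_eq_smul_one, LinearMap.smul_comp]
    exact Submodule.smul_mem _ _ hT
  | add X Y _ _ hX hY => rw [LinearMap.add_comp]; exact (Diff h).add_mem (hX hT) (hY hT)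
  | mul X Y _ _ hX hY => exact hX (hY hT)

/-- The map f is itself an operator along f; by the chain rule E ∘ f is one too, and applying h and
multiplying stay within operators along k. -/
lemma pre_mem_diff (hP : IsPoly P) (hQ : IsComm Q) (f : P ⟶ Q) {h : Q ⟶ M} {k : P ⟶ M}
    (e : f ≫ h = k) {T : Q →ₗ[ℂ] M} (hT : T ∈ Diff h) : T ∘ₗ (alg f).toLinearMap ∈ Diff k := by
  refine diff_le_of (S := (Diff k).comap (LinearMap.lcomp ℂ M (alg f).toLinearMap))
    (fun m E hE => ?_) hT
  have h1 : (alg f).toLinearMap ∈ Diff f := alg_comp_mem_diff (h := f) (one_mem _)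
  exact mulLeft_comp_mem_diff m (post_mem_diff h e (diffOps_comp_mem_diff hP hQ hE h1))

/-- Precomposition. -/
def pre (hP : IsPoly P) (hQ : IsComm Q) (f : P ⟶ Q) {h : Q ⟶ M} {k : P ⟶ M}
    (e : f ≫ h = k) : DiffAlong h →ₗ[ℂ] DiffAlong k :=
  (LinearMap.lcomp ℂ M (alg f).toLinearMap).restrict (p := Diff h) (q := Diff k) fun _ hT => pre_mem_diff hP hQ f e hT

lemma pre_diffD (hP : IsPoly P) (hQ : IsComm Q) (f : P ⟶ Q) {h : Q ⟶ M} {k : P ⟶ M}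
    (e : f ≫ h = k) (T : DiffAlong h) : pre hP hQ f e (diffD h T) = diffD k (pre hP hQ f e T) :=
  Subtype.ext (homD_pre f T.1).symm

/-! ### Coefficients of operators, and postcomposition with quasi-isomorphisms. -/

section Basis

variable {n : ℕ} {deg : Fin n → ℤ} {x : Fin n → P} {D : Fin n → Module.End ℂ P} {ω : Fin n → ℕ}

/-- The operators `∑ mₐ h ∂^a`. -/
noncomputable def diffOf (deg : Fin n → ℤ) (D : Fin n → Module.End ℂ P) (h : P ⟶ M) :
    ({a : Fin n → ℕ // ValidExponent deg a} →₀ M) →ₗ[ℂ] (P →ₗ[ℂ] M) :=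
  Finsupp.lsum ℂ fun a =>
    (LinearMap.lcomp ℂ M ((alg h).toLinearMap ∘ₗ orderedMonomial D a.1)) ∘ₗ LinearMap.mul ℂ M

lemma diffOf_single (a : {a : Fin n → ℕ // ValidExponent deg a}) (m : M) :
    diffOf deg D h (Finsupp.single a m) =
      LinearMap.mulLeft ℂ m ∘ₗ (alg h).toLinearMap ∘ₗ orderedMonomial D a.1 := by
  simp [diffOf]; rfl

lemma IsPartials.orderedMonomial_mem (hD : IsPartials deg x D) (a : Fin n → ℕ) :
    orderedMonomial D a ∈ P.diffOps := by
  refine list_prod_mem fun y hy => ?_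
  rw [List.mem_ofFn] at hy
  obtain ⟨i, rfl⟩ := hy
  exact pow_mem (isDerivation_mem_diffOps (isDerivation_iff.2 (hD.isDer i))) _

lemma diffOf_mem (hD : IsPartials deg x D) (l : {a : Fin n → ℕ // ValidExponent deg a} →₀ M) :
    diffOf deg D h l ∈ Diff h := by
  induction l using Finsupp.induction_linear with
  | zero => rw [map_zero]; exact zero_mem _
  | add l l' h1 h2 => rw [map_add]; exact add_mem h1 h2
  | single a m => rw [diffOf_single]; exact mem_diff _ (hD.orderedMonomial_mem _)

/-- The families supported in weights less than `k`. -/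
def supportedLT (deg : Fin n → ℤ) (ω : Fin n → ℕ) (M : DGAlg.{u}) (k : ℕ) :
    Submodule ℂ ({a : Fin n → ℕ // ValidExponent deg a} →₀ M) :=
  Finsupp.supported M ℂ {a | weight ω a.1 < k}

lemma mem_supportedLT {k : ℕ} {l : {a : Fin n → ℕ // ValidExponent deg a} →₀ M} :
    l ∈ supportedLT deg ω M k ↔ ∀ a, k ≤ weight ω a.1 → l a = 0 := by
  rw [supportedLT, Finsupp.mem_supported']
  simp

lemma comp_mem_map_diffOf (m : M) {k : ℕ} {T : Module.End ℂ P} (hT : T ∈ weightLT deg D ω k) :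
    LinearMap.mulLeft ℂ m ∘ₗ (alg h).toLinearMap ∘ₗ T ∈
      (supportedLT deg ω M k).map (diffOf deg D h) := by
  let F : Module.End ℂ P →ₗ[ℂ] (P →ₗ[ℂ] M) :=
    LinearMap.compRight ℂ (LinearMap.mulLeft ℂ m ∘ₗ (alg h).toLinearMap)
  refine Submodule.span_le (p := ((supportedLT deg ω M k).map (diffOf deg D h)).comap F).2 ?_ hT
  rintro _ ⟨p, a, h1, h2, rfl⟩
  refine ⟨Finsupp.single ⟨a, h1⟩ (m * alg h p), ?_, ?_⟩
  · exact Finsupp.single_mem_supported _ _ h2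
  · rw [diffOf_single]
    ext z
    simp [F]

lemma IsPartials.exists_diffOf (hD : IsPartials deg x D) (hx : IsFree P deg x) (hc : IsComm P)
    {T : P →ₗ[ℂ] M} (hT : T ∈ Diff h) : ∃ l, diffOf deg D h l = T := by
  refine diff_le_of (S := LinearMap.range (diffOf deg D h)) (fun m X hX => ?_) hT
  have h1 : X ∈ weightLT deg D 0 1 := by
    refine Submodule.span_mono ?_ (hD.mem_span hx hc hX)
    rintro _ ⟨p, a, h1, rfl⟩
    exact ⟨p, a, h1, by simp [weight], rfl⟩
  obtain ⟨l, -, hl⟩ := comp_mem_map_diffOf (h := h) m h1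
  exact ⟨l, hl⟩

/-- Evaluate at x^a for an exponent a minimal in the support: the other ∂^b occurring kill x^a, and
what remains is a nonzero multiple of the coefficient at a. -/
lemma IsPartials.diffOf_injective (hD : IsPartials deg x D) :
    Function.Injective (diffOf deg D h) := by
  rw [injective_iff_map_eq_zero]
  intro l hl
  by_contra hne
  obtain ⟨a, ha⟩ := l.support.exists_minimal (Finsupp.support_nonempty_iff.2 hne)
  have h1 := LinearMap.congr_fun hl (orderedMonomial x a.1)
  rw [diffOf, Finsupp.lsum_apply, Finsupp.sum, LinearMap.sum_apply,
    Finset.sum_eq_single_of_mem a ha.1] at h1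
  · obtain ⟨c, hc, hc'⟩ := (hD.apply_monomial a.1 a.2).2 rfl
    simp only [LinearMap.comp_apply, LinearMap.lcomp_apply, LinearMap.mul_apply', hc',
      AlgHom.toLinearMap_apply, map_smul, map_one, mul_one, LinearMap.zero_apply] at h1
    exact Finsupp.mem_support_iff.1 ha.1 ((smul_eq_zero.1 h1).resolve_left hc)
  · intro b hb hba
    have : ¬ b.1 ≤ a.1 := fun hle => hba (le_antisymm hle (ha.2 hb hle))
    simp [(hD.apply_monomial b.1 a.2).1 this]

/-- Modulo lower weight, the differential acts on coefficients only: the remaining term contains the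
bracket of d with ∂^a, of smaller weight. -/
lemma IsPartials.homD_diffOf (hD : IsPartials deg x D) (hx : IsFree P deg x) (hc : IsComm P)
    (hn : IsNonpos P) (hω : ∀ i k, deg k < deg i → ω k < ω i) {k : ℕ} {l : {a : Fin n → ℕ // ValidExponent deg a} →₀ M}
    (hl : l ∈ supportedLT deg ω M (k + 1)) : ∃ l' ∈ supportedLT deg ω M k,
      homD P M (diffOf deg D h l) = diffOf deg D h (Finsupp.mapRange.linearMap M.d l + l') := by
  classical
  -- Truncating makes the statement meaningful for every family, so that additive induction is
  -- available without tracking supports.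
  have key : ∀ l : {a : Fin n → ℕ // ValidExponent deg a} →₀ M, ∃ l' ∈ supportedLT deg ω M k,
      homD P M (diffOf deg D h (l.filter fun a => weight ω a.1 < k + 1)) =
        diffOf deg D h (Finsupp.mapRange.linearMap M.d
          (l.filter fun a => weight ω a.1 < k + 1) + l') := by
    intro l
    induction l using Finsupp.induction_linear with
    | zero => exact ⟨0, zero_mem _, by rw [Finsupp.filter_zero]; simp⟩
    | add l₁ l₂ h1 h2 =>
      obtain ⟨l₁', h3, h4⟩ := h1
      obtain ⟨l₂', h5, h6⟩ := h2
      refine ⟨l₁' + l₂', add_mem h3 h5, ?_⟩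
      rw [Finsupp.filter_add, map_add, map_add, h4, h6, ← map_add, map_add _ (Finsupp.filter _ _)]
      congr 1
      abel
    | single a m =>
      by_cases ha : weight ω a.1 < k + 1
      · rw [Finsupp.filter_single_of_pos (fun a : {a // ValidExponent deg a} => weight ω a.1 < k + 1) ha]
        obtain ⟨l', hl', e⟩ := comp_mem_map_diffOf (h := h) (M.parity m)
          (weightLT_mono (Nat.lt_succ_iff.1 ha) (hD.orderedMonomial_hasWeight hx hc hn hω a.1))
        refine ⟨l', hl', ?_⟩
        rw [diffOf_single, homD_comp, homD_mulLeft, homParity_mulLeft, homD_comp, homD_alg,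
          homParity_alg, LinearMap.zero_comp, zero_add, ← dEnd_eq_homD, map_add, e]
        simp [diffOf_single]
      · rw [Finsupp.filter_single_of_neg (fun a : {a // ValidExponent deg a} => weight ω a.1 < k + 1) ha]
        exact ⟨0, zero_mem _, by simp⟩
  obtain ⟨l', h1, h2⟩ := key l
  rw [Finsupp.filter_eq_self_iff _ _ |>.2 fun a ha => ?_] at h2
  · exact ⟨l', h1, h2⟩
  · by_contra hlt
    exact ha (mem_supportedLT.1 hl a (not_lt.1 hlt))

lemma diffOf_post (w : M ⟶ N) {k : P ⟶ N} (e : h ≫ w = k)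
    (l : {a : Fin n → ℕ // ValidExponent deg a} →₀ M) :
    (alg w).toLinearMap ∘ₗ diffOf deg D h l =
      diffOf deg D k (Finsupp.mapRange.linearMap (alg w).toLinearMap l) := by
  subst e
  induction l using Finsupp.induction_linear with
  | zero => simp
  | add l l' h1 h2 => simp only [map_add, LinearMap.comp_add, h1, h2]
  | single a m =>
    rw [diffOf_single, Finsupp.mapRange.linearMap_apply, Finsupp.mapRange_single, diffOf_single]
    ext p
    simp

/-- Induction on the weight bound. The coefficients of top weight are cocycles in the cone of w;
solving there coefficient by coefficient and subtracting the boundary of the resulting operators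
leaves a cocycle of smaller weight. -/
lemma IsPartials.exists_primitive_of_quasiIso (hD : IsPartials deg x D) (hx : IsFree P deg x) (hc : IsComm P)
    (hn : IsNonpos P) (hω : ∀ i k, deg k < deg i → ω k < ω i) (w : M ⟶ N) (hw : quasiIso w) {h' : P ⟶ N}
    (e : h ≫ w = h') (k : ℕ) : ∀ (l : {a : Fin n → ℕ // ValidExponent deg a} →₀ M)
    (r : {a : Fin n → ℕ // ValidExponent deg a} →₀ N), l ∈ supportedLT deg ω M k →
    r ∈ supportedLT deg ω N k → homD P M (diffOf deg D h l) = 0 →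
    (alg w).toLinearMap ∘ₗ diffOf deg D h l = homD P N (diffOf deg D h' r) →
    ∃ T ∈ Diff h, ∃ U ∈ Diff h', homD P M T = diffOf deg D h l ∧
      (alg w).toLinearMap ∘ₗ T + homD P N U = diffOf deg D h' r := by
  induction k with
  | zero =>
    intro l r hl hr _ _
    have hl0 : l = 0 := Finsupp.ext fun a => mem_supportedLT.1 hl a (Nat.zero_le _)
    have hr0 : r = 0 := Finsupp.ext fun a => mem_supportedLT.1 hr a (Nat.zero_le _)
    exact ⟨0, zero_mem _, 0, zero_mem _, by simp [hl0], by simp [hr0]⟩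
  | succ k ih =>
    intro l r hl hr h0 h1
    obtain ⟨l', hl', el⟩ := hD.homD_diffOf hx hc hn hω (h := h) hl
    obtain ⟨r', hr', er⟩ := hD.homD_diffOf hx hc hn hω (h := h') hr
    have h2 : ∀ a, weight ω a.1 = k → M.d (l a) = 0 := fun a ha => by
      rw [h0] at el
      have := DFunLike.congr_fun (hD.diffOf_injective (el.symm.trans (map_zero _).symm)) a
      simpa [mem_supportedLT.1 hl' a ha.ge] using this
    have h3 : ∀ a, weight ω a.1 = k → alg w (l a) = N.d (r a) := fun a ha => by
      rw [er, diffOf_post w e] at h1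
      have := DFunLike.congr_fun (hD.diffOf_injective h1) a
      simpa [mem_supportedLT.1 hr' a ha.ge] using this
    -- Solutions are taken to be zero wherever the data vanish, so that they form finitely supported
    -- families.
    have h4 : ∀ a, ∃ (m : M) (v : N), (weight ω a.1 = k → M.d m = l a ∧ alg w m + N.d v = r a) ∧
        (weight ω a.1 ≠ k ∨ (l a = 0 ∧ r a = 0) → m = 0 ∧ v = 0) := fun a => by
      by_cases ha : weight ω a.1 = k
      · by_cases hz : l a = 0 ∧ r a = 0
        · exact ⟨0, 0, fun _ => by simp [hz], fun _ => ⟨rfl, rfl⟩⟩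
        · obtain ⟨m, v, h5, h6⟩ := (quasiIso_iff w).1 hw (l a) (r a) (h2 a ha) (h3 a ha)
          exact ⟨m, v, fun _ => ⟨h5, h6⟩, fun h => absurd h (by tauto)⟩
      · exact ⟨0, 0, fun h => absurd h ha, fun _ => ⟨rfl, rfl⟩⟩
    choose μ ν hμν hz using h4
    classical
    let l₁ : {a : Fin n → ℕ // ValidExponent deg a} →₀ M :=
      Finsupp.onFinset (l.support ∪ r.support) μ fun a ha => by
        by_contra hcon
        simp only [Finset.mem_union, Finsupp.mem_support_iff, not_or, not_not] at hcon
        exact ha (hz a (Or.inr hcon)).1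
    let r₁ : {a : Fin n → ℕ // ValidExponent deg a} →₀ N :=
      Finsupp.onFinset (l.support ∪ r.support) ν fun a ha => by
        by_contra hcon
        simp only [Finset.mem_union, Finsupp.mem_support_iff, not_or, not_not] at hcon
        exact ha (hz a (Or.inr hcon)).2
    have hl₁ : ∀ a, l₁ a = μ a := fun a => rfl
    have hr₁ : ∀ a, r₁ a = ν a := fun a => rfl
    obtain ⟨l₂, hl₂, el₁⟩ := hD.homD_diffOf hx hc hn hω (h := h) (l := l₁) (k := k)
      (mem_supportedLT.2 fun a ha => (hz a (Or.inl (by omega))).1)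
    obtain ⟨r₂, hr₂, er₁⟩ := hD.homD_diffOf hx hc hn hω (h := h') (l := r₁) (k := k)
      (mem_supportedLT.2 fun a ha => (hz a (Or.inl (by omega))).2)
    have e5 : diffOf deg D h (l - (Finsupp.mapRange.linearMap M.d l₁ + l₂)) =
        diffOf deg D h l - homD P M (diffOf deg D h l₁) := by rw [map_sub, el₁]
    have e6 : diffOf deg D h' (r - Finsupp.mapRange.linearMap (alg w).toLinearMap l₁ -
        (Finsupp.mapRange.linearMap N.d r₁ + r₂)) = diffOf deg D h' r -
        (alg w).toLinearMap ∘ₗ diffOf deg D h l₁ - homD P N (diffOf deg D h' r₁) := by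
      rw [map_sub, map_sub, er₁, diffOf_post w e]
    obtain ⟨T, hT, U, hU, e7, e8⟩ := ih (l - (Finsupp.mapRange.linearMap M.d l₁ + l₂))
      (r - Finsupp.mapRange.linearMap (alg w).toLinearMap l₁ -
        (Finsupp.mapRange.linearMap N.d r₁ + r₂))
      (mem_supportedLT.2 fun a ha => by
        have h5 := mem_supportedLT.1 hl₂ a ha
        rcases ha.eq_or_lt with ha' | ha'
        · simp [hl₁, h5, (hμν a ha'.symm).1]
        · simp [hl₁, h5, (hz a (Or.inl ha'.ne')).1, mem_supportedLT.1 hl a ha'])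
      (mem_supportedLT.2 fun a ha => by
        have h5 := mem_supportedLT.1 hr₂ a ha
        rcases ha.eq_or_lt with ha' | ha'
        · simp [hl₁, hr₁, h5, ← (hμν a ha'.symm).2]
        · simp [hl₁, hr₁, h5, (hz a (Or.inl ha'.ne')).1, (hz a (Or.inl ha'.ne')).2,
            mem_supportedLT.1 hr a ha'])
      (by rw [e5, map_sub, h0, homD_homD, sub_zero])
      (by rw [e5, e6, LinearMap.comp_sub, h1, map_sub, map_sub, homD_homD, sub_zero, homD_post])
    refine ⟨T + diffOf deg D h l₁, add_mem hT (diffOf_mem hD _), U + diffOf deg D h' r₁,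
      add_mem hU (diffOf_mem hD _), ?_, ?_⟩
    · rw [map_add, e7, e5, sub_add_cancel]
    · rw [LinearMap.comp_add, map_add]
      rw [e6] at e8
      calc _ = ((alg w).toLinearMap ∘ₗ T + homD P N U) + (alg w).toLinearMap ∘ₗ diffOf deg D h l₁
            + homD P N (diffOf deg D h' r₁) := by abel
        _ = _ := by rw [e8]; abel

end Basis

/-- Postcomposition with a quasi-isomorphism is a quasi-isomorphism. -/
lemma coneAcyclic_post (hP : IsPoly P) (w : M ⟶ N) (hw : quasiIso w) {k : P ⟶ N}
    (e : h ≫ w = k) : ConeAcyclic (diffD h) (diffD k) (post w e) := by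
  obtain ⟨n, deg, x, hdeg, hx⟩ := hP.exists_fin
  obtain ⟨D, hD⟩ := hx.exists_partials hP.1
  obtain ⟨m, hm⟩ := exists_neg_lt deg
  -- Since m exceeds every -deg i, the shifted degree is a positive integer and strictly increasing
  -- in the degree.
  let ω : Fin n → ℕ := fun i => (deg i + m).toNat
  have hω : ∀ i k, deg k < deg i → ω k < ω i := fun i k hik => by
    have h1 := hm i
    have h2 := hm k
    simp only [ω]; omega
  rintro ⟨T, hT⟩ ⟨U, hU⟩ h0 h1
  obtain ⟨l, rfl⟩ := hD.exists_diffOf hx hP.1 hT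
  obtain ⟨r, rfl⟩ := hD.exists_diffOf hx hP.1 hU
  let K := (l.support.sup fun a => weight ω a.1) + (r.support.sup fun a => weight ω a.1) + 1
  obtain ⟨T, hT', U, hU', h2, h3⟩ := hD.exists_primitive_of_quasiIso hx hP.1 (hx.isNonpos hdeg) hω
    w hw e K l r
    (mem_supportedLT.2 fun a ha => by
      by_contra hne
      have := Finset.le_sup (f := fun a : {a // ValidExponent deg a} => weight ω a.1)
        (Finsupp.mem_support_iff.2 hne)
      simp only [K] at ha this
      omega)
    (mem_supportedLT.2 fun a ha => by
      by_contra hne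
      have := Finset.le_sup (f := fun a : {a // ValidExponent deg a} => weight ω a.1)
        (Finsupp.mem_support_iff.2 hne)
      simp only [K] at ha this
      omega)
    (congrArg Subtype.val h0) (congrArg Subtype.val h1)
  exact ⟨⟨T, hT'⟩, ⟨U, hU'⟩, Subtype.ext h2, Subtype.ext h3⟩

end DGAlg

/-! ### Precomposition with quasi-isomorphisms. -/

namespace DGAlg

variable {A B M N P Q R : DGAlg.{u}}

/-- Precomposition with `f` is a quasi-isomorphism on differential operators. -/
def PreAcyclic (hP : IsPoly P) (hQ : IsComm Q) (f : P ⟶ Q) {h : Q ⟶ M} {k : P ⟶ M}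
    (e : f ≫ h = k) : Prop :=
  ConeAcyclic (diffD h) (diffD k) (pre hP hQ f e)

section

variable {hP : IsPoly P} {hQ : IsPoly Q} {hR : IsPoly R}

/-- Precomposition with f commutes with postcomposition with w, and the latter is a
quasi-isomorphism on operators. Thus the property of f can be tested with values in any target
quasi-isomorphic to the given one. -/
lemma preAcyclic_post_iff {f : P ⟶ Q} {h : Q ⟶ M} {k : P ⟶ M} {e : f ≫ h = k} {w : M ⟶ N}
    (hw : quasiIso w) {h' : Q ⟶ N} {k' : P ⟶ N} {e' : f ≫ h' = k'} (hh : h ≫ w = h') :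
    PreAcyclic hP hQ.1 f e ↔ PreAcyclic hP hQ.1 f e' := by
  subst hh
  have hk : k ≫ w = k' := by rw [← e, ← e', Category.assoc]
  have h1 := coneAcyclic_post hQ w hw (h := h) rfl
  have h2 := coneAcyclic_post hP w hw (h := k) hk
  have e : (pre hP hQ.1 f e').comp (post w (h := h) rfl) = (post w hk).comp (pre hP hQ.1 f e) := by
    ext; rfl
  constructor
  · intro h3
    refine ConeAcyclic.of_comp_right (post_diffD w rfl) (pre_diffD hP hQ.1 f e') h1 ?_
    rw [e]
    exact h3.comp (pre_diffD hP hQ.1 f _) (post_diffD w hk) h2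
  · intro h3
    refine ConeAcyclic.of_comp_left (pre_diffD hP hQ.1 f _) (post_diffD w hk) h2 ?_
    rw [← e]
    exact h1.comp (post_diffD w rfl) (pre_diffD hP hQ.1 f e') h3

/-- Precomposition with `f` is a quasi-isomorphism on the differential operators on its target. -/
def DualAcyclic (hP : IsPoly P) (hQ : IsPoly Q) (f : P ⟶ Q) : Prop :=
  PreAcyclic hP hQ.1 f (Category.comp_id f)

lemma dualAcyclic_iff {f : P ⟶ Q} {h : Q ⟶ M} (hh : quasiIso h) {k : P ⟶ M} (e : f ≫ h = k) :
    DualAcyclic hP hQ f ↔ PreAcyclic hP hQ.1 f e :=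
  preAcyclic_post_iff (hQ := hQ) hh (Category.id_comp h)

lemma dualAcyclic_id : DualAcyclic hP hP (𝟙 P) := by
  have : pre hP hP.1 (𝟙 P) (Category.comp_id (𝟙 P)) = LinearMap.id := by ext; rfl
  rw [DualAcyclic, PreAcyclic, this]
  exact coneAcyclic_id

lemma pre_comp {f : P ⟶ Q} {g : Q ⟶ R} {k : P ⟶ R} (e : f ≫ g = k) :
    (pre hP hQ.1 f e).comp (pre hQ hR.1 g (Category.comp_id g)) =
      pre hP hR.1 k (Category.comp_id k) := by
  subst e; ext; rfl

lemma DualAcyclic.comp {f : P ⟶ Q} {g : Q ⟶ R} (hg' : quasiIso g) (hf : DualAcyclic hP hQ f)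
    (hg : DualAcyclic hQ hR g) : DualAcyclic hP hR (f ≫ g) := by
  rw [dualAcyclic_iff hg' rfl] at hf
  rw [DualAcyclic, PreAcyclic, ← pre_comp (hQ := hQ) (hR := hR) rfl]
  exact ConeAcyclic.comp (pre_diffD _ _ _ _) (pre_diffD _ _ _ _) hg hf

lemma DualAcyclic.of_comp_left {f : P ⟶ Q} {g : Q ⟶ R} (hg' : quasiIso g)
    (hg : DualAcyclic hQ hR g) (h : DualAcyclic hP hR (f ≫ g)) : DualAcyclic hP hQ f := by
  rw [dualAcyclic_iff hg' rfl]
  rw [DualAcyclic, PreAcyclic, ← pre_comp (hQ := hQ) (hR := hR) rfl] at h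
  exact ConeAcyclic.of_comp_right (pre_diffD _ _ _ _) (pre_diffD _ _ _ _) hg h

lemma DualAcyclic.of_comp_right {f : P ⟶ Q} {g : Q ⟶ R} (hg' : quasiIso g)
    (hf : DualAcyclic hP hQ f) (h : DualAcyclic hP hR (f ≫ g)) : DualAcyclic hQ hR g := by
  rw [dualAcyclic_iff hg' rfl] at hf
  rw [DualAcyclic, PreAcyclic, ← pre_comp (hQ := hQ) (hR := hR) rfl] at h
  exact ConeAcyclic.of_comp_left (pre_diffD _ _ _ _) (pre_diffD _ _ _ _) hf h

/-- After values are moved to P along g, precomposition with f is injective on cohomology because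
its composite with that of g is, and surjective because it occurs last in the composite for f ≫ g.
-/
lemma DualAcyclic.two_of_six {f : P ⟶ Q} {g : Q ⟶ P} (hg' : quasiIso g)
    (h1 : DualAcyclic hP hP (f ≫ g)) (h2 : DualAcyclic hQ hQ (g ≫ f)) : DualAcyclic hP hQ f := by
  rw [dualAcyclic_iff hg' rfl]
  refine coneAcyclic_of (pre_diffD _ _ _ _) ?_ ?_
  · have h3 := (dualAcyclic_iff (hP := hQ) (hQ := hQ) (f := g ≫ f) hg' rfl).1 h2
    refine InjectiveOnCohomology.of_comp (ψ := pre hQ hP.1 g (h := f ≫ g)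
      (k := (g ≫ f) ≫ g) (Category.assoc _ _ _).symm) (pre_diffD _ _ _ _) ?_
    have : (pre hQ hP.1 g (h := f ≫ g) (k := (g ≫ f) ≫ g) (Category.assoc _ _ _).symm).comp
        (pre hP hQ.1 f (h := g) rfl) = pre hQ hQ.1 (g ≫ f) (h := g) rfl := by ext; rfl
    rw [this]
    exact h3.injective
  · rw [DualAcyclic, PreAcyclic, ← pre_comp (hQ := hQ) (hR := hP) rfl] at h1
    exact h1.surjective.of_comp (pre_diffD _ _ _ _)

end

/-- A differential operator extends along a map to a free algebra that carries generators to
generators. -/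
lemma IsFree.exists_lift_diffOp {κ κ' : Type} {deg : κ → ℤ} {y : κ → P} {deg' : κ' → ℤ} {x : κ' → Q}
    {f : P ⟶ Q} (hy : IsFree P deg y) (hx : IsFree Q deg' x) (hQ : IsComm Q) {e : κ → κ'}
    (he : Function.Injective e) (h1 : ∀ k, deg' (e k) = deg k) (h2 : ∀ k, x (e k) = alg f (y k))
    {D : Module.End ℂ P} (hD : D ∈ P.diffOps) :
    ∃ D' ∈ Q.diffOps, ∀ p, D' (alg f p) = alg f (D p) := by
  induction hD using Algebra.adjoin_induction with
  | mem D hD =>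
    rcases hD with ⟨q, rfl⟩ | ⟨n, hD⟩
    · exact ⟨_, mulLeft_mem_diffOps (alg f q), fun q' => by simp⟩
    · rw [isDerivation_iff] at hD
      -- The extended derivation is zero on the generators outside the image of e.
      obtain ⟨D', hD', h⟩ := hx.exists_isDer hQ isGraded_id n
        (Function.extend e (fun k => alg f (D (y k))) 0) (fun i => by
          by_cases hi : ∃ k, e k = i
          · obtain ⟨k, rfl⟩ := hi
            rw [he.extend_apply, h1]
            exact isGraded_alg f _ _ (hD.mem _ _ (hy.mem k))
          · rw [Function.extend_apply' _ _ _ hi]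
            exact zero_mem _)
      refine ⟨D', isDerivation_mem_diffOps (isDerivation_iff.2 hD'), fun q => ?_⟩
      refine LinearMap.congr_fun (hy.isDer_ext (hD'.comp_right (isGraded_alg f))
        (hD.comp_left (isGraded_alg f)) fun k => ?_) q
      have := h (e k)
      rwa [he.extend_apply, h2] at this
  | algebraMap a => exact ⟨algebraMap ℂ _ a, algebraMap_mem _ _, fun q => by
      simp [Algebra.algebraMap_eq_smul_one]⟩
  | add X Y _ _ hX hY =>
    obtain ⟨X', h1, h2⟩ := hX
    obtain ⟨Y', h3, h4⟩ := hY
    exact ⟨X' + Y', add_mem h1 h3, fun q => by simp [h2, h4]⟩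
  | mul X Y _ _ hX hY =>
    obtain ⟨X', h1, h2⟩ := hX
    obtain ⟨Y', h3, h4⟩ := hY
    exact ⟨X' * Y', mul_mem h1 h3, fun q => by simp [h2, h4]⟩

/-! ### Operators on an extension by contractible pairs. -/

namespace Extension

variable {ι : Type} {deg : ι → ℤ} {x : ι → Q} {κ : Type} {c : κ → ℤ}
  {E : Extension Q deg x c} {s : Module.End ℂ E.Z}

lemma isEigen_list_prod {V : Type*} [Ring V] [Algebra ℂ V] (e : V) (l : List V)
    (h : ∀ T ∈ l, ∃ μ : ℤ, e * T - T * e = (μ : ℂ) • T) :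
    ∃ μ : ℤ, e * l.prod - l.prod * e = (μ : ℂ) • l.prod := by
  induction l with
  | nil => exact ⟨0, by simp⟩
  | cons T l ih =>
    obtain ⟨μ, hμ⟩ := h T (by simp)
    obtain ⟨ν, hν⟩ := ih fun T hT => h T (by simp [hT])
    refine ⟨μ + ν, ?_⟩
    rw [List.prod_cons]
    calc _ = (e * T - T * e) * l.prod + T * (e * l.prod - l.prod * e) := by noncomm_ring
      _ = _ := by rw [hμ, hν, smul_mul_assoc, mul_smul_comm, ← add_smul]; push_cast; rfl

lemma isEigen_orderedMonomial {V : Type*} [Ring V] [Algebra ℂ V] (e : V) {n : ℕ} (T : Fin n → V)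
    (h : ∀ i, ∃ μ : ℤ, e * T i - T i * e = (μ : ℂ) • T i) (a : Fin n → ℕ) :
    ∃ μ : ℤ, e * orderedMonomial T a - orderedMonomial T a * e = (μ : ℂ) • orderedMonomial T a := by
  refine isEigen_list_prod e _ fun S hS => ?_
  rw [List.mem_ofFn] at hS
  obtain ⟨i, rfl⟩ := hS
  simpa using isEigen_list_prod e (List.replicate (a i) (T i)) fun S hS => by
    rw [List.eq_of_mem_replicate hS]; exact h i

/-- Differential operators on an extension are sums of eigenvectors of the bracket with the Euler
derivation, with integral eigenvalues. -/
lemma IsHomotopy.mem_span_eigen [Finite ι] [Finite κ] (hs : E.IsHomotopy s)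
    {T : Module.End ℂ E.Z} (hT : T ∈ E.Z.diffOps) :
    T ∈ Submodule.span ℂ {T | T ∈ E.Z.diffOps ∧
      ∃ μ : ℤ, E.euler s * T - T * E.euler s = (μ : ℂ) • T} := by
  obtain ⟨n, ⟨φ⟩⟩ := Finite.exists_equiv_fin (ι ⊕ (κ ⊕ κ))
  have hf := E.free.reindex φ.symm
  have heig : ∀ i, ∃ μ : ℤ, E.euler s ((Sum.elim (fun a => alg E.i (x a))
      (Sum.elim E.w fun k => E.Z.d (E.w k)) ∘ φ.symm) i) = (μ : ℂ) •
      (Sum.elim (fun a => alg E.i (x a)) (Sum.elim E.w fun k => E.Z.d (E.w k)) ∘ φ.symm) i := by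
    intro i
    simp only [Function.comp_apply]
    rcases φ.symm i with a | k | k
    · exact ⟨0, by simp [hs.euler_i]⟩
    · exact ⟨1, by simp [hs.euler_w]⟩
    · exact ⟨1, by simp [hs.euler_dw]⟩
  set z := Sum.elim (fun a => alg E.i (x a)) (Sum.elim E.w fun k => E.Z.d (E.w k)) ∘ φ.symm
  choose μ hμ using heig
  obtain ⟨D, hD⟩ := hf.exists_partials E.comm
  have hcomm : ∀ p : E.Z, E.euler s * LinearMap.mulLeft ℂ p - LinearMap.mulLeft ℂ p * E.euler s =
      LinearMap.mulLeft ℂ (E.euler s p) := fun p => by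
    ext q; simp [hs.euler_mul]
  -- Differentiation lowers the count of letters: ∂_i has minus the eigenvalue of its variable. Both
  -- sides are derivations, so comparing them on generators suffices.
  have hDe : ∀ i, ∃ ν : ℤ, E.euler s * D i - D i * E.euler s = (ν : ℂ) • D i := fun i => by
    refine ⟨-μ i, ?_⟩
    have h1 := hs.isDer_euler.commutator (hD.isDer i)
    have h2 := (hD.isDer i).smul ((-μ i : ℤ) : ℂ)
    rw [zero_mul, zpow_zero, one_smul, zero_add] at h1
    refine hf.isDer_ext h1 h2 fun j => ?_
    by_cases hij : i = j
    · subst hij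
      simp [hD.apply_self, hμ, hs.isDer_euler.apply_one]
    · simp [hD.apply_ne i j hij, hμ]
  have hmono : ∀ a : {a // ValidExponent (Sum.elim deg (Sum.elim c fun k => c k + 1) ∘ φ.symm) a}, ∃ ν : ℤ, E.euler s *
      LinearMap.mulLeft ℂ (orderedMonomial z a.1) - LinearMap.mulLeft ℂ (orderedMonomial z a.1) *
      E.euler s = (ν : ℂ) • LinearMap.mulLeft ℂ (orderedMonomial z a.1) := fun a => by
    have := isEigen_orderedMonomial (E.euler s) (fun i => LinearMap.mulLeft ℂ (z i))
      (fun i => ⟨μ i, by rw [hcomm, hμ]; ext; simp⟩) a.1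
    rwa [show orderedMonomial (fun i => LinearMap.mulLeft ℂ (z i)) a.1 =
      LinearMap.mulLeft ℂ (orderedMonomial z a.1) from
      (map_orderedMonomial (Algebra.lmul ℂ E.Z) z a.1).symm] at this
  have h := hD.mem_span hf E.comm hT
  refine Submodule.span_le.2 ?_ h
  rintro _ ⟨p, a, ha, rfl⟩
  have hp := span_orderedMonomial (fun i j => E.comm _ _ _ _ (hf.mem i) (hf.mem j)) p
    (by rw [hf.adjoin_eq_top]; trivial)
  obtain ⟨ν, hν⟩ := isEigen_orderedMonomial (E.euler s) D hDe a
  let F : E.Z →ₗ[ℂ] Module.End ℂ E.Z :=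
    LinearMap.mulRight ℂ (orderedMonomial D a) ∘ₗ LinearMap.mul ℂ E.Z
  refine Submodule.span_le (p := (Submodule.span ℂ {T | T ∈ E.Z.diffOps ∧
      ∃ μ : ℤ, E.euler s * T - T * E.euler s = (μ : ℂ) • T}).comap F).2 ?_ hp
  rintro _ ⟨b, rfl⟩
  refine Submodule.subset_span ⟨mul_mem (mulLeft_mem_diffOps _) (hD.orderedMonomial_mem a), ?_⟩
  have := isEigen_list_prod (E.euler s)
    [LinearMap.mulLeft ℂ (orderedMonomial z b.1), orderedMonomial D a] (by
      intro T hT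
      simp only [List.mem_cons, List.not_mem_nil, or_false] at hT
      rcases hT with rfl | rfl
      · exact hmono b
      · exact ⟨ν, hν⟩)
  simp only [List.prod_cons, List.prod_nil, mul_one] at this
  exact this

variable {r : E.Z ⟶ Q}

/-- Let D have eigenvalue μ for the bracket with the Euler derivation e. As r ∘ e = 0, the operator
T = m r D satisfies T ∘ e = -μ T. For μ = 0 it is a part T₀ killed by e; otherwise T = S ∘ e with S
= -μ⁻¹ T, and S vanishes on i(Q) because e does. -/
lemma IsHomotopy.exists_decomposition [Finite ι] [Finite κ] (hs : E.IsHomotopy s)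
    (hr : ∀ k, alg r (E.w k) = 0) {T : E.Z →ₗ[ℂ] Q} (hT : T ∈ Diff r) :
    ∃ S T₀ : E.Z →ₗ[ℂ] Q, S ∈ Diff r ∧ T = T₀ + S ∘ₗ E.euler s ∧ T₀ ∘ₗ E.euler s = 0 ∧
      S ∘ₗ (alg E.i).toLinearMap = 0 := by
  let V : Submodule ℂ (E.Z →ₗ[ℂ] Q) :=
    { carrier := {T | ∃ S T₀ : E.Z →ₗ[ℂ] Q, S ∈ Diff r ∧ T = T₀ + S ∘ₗ E.euler s ∧
        T₀ ∘ₗ E.euler s = 0 ∧ S ∘ₗ (alg E.i).toLinearMap = 0}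
      add_mem' := by
        rintro _ _ ⟨S, T₀, h1, rfl, h2, h3⟩ ⟨S', T₀', h1', rfl, h2', h3'⟩
        refine ⟨S + S', T₀ + T₀', add_mem h1 h1', ?_, ?_, ?_⟩
        · rw [LinearMap.add_comp]; abel
        · rw [LinearMap.add_comp, h2, h2', add_zero]
        · rw [LinearMap.add_comp, h3, h3', add_zero]
      zero_mem' := ⟨0, 0, zero_mem _, by simp, by simp, by simp⟩
      smul_mem' := by
        rintro a _ ⟨S, T₀, h1, rfl, h2, h3⟩
        refine ⟨a • S, a • T₀, Submodule.smul_mem _ _ h1, ?_, ?_, ?_⟩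
        · rw [LinearMap.smul_comp, smul_add]
        · rw [LinearMap.smul_comp, h2, smul_zero]
        · rw [LinearMap.smul_comp, h3, smul_zero] }
  suffices h : T ∈ V from h
  refine diff_le_of (fun m D hD => ?_) hT
  let F : Module.End ℂ E.Z →ₗ[ℂ] (E.Z →ₗ[ℂ] Q) :=
    LinearMap.compRight ℂ (LinearMap.mulLeft ℂ m ∘ₗ (alg r).toLinearMap)
  refine Submodule.span_le (p := V.comap F).2 ?_ (hs.mem_span_eigen hD)
  rintro D ⟨hD, μ, hμ⟩
  have hre : (alg r).toLinearMap ∘ₗ E.euler s = 0 := LinearMap.ext fun z => hs.comp_euler hr z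
  have h1 : F D ∘ₗ E.euler s = -(μ : ℂ) • F D := by
    have e : D ∘ₗ E.euler s = E.euler s ∘ₗ D - (μ : ℂ) • D := by
      rw [← hμ]; change _ = E.euler s * D - (E.euler s * D - D * E.euler s)
      rw [sub_sub_cancel]; rfl
    change (LinearMap.mulLeft ℂ m ∘ₗ (alg r).toLinearMap) ∘ₗ (D ∘ₗ E.euler s) = _
    rw [e, LinearMap.comp_sub, LinearMap.comp_smul, LinearMap.comp_assoc _ (alg r).toLinearMap,
      ← LinearMap.comp_assoc _ (E.euler s), hre]
    ext z; simp [F]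
  have h2 : E.euler s ∘ₗ (alg E.i).toLinearMap = 0 := LinearMap.ext fun q => hs.euler_i q
  by_cases h0 : μ = 0
  · refine ⟨0, F D, zero_mem _, by simp, ?_, by simp⟩
    rw [h1, h0]; simp
  · have h0' : (μ : ℂ) ≠ 0 := by exact_mod_cast h0
    refine ⟨-(μ : ℂ)⁻¹ • F D, 0, Submodule.smul_mem _ _ (mem_diff m hD), ?_, by simp, ?_⟩
    · rw [LinearMap.smul_comp, h1, smul_smul, zero_add, neg_mul_neg, inv_mul_cancel₀ h0', one_smul]
    · have h3 : (μ : ℂ) • (F D ∘ₗ (alg E.i).toLinearMap) = 0 := by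
        ext q
        have := LinearMap.congr_fun h1 (alg E.i q)
        simp only [LinearMap.comp_apply, LinearMap.smul_apply, hs.euler_i, map_zero] at this
        simpa using this.symm
      rw [LinearMap.smul_comp, (smul_eq_zero.1 h3).resolve_left h0', smul_zero]

/-- Every element is the sum of one in i(Q) and one in the image of the Euler derivation. -/
lemma IsHomotopy.eq_zero (hs : E.IsHomotopy s) (hir : E.i ≫ r = 𝟙 Q)
    (hr : ∀ k, alg r (E.w k) = 0) {T : E.Z →ₗ[ℂ] Q} (h1 : T ∘ₗ E.euler s = 0)
    (h2 : T ∘ₗ (alg E.i).toLinearMap = 0) : T = 0 := by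
  have hir' : ∀ q, alg r (alg E.i q) = q := fun q => AlgHom.congr_fun (congrArg alg hir) q
  ext z
  obtain ⟨t, ht⟩ := hs.exists_inverse hir hr (z := z - alg E.i (alg r z)) (by
    rw [map_sub, hir', sub_self])
  have h3 : T (z - alg E.i (alg r z)) = 0 := by rw [ht]; exact LinearMap.congr_fun h1 _
  rw [map_sub, show T (alg E.i (alg r z)) = 0 from LinearMap.congr_fun h2 _, sub_zero] at h3
  exact h3

/-- Restriction is surjective since operators on Q extend to Z. A cocycle T vanishing on i(Q) has
the form S ∘ e with S closed, and e = [d, s], so T is the differential of ± S ∘ s. -/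
lemma preAcyclic_i [Finite ι] [Finite κ] (hx : IsFree Q deg x) (hQ : IsPoly Q)
    (hir : E.i ≫ r = 𝟙 Q) (hr : ∀ k, alg r (E.w k) = 0) :
    PreAcyclic hQ E.comm E.i hir := by
  obtain ⟨s, hs⟩ := E.exists_isHomotopy hx
  have hir' : ∀ q, alg r (alg E.i q) = q := fun q => AlgHom.congr_fun (congrArg alg hir) q
  refine coneAcyclic_of_surjective (pre_diffD _ _ _ _) diffD_diffD ?_ ?_
  · rintro ⟨D, hD⟩
    obtain ⟨D', hD', h⟩ := hx.exists_lift_diffOp E.free E.comm Sum.inl_injective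
      (fun _ => rfl) (fun _ => rfl) (mem_diff_id.1 hD)
    refine ⟨⟨_, alg_comp_mem_diff hD'⟩, Subtype.ext (LinearMap.ext fun q => ?_)⟩
    change alg r (D' (alg E.i q)) = D q
    rw [h, hir']
  · rintro ⟨T, hT⟩ h0 hd
    have h0' : T ∘ₗ (alg E.i).toLinearMap = 0 := congrArg Subtype.val h0
    have hd' : homD E.Z Q T = 0 := congrArg Subtype.val hd
    obtain ⟨S, T₀, hS, hST, h1, h2⟩ := hs.exists_decomposition hr hT
    have h3 : E.euler s ∘ₗ (alg E.i).toLinearMap = 0 := LinearMap.ext fun q => hs.euler_i q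
    have h4 : T₀ = 0 := hs.eq_zero hir hr h1 (by
      rw [hST, LinearMap.add_comp, LinearMap.comp_assoc, h3, LinearMap.comp_zero, add_zero] at h0'
      exact h0')
    rw [h4, zero_add] at hST
    have hs1 : s ∈ E.Z.diffOps := isDerivation_mem_diffOps (isDerivation_iff.2 hs.isDer)
    have hds : homD E.Z E.Z s = E.euler s := by
      rw [← dEnd_eq_homD, dEnd_of_mem hs.isDer.mem, zpow_neg_one,
        show (-1 : ℂ)⁻¹ = -1 by norm_num, euler]
      module
    have hde : homD E.Z E.Z (E.euler s) = 0 := by rw [← hds, homD_homD]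
    -- Since e is closed, dS ∘ e = dT = 0; also dS vanishes on i(Q) because S does.
    have hdS : homD E.Z Q S = 0 := by
      refine hs.eq_zero hir hr ?_ ?_
      · rw [hST, homD_comp, hde, LinearMap.comp_zero, add_zero] at hd'
        exact hd'
      · rw [← homD_pre, h2, map_zero]
    have hsi : s ∘ₗ (alg E.i).toLinearMap = 0 := LinearMap.ext fun q => hs.apply_i q
    refine ⟨⟨homParity E.Z Q S ∘ₗ s, comp_mem_diff (homParity_mem_diff hS) hs1⟩,
      Subtype.ext ?_, Subtype.ext ?_⟩
    · change (homParity E.Z Q S ∘ₗ s) ∘ₗ (alg E.i).toLinearMap = 0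
      rw [LinearMap.comp_assoc, hsi, LinearMap.comp_zero]
    · change homD E.Z Q (homParity E.Z Q S ∘ₗ s) = T
      rw [homD_comp, homD_homParity, hdS, map_zero, neg_zero, LinearMap.zero_comp, zero_add,
        homParity_homParity, hds, hST]

end Extension

lemma IsExtension.dualAcyclic {i : Q ⟶ A} (hi : IsExtension i) (hQ : IsPoly Q) :
    DualAcyclic hQ hi.isPoly i := by
  have hiq := hi.quasiIso hQ.1
  have hA := hi.isPoly
  obtain ⟨ι, _, deg, x, κ, _, c, w, hdeg, hc, hx, hAc, hf⟩ := hi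
  let E : Extension Q deg x c := ⟨A, i, w, hAc, hf⟩
  obtain ⟨r, hir, hr⟩ := E.exists_retraction hx hQ.1
  exact (dualAcyclic_iff (quasiIso_of_retraction hir hiq) hir).2 (E.preAcyclic_i hx hQ hir hr)

/-- The property holds for i, hence for its retraction r, hence for the other section j of r. It
passes from i ≫ K to K by cancelling i, and then to j ≫ K. -/
lemma dualAcyclic_of_leftHomotopic {hP : IsPoly P} {hQ : IsPoly Q} (c : CylinderObject P)
    (K : c.Z ⟶ Q) (h0 : quasiIso (c.i ≫ K)) (h : DualAcyclic hP hQ (c.i ≫ K)) :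
    quasiIso (c.j ≫ K) ∧ DualAcyclic hP hQ (c.j ≫ K) := by
  have hi := c.isExtension.quasiIso hP.1
  have hr := quasiIso_of_retraction c.i_r hi
  have hK := quasiIso_of_comp_right hi h0
  have hj := quasiIso_of_comp_left hr (c.j_r ▸ quasiIso_id P)
  have hi' := c.isExtension.dualAcyclic hP
  have hr' : DualAcyclic c.isExtension.isPoly hP c.r :=
    hi'.of_comp_right hr (by rw [c.i_r]; exact dualAcyclic_id)
  have hj' : DualAcyclic hP c.isExtension.isPoly c.j :=
    DualAcyclic.of_comp_left hr hr' (by rw [c.j_r]; exact dualAcyclic_id)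
  exact ⟨quasiIso_comp hj hK, hj'.comp hK (hi'.of_comp_right hK h)⟩

lemma dualAcyclic_of_toHo_eq_id {hP : IsPoly P} {f : P ⟶ P}
    (h : CDGAlg.toHo.map (CDGAlg.homMk (A := CDGAlg.ofPoly hP) (B := CDGAlg.ofPoly hP) f) =
      𝟙 _) : DualAcyclic hP hP f := by
  obtain ⟨c⟩ := hP.exists_cylinderObject
  have h' : CDGAlg.toHo.map (𝟙 (CDGAlg.ofPoly hP)) =
    CDGAlg.toHo.map (CDGAlg.homMk (A := CDGAlg.ofPoly hP) (B := CDGAlg.ofPoly hP) f) := by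
    rw [h]; exact CDGAlg.toHo.map_id _
  obtain ⟨K, h1, h2⟩ := CDGAlg.leftHomotopic_of_toHo_eq (P := CDGAlg.ofPoly hP) c h'
  have h1' : c.i ≫ K = 𝟙 P := h1
  have h2' : c.j ≫ K = f := h2
  rw [← h2']
  exact (dualAcyclic_of_leftHomotopic c K (by rw [h1']; exact quasiIso_id P)
    (by rw [h1']; exact dualAcyclic_id)).2

/-- Precomposition with a quasi-isomorphism of polynomial algebras is a quasi-isomorphism. -/
theorem dualAcyclic_of_quasiIso (hP : IsPoly P) (hQ : IsPoly Q) (f : P ⟶ Q) (hf : quasiIso f) :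
    DualAcyclic hP hQ f := by
  let f' : CDGAlg.ofPoly hP ⟶ CDGAlg.ofPoly hQ := CDGAlg.homMk f
  have : IsIso (CDGAlg.toHo.map f') := Localization.inverts CDGAlg.toHo CDGAlg.quasiIso f' hf
  -- The inverse in the homotopy category is represented by a dg map because Q is polynomial.
  obtain ⟨g', hg'⟩ := CDGAlg.exists_toHo_map_eq (P := CDGAlg.ofPoly hQ) hQ
    (inv (CDGAlg.toHo.map f'))
  have : IsIso (CDGAlg.toHo.map g') := by rw [hg']; infer_instance
  have hg : quasiIso g'.hom := CDGAlg.quasiIso_of_isIso_toHo g'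
  refine DualAcyclic.two_of_six hg (dualAcyclic_of_toHo_eq_id ?_) (dualAcyclic_of_toHo_eq_id ?_)
  · change CDGAlg.toHo.map (f' ≫ g') = _
    rw [Functor.map_comp, hg', IsIso.hom_inv_id]
  · change CDGAlg.toHo.map (g' ≫ f') = _
    rw [Functor.map_comp, hg', IsIso.inv_hom_id]

end DGAlg

/-! ### Operators along f as a bimodule over the operators on source and target. -/

namespace DGAlg

variable {A B M N P Q R : DGAlg.{u}}

section Op

@[simp] lemma op_mul (D E : P.diffOpAlg) : op (D * E) = op D * op E := rfl
@[simp] lemma op_one : op (1 : P.diffOpAlg) = 1 := rfl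
@[simp] lemma op_zero : op (0 : P.diffOpAlg) = 0 := rfl
@[simp] lemma op_add (D E : P.diffOpAlg) : op (D + E) = op D + op E := rfl
@[simp] lemma op_smul (c : ℂ) (D : P.diffOpAlg) : op (c • D) = c • op D := rfl
lemma op_mem (D : P.diffOpAlg) : op D ∈ P.diffOps := Subtype.prop (p := (· ∈ P.diffOps)) D
lemma op_ext {D E : P.diffOpAlg} (h : op D = op E) : D = E := Subtype.ext (p := (· ∈ P.diffOps)) h
lemma exists_op_eq {D : Module.End ℂ P} (h : D ∈ P.diffOps) : ∃ E : P.diffOpAlg, op E = D :=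
  ⟨(⟨D, h⟩ : P.diffOps), rfl⟩
lemma op_d (D : P.diffOpAlg) : op (P.diffOpAlg.d D) = homD P P (op D) := dEnd_eq_homD (op D)
lemma op_mem_opDeg {D : P.diffOpAlg} {n : ℤ} : D ∈ P.diffOpAlg.grading n ↔ op D ∈ P.opDeg n :=
  Iff.rfl

lemma op_parity (D : P.diffOpAlg) : op (P.diffOpAlg.parity D) = homParity P P (op D) := by
  refine linear_induction (fun D => op (P.diffOpAlg.parity D) = homParity P P (op D)) ?_
    (fun n D hD => ?_) (fun D E hD hE => ?_) D
  · rw [map_zero, op_zero, map_zero]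
  · rw [parity_of_mem hD, op_smul]
    exact (parity_conj_of_mem (op_mem_opDeg.1 hD)).symm
  · rw [map_add, op_add, op_add, map_add, hD, hE]

end Op

section Grading

/-- Linear maps of degree `n`. -/
def homDeg (P M : DGAlg.{u}) (n : ℤ) : Submodule ℂ (P →ₗ[ℂ] M) where
  carrier := {T | ∀ m p, p ∈ P.grading m → T p ∈ M.grading (m + n)}
  add_mem' hS hT m p hp := add_mem (hS m p hp) (hT m p hp)
  zero_mem' _ _ _ := zero_mem _
  smul_mem' c _ hT m p hp := Submodule.smul_mem _ c (hT m p hp)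

lemma homDeg_comp {m n : ℤ} {S : Q →ₗ[ℂ] M} {T : P →ₗ[ℂ] Q} (hS : S ∈ homDeg Q M m)
    (hT : T ∈ homDeg P Q n) : S ∘ₗ T ∈ homDeg P M (m + n) := fun k p hp => by
  have := hS _ _ (hT k p hp)
  rwa [show k + (m + n) = k + n + m by ring]

lemma alg_mem_homDeg (f : P ⟶ Q) : (alg f).toLinearMap ∈ homDeg P Q 0 := fun m p hp => by
  rw [add_zero]; exact isGraded_alg f _ _ hp

lemma homParity_of_mem {n : ℤ} {T : P →ₗ[ℂ] M} (hT : T ∈ homDeg P M n) :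
    homParity P M T = (-1 : ℂ) ^ n • T := by
  refine linearMap_ext fun m p hp => ?_
  rw [homParity_apply, parity_of_mem hp, map_smul, map_smul, parity_of_mem (hT m p hp),
    neg_one_zpow_add, LinearMap.smul_apply, ← mul_smul, ← mul_assoc, neg_one_zpow_sq, one_mul]

lemma homD_mem_homDeg {n : ℤ} {T : P →ₗ[ℂ] M} (hT : T ∈ homDeg P M n) :
    homD P M T ∈ homDeg P M (n + 1) := by
  have e : homD P M T = M.d ∘ₗ T - homParity P M T ∘ₗ P.d := rfl
  rw [e, homParity_of_mem hT]
  refine sub_mem ?_ (homDeg_comp (Submodule.smul_mem _ _ hT) fun _ _ h => P.d_mem h)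
  rw [add_comm]
  exact homDeg_comp (fun _ _ h => M.d_mem h) hT

/-- The component of degree `n` of a linear map. -/
noncomputable def homComp (P M : DGAlg.{u}) (n : ℤ) : (P →ₗ[ℂ] M) →ₗ[ℂ] (P →ₗ[ℂ] M) where
  toFun T := DirectSum.toModule ℂ ℤ M (fun m => M.comp (m + n) ∘ₗ T ∘ₗ (P.grading m).subtype) ∘ₗ
    (DirectSum.decomposeLinearEquiv P.grading).toLinearMap
  map_add' S T := linearMap_ext fun m p hp => by
    have h : (DirectSum.decomposeLinearEquiv P.grading) p
      = DirectSum.lof ℂ ℤ (fun i => P.grading i) m ⟨p, hp⟩ := DirectSum.decompose_of_mem P.grading hp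
    simp [h]
  map_smul' c T := linearMap_ext fun m p hp => by
    have h : (DirectSum.decomposeLinearEquiv P.grading) p
      = DirectSum.lof ℂ ℤ (fun i => P.grading i) m ⟨p, hp⟩ := DirectSum.decompose_of_mem P.grading hp
    simp [h]

lemma homComp_apply (n : ℤ) (T : P →ₗ[ℂ] M) {m : ℤ} {p : P} (hp : p ∈ P.grading m) :
    homComp P M n T p = M.comp (m + n) (T p) := by
  have h : (DirectSum.decomposeLinearEquiv P.grading) p
      = DirectSum.lof ℂ ℤ (fun i => P.grading i) m ⟨p, hp⟩ := DirectSum.decompose_of_mem P.grading hp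
  simp [homComp, h]

lemma homComp_of_mem {n : ℤ} {T : P →ₗ[ℂ] M} (hT : T ∈ homDeg P M n) : homComp P M n T = T :=
  linearMap_ext fun m p hp => by rw [homComp_apply n T hp, comp_of_mem (hT m p hp)]

lemma homComp_of_mem_ne {n k : ℤ} {T : P →ₗ[ℂ] M} (hT : T ∈ homDeg P M n) (hk : k ≠ n) :
    homComp P M k T = 0 :=
  linearMap_ext fun m p hp => by
    rw [homComp_apply k T hp, comp_of_mem_ne (hT m p hp) (by omega), LinearMap.zero_apply]

variable {h : P ⟶ M}

/-- The value of an element of `DiffAlong h`. -/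
def dval : DiffAlong h →ₗ[ℂ] (P →ₗ[ℂ] M) := (Diff h).subtype

lemma dval_mem (T : DiffAlong h) : dval T ∈ Diff h := Subtype.prop (p := (· ∈ Diff h)) T

lemma dval_ext {S T : DiffAlong h} (e : dval S = dval T) : S = T :=
  Subtype.ext (p := (· ∈ Diff h)) e

/-- The elements of degree `n` of `DiffAlong h`. -/
def diffDeg (h : P ⟶ M) (n : ℤ) : Submodule ℂ (DiffAlong h) := (homDeg P M n).comap dval

lemma mem_iSup_diffDeg (T : DiffAlong h) : T ∈ ⨆ n, diffDeg h n := by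
  have key : ∀ T ∈ Diff h, T ∈ (⨆ n, diffDeg h n).map dval := by
    intro T hT
    refine diff_le_of (fun m D hD => ?_) hT
    let F : M →ₗ[ℂ] P.diffOpAlg →ₗ[ℂ] (P →ₗ[ℂ] M) :=
      { toFun := fun m =>
          { toFun := fun D => LinearMap.mulLeft ℂ m ∘ₗ (alg h).toLinearMap ∘ₗ op D
            map_add' := fun D E => by ext; simp [mul_add]
            map_smul' := fun c D => by ext; simp }
        map_add' := fun m m' => by ext; simp [add_mul]
        map_smul' := fun c m => by ext; simp }
    obtain ⟨D, rfl⟩ := exists_op_eq hD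
    change F m D ∈ _
    refine linear_induction (fun m => F m D ∈ (⨆ n, diffDeg h n).map dval) ?_ (fun k m hm => ?_)
      (fun m m' h1 h2 => ?_) m
    · rw [map_zero]; exact zero_mem _
    · refine linear_induction (fun D => F m D ∈ (⨆ n, diffDeg h n).map dval) ?_ (fun l D hD => ?_)
        (fun m m' h1 h2 => ?_) D
      · rw [map_zero]; exact zero_mem _
      · refine ⟨(⟨_, mem_diff m (op_mem D)⟩ : Diff h), ?_, rfl⟩
        refine Submodule.mem_iSup_of_mem (k + (0 + l)) ?_
        refine homDeg_comp (fun j p hp => ?_) (homDeg_comp (alg_mem_homDeg h) hD)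
        rw [add_comm]; exact mul_mem_grading hm hp
      · rw [map_add]; exact add_mem h1 h2
    · rw [map_add]; exact add_mem h1 h2
  obtain ⟨S, hS, e⟩ := key _ (dval_mem T)
  rwa [← dval_ext e]

lemma homComp_mem_diff (n : ℤ) {T : P →ₗ[ℂ] M} (hT : T ∈ Diff h) : homComp P M n T ∈ Diff h := by
  suffices H : ∀ T : DiffAlong h, homComp P M n (dval T) ∈ Diff h from H (⟨T, hT⟩ : Diff h)
  intro T
  induction mem_iSup_diffDeg T using Submodule.iSup_induction' with
  | mem k T hT =>
    by_cases hk : n = k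
    · subst hk; rw [homComp_of_mem hT]; exact dval_mem T
    · rw [homComp_of_mem_ne hT hk]; exact zero_mem _
  | zero => simp
  | add S T _ _ hS hT => rw [map_add, map_add]; exact add_mem hS hT

/-- The component of degree `n` of an element of `DiffAlong h`. -/
noncomputable def diffComp (h : P ⟶ M) (n : ℤ) : DiffAlong h →ₗ[ℂ] DiffAlong h :=
  (homComp P M n).restrict (p := Diff h) (q := Diff h) fun _ hT => homComp_mem_diff n hT

lemma diffComp_of_mem {n : ℤ} {T : DiffAlong h} (hT : T ∈ diffDeg h n) : diffComp h n T = T :=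
  dval_ext (homComp_of_mem hT)

lemma diffComp_of_mem_ne {n k : ℤ} {T : DiffAlong h} (hT : T ∈ diffDeg h n) (hk : k ≠ n) :
    diffComp h k T = 0 :=
  dval_ext (homComp_of_mem_ne hT hk)

end Grading

section Bimodule

variable {f : P ⟶ Q}

/-- `H ∘ A`. -/
def rmul (H : DiffAlong f) (A : P.diffOpAlg) : DiffAlong f :=
  (⟨dval H ∘ₗ op A, comp_mem_diff (dval_mem H) (op_mem A)⟩ : Diff f)

@[simp] lemma dval_rmul (H : DiffAlong f) (A : P.diffOpAlg) : dval (rmul H A) = dval H ∘ₗ op A := rfl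

/-- `D ∘ H`. -/
def lmul (hP : IsPoly P) (hQ : IsComm Q) (D : Q.diffOpAlg) (H : DiffAlong f) : DiffAlong f :=
  (⟨op D ∘ₗ dval H, diffOps_comp_mem_diff hP hQ (op_mem D) (dval_mem H)⟩ : Diff f)

@[simp] lemma dval_lmul (hP : IsPoly P) (hQ : IsComm Q) (D : Q.diffOpAlg) (H : DiffAlong f) :
    dval (lmul hP hQ D H) = op D ∘ₗ dval H := rfl

lemma dval_diffD (H : DiffAlong f) : dval (diffD f H) = homD P Q (dval H) := rfl

/-- `A ↦ f ∘ A`. -/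
def diffPost (f : P ⟶ Q) : P.diffOpAlg →ₗ[ℂ] DiffAlong f where
  toFun A := (⟨(alg f).toLinearMap ∘ₗ op A, alg_comp_mem_diff (op_mem A)⟩ : Diff f)
  map_add' _ _ := dval_ext (LinearMap.comp_add _ _ _)
  map_smul' _ _ := dval_ext (LinearMap.comp_smul _ _ _)

@[simp] lemma dval_diffPost (A : P.diffOpAlg) : dval (diffPost f A) = (alg f).toLinearMap ∘ₗ op A := rfl

/-- `D ↦ D ∘ f`. -/
def diffPre (hP : IsPoly P) (hQ : IsComm Q) (f : P ⟶ Q) : Q.diffOpAlg →ₗ[ℂ] DiffAlong f where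
  toFun D := (⟨op D ∘ₗ (alg f).toLinearMap,
    diffOps_comp_mem_diff hP hQ (op_mem D) (alg_comp_mem_diff (h := f) (one_mem _))⟩ : Diff f)
  map_add' _ _ := dval_ext (LinearMap.add_comp _ _ _)
  map_smul' _ _ := dval_ext (LinearMap.smul_comp _ _ _)

@[simp] lemma dval_diffPre (hP : IsPoly P) (hQ : IsComm Q) (D : Q.diffOpAlg) :
    dval (diffPre hP hQ f D) = op D ∘ₗ (alg f).toLinearMap := rfl

lemma diffPost_d (A : P.diffOpAlg) : diffPost f (P.diffOpAlg.d A) = diffD f (diffPost f A) :=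
  dval_ext (by rw [dval_diffPost, op_d, dval_diffD, dval_diffPost, homD_post])

lemma diffPre_d (hP : IsPoly P) (hQ : IsComm Q) (D : Q.diffOpAlg) :
    diffPre hP hQ f (Q.diffOpAlg.d D) = diffD f (diffPre hP hQ f D) :=
  dval_ext (by rw [dval_diffPre, op_d, dval_diffD, dval_diffPre, homD_pre])

/-- `D_P` is `Diff (𝟙 P)`. -/
lemma coneAcyclic_diffOpAlg {V : Type u} [AddCommGroup V] [Module ℂ V] {dV : V →ₗ[ℂ] V}
    {φ : DiffAlong (𝟙 P) →ₗ[ℂ] V} {ψ : P.diffOpAlg →ₗ[ℂ] V}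
    (e : ∀ (T : DiffAlong (𝟙 P)) (A : P.diffOpAlg), dval T = op A → φ T = ψ A)
    (h : ConeAcyclic (diffD (𝟙 P)) dV φ) : ConeAcyclic P.diffOpAlg.d dV ψ := by
  intro A v hA hv
  let T : DiffAlong (𝟙 P) := (⟨op A, mem_diff_id.2 (op_mem A)⟩ : Diff (𝟙 P))
  have hT : dval T = op A := rfl
  obtain ⟨S, v', h1, h2⟩ := h T v (dval_ext (by
    rw [dval_diffD, hT, ← op_d, hA, op_zero, map_zero])) ((e T A hT).trans hv)
  obtain ⟨B, hB⟩ := exists_op_eq (mem_diff_id.1 (dval_mem S))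
  refine ⟨B, v', op_ext ?_, ?_⟩
  · rw [op_d, hB, ← dval_diffD, h1, hT]
  · rw [← e S B hB.symm, h2]

lemma coneAcyclic_diffPost (hP : IsPoly P) (hf : quasiIso f) :
    ConeAcyclic P.diffOpAlg.d (diffD f) (diffPost f) :=
  coneAcyclic_diffOpAlg (fun T A h => dval_ext (by rw [dval_diffPost, ← h]; rfl))
    (coneAcyclic_post hP f hf (Category.id_comp f))

lemma coneAcyclic_diffPre (hP : IsPoly P) (hQ : IsPoly Q) (hf : quasiIso f) :
    ConeAcyclic Q.diffOpAlg.d (diffD f) (diffPre hP hQ.1 f) :=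
  coneAcyclic_diffOpAlg (fun T A h => dval_ext (by rw [dval_diffPre, ← h]; rfl))
    (dualAcyclic_of_quasiIso hP hQ f hf)

end Bimodule

end DGAlg

/-! ### Products, subalgebras and fibre products of dg algebras. -/

namespace DGAlg

variable {A B C M N P Q R : DGAlg.{u}}

section Constructions

lemma comp_mem_of_hom {n k : ℤ} (f : A ⟶ B) (a : A) (e : n = k) :
    alg f (A.comp n a) = B.comp k (alg f a) := by
  subst e
  refine LinearMap.congr_fun (f := (alg f).toLinearMap ∘ₗ A.comp n)
    (g := B.comp n ∘ₗ (alg f).toLinearMap) (linearMap_ext fun m a ha => ?_) a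
  simp only [LinearMap.comp_apply, AlgHom.toLinearMap_apply]
  by_cases h : n = m
  · subst h; rw [comp_of_mem ha, comp_of_mem (isGraded_alg f _ _ ha)]
  · rw [comp_of_mem_ne ha h, comp_of_mem_ne (isGraded_alg f _ _ ha) h, map_zero]

/-- The homogeneous elements of a product. -/
def prodGrading (A B : DGAlg.{u}) (n : ℤ) : Submodule ℂ (A × B) := (A.grading n).prod (B.grading n)

instance : SetLike.GradedMonoid (prodGrading A B) where
  one_mem := ⟨one_mem_grading, one_mem_grading⟩
  mul_mem _ _ _ _ hx hy := ⟨mul_mem_grading hx.1 hy.1, mul_mem_grading hx.2 hy.2⟩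

lemma prodGrading_isInternal : DirectSum.IsInternal (prodGrading A B) := by
  refine isInternal_of_components _ (fun n => (A.comp n).prodMap (B.comp n))
    (fun n x hx => Prod.ext (comp_of_mem hx.1) (comp_of_mem hx.2))
    (fun n k x hx hk => Prod.ext (comp_of_mem_ne hx.1 hk) (comp_of_mem_ne hx.2 hk)) (fun x => ?_)
  have e : x = LinearMap.inl ℂ A B x.1 + LinearMap.inr ℂ A B x.2 := by simp
  rw [e]
  refine add_mem (linear_induction (fun b => LinearMap.inl ℂ A B b ∈ ⨆ m, prodGrading A B m)
    ?_ (fun m b hb => ?_) (fun a b ha hb => ?_) _)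
    (linear_induction (fun b => LinearMap.inr ℂ A B b ∈ ⨆ m, prodGrading A B m)
    ?_ (fun m b hb => ?_) (fun a b ha hb => ?_) _)
  · rw [map_zero]; exact zero_mem _
  · exact Submodule.mem_iSup_of_mem m ⟨hb, zero_mem _⟩
  · rw [map_add]; exact add_mem ha hb
  · rw [map_zero]; exact zero_mem _
  · exact Submodule.mem_iSup_of_mem m ⟨zero_mem _, hb⟩
  · rw [map_add]; exact add_mem ha hb

/-- The product of two dg algebras. -/
noncomputable def prod (A B : DGAlg.{u}) : DGAlg.{u} where
  carrier := A × B
  grading := prodGrading A B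
  graded := { (inferInstance : SetLike.GradedMonoid (prodGrading A B)),
    prodGrading_isInternal.chooseDecomposition with }
  d := A.d.prodMap B.d
  d_mem h := ⟨A.d_mem h.1, B.d_mem h.2⟩
  d_d x := Prod.ext (A.d_d x.1) (B.d_d x.2)
  leibniz hx y := Prod.ext (A.leibniz hx.1 y.1) (B.leibniz hx.2 y.2)

/-- The first projection. -/
noncomputable def fst (A B : DGAlg.{u}) : prod A B ⟶ A :=
  ofAlg (AlgHom.fst ℂ A B) (fun _ _ h => h.1) fun _ => rfl

/-- The second projection. -/
noncomputable def snd (A B : DGAlg.{u}) : prod A B ⟶ B :=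
  ofAlg (AlgHom.snd ℂ A B) (fun _ _ h => h.2) fun _ => rfl

variable (S : Subalgebra ℂ A)

/-- The homogeneous elements of a subalgebra. -/
def subGrading (n : ℤ) : Submodule ℂ S := (A.grading n).comap S.val.toLinearMap

instance : SetLike.GradedMonoid (subGrading S) where
  one_mem := one_mem_grading (A := A)
  mul_mem _ _ _ _ hx hy := mul_mem_grading (A := A) hx hy

lemma subGrading_isInternal (hc : ∀ n, ∀ a ∈ S, A.comp n a ∈ S) :
    DirectSum.IsInternal (subGrading S) := by
  classical
  refine isInternal_of_components _ (fun n => (A.comp n).restrict (p := Subalgebra.toSubmodule S)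
      (q := Subalgebra.toSubmodule S) (hc n))
    (fun n x hx => Subtype.ext (comp_of_mem hx))
    (fun n k x hx hk => Subtype.ext (comp_of_mem_ne hx hk)) (fun x => ?_)
  have e : x = ∑ n ∈ (DirectSum.decompose A.grading x.1).support,
      (⟨A.comp n x.1, hc n _ x.2⟩ : S) := by
    refine Subtype.ext ?_
    rw [AddSubmonoidClass.coe_finsetSum]
    exact (DirectSum.sum_support_decompose A.grading x.1).symm
  rw [e]
  exact sum_mem fun n _ => Submodule.mem_iSup_of_mem n (comp_mem (A := A) n x.1)

/-- The dg algebra given by a homogeneous subalgebra stable under `d`. -/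
noncomputable def sub (hc : ∀ n, ∀ a ∈ S, A.comp n a ∈ S) (hd : ∀ a ∈ S, A.d a ∈ S) : DGAlg.{u} where
  carrier := S
  grading := subGrading S
  graded := { (inferInstance : SetLike.GradedMonoid (subGrading S)),
    (subGrading_isInternal S hc).chooseDecomposition with }
  d := A.d.restrict (p := Subalgebra.toSubmodule S) (q := Subalgebra.toSubmodule S) hd
  d_mem h := A.d_mem h
  d_d x := Subtype.ext (A.d_d x.1)
  leibniz hx y := Subtype.ext (A.leibniz hx y.1)

/-- The inclusion of a subalgebra. -/
noncomputable def subι (hc : ∀ n, ∀ a ∈ S, A.comp n a ∈ S) (hd : ∀ a ∈ S, A.d a ∈ S) :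
    sub S hc hd ⟶ A :=
  ofAlg S.val (fun _ _ h => h) fun _ => rfl

/-- A sub dg algebra of a product, given by a condition that is linear and homogeneous. -/
lemma exists_fiberProduct (A B : DGAlg.{u}) {V : Type u} [AddCommGroup V] [Module ℂ V]
    (φ : A →ₗ[ℂ] V) (ψ : B →ₗ[ℂ] V) (dV : V →ₗ[ℂ] V) (κ : ℤ → V →ₗ[ℂ] V)
    (hφ : ∀ a, φ (A.d a) = dV (φ a)) (hψ : ∀ b, ψ (B.d b) = dV (ψ b))
    (hφκ : ∀ n a, φ (A.comp n a) = κ n (φ a)) (hψκ : ∀ n b, ψ (B.comp n b) = κ n (ψ b))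
    (h1 : φ 1 = ψ 1) (hm : ∀ a a' b b', φ a = ψ b → φ a' = ψ b' → φ (a * a') = ψ (b * b')) :
    ∃ (G : DGAlg.{u}) (p : G ⟶ A) (q : G ⟶ B), (∀ g, φ (alg p g) = ψ (alg q g)) ∧
      (∀ a b, φ a = ψ b → ∃ g, alg p g = a ∧ alg q g = b) ∧
      ∀ g g', alg p g = alg p g' → alg q g = alg q g' → g = g' := by
  let S : Subalgebra ℂ (prod A B) :=
    { carrier := {x | φ x.1 = ψ x.2}
      mul_mem' := fun {x y} hx hy => hm _ _ _ _ hx hy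
      add_mem' := fun {x y} hx hy => by
        change φ (x.1 + y.1) = ψ (x.2 + y.2)
        rw [map_add, map_add, hx, hy]
      algebraMap_mem' := fun c => by
        change φ (algebraMap ℂ A c) = ψ (algebraMap ℂ B c)
        rw [Algebra.algebraMap_eq_smul_one, Algebra.algebraMap_eq_smul_one, map_smul, map_smul, h1] }
  -- The maps κ play the role of component projections on V; compatibility with them makes the
  -- subalgebra homogeneous without a grading on V.
  have hc : ∀ n, ∀ x ∈ S, (prod A B).comp n x ∈ S := fun n x hx => by
    change φ (alg (fst A B) ((prod A B).comp n x)) = ψ (alg (snd A B) ((prod A B).comp n x))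
    rw [comp_mem_of_hom _ _ rfl, comp_mem_of_hom _ _ rfl, hφκ, hψκ]
    exact congrArg _ hx
  have hd : ∀ x ∈ S, (prod A B).d x ∈ S := fun x hx => by
    change φ (A.d x.1) = ψ (B.d x.2)
    rw [hφ, hψ]; exact congrArg _ hx
  refine ⟨sub S hc hd, subι S hc hd ≫ fst A B, subι S hc hd ≫ snd A B, fun g => g.2,
    fun a b hab => ⟨⟨(a, b), hab⟩, rfl, rfl⟩, fun g g' h1 h2 => Subtype.ext (Prod.ext h1 h2)⟩

/-- The projection of a fibre product opposite to a surjective quasi-isomorphism is a surjective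
quasi-isomorphism. -/
lemma quasiIso_of_fiberProduct {V : Type u} [AddCommGroup V] [Module ℂ V]
    {φ : A →ₗ[ℂ] V} {ψ : B →ₗ[ℂ] V} {dV : V →ₗ[ℂ] V}
    (hψ : ∀ b, ψ (B.d b) = dV (ψ b)) (hs : Function.Surjective ψ)
    (hq : ConeAcyclic B.d dV ψ) {G : DGAlg.{u}} {p : G ⟶ A} {q : G ⟶ B}
    (hpq : ∀ a b, φ a = ψ b → ∃ g, alg p g = a ∧ alg q g = b)
    (hG : ∀ g, φ (alg p g) = ψ (alg q g))
    (hinj : ∀ g g', alg p g = alg p g' → alg q g = alg q g' → g = g') : quasiIso p := by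
  rw [quasiIso_iff]
  refine coneAcyclic_of_surjective (alg_d p) G.d_d (fun a => ?_) (fun g h0 hd => ?_)
  · obtain ⟨b, hb⟩ := hs (φ a)
    obtain ⟨g, hg, -⟩ := hpq a b hb.symm
    exact ⟨g, hg⟩
  · have h0' : alg p g = 0 := h0
    obtain ⟨b, hb1, hb2⟩ := hq.kernel hψ hs B.d_d (alg q g) (by rw [← hG, h0', map_zero])
      (by rw [← alg_d, hd, map_zero])
    obtain ⟨g', h1, h2⟩ := hpq 0 b (by rw [hb1, map_zero])
    refine ⟨g', h1, hinj _ _ ?_ ?_⟩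
    · rw [alg_d, h1, h0', map_zero]
    · rw [alg_d, h2, hb2]

end Constructions

/-! ### The dg algebra of pairs of operators with a homotopy. -/

section Triangular

/-- Triples `(A, H, D)` of differential operators on `P`, along `f`, and on `Q`. -/
def Triangular (_hP : IsPoly P) (_hQ : IsPoly Q) (f : P ⟶ Q) : Type u :=
  P.diffOpAlg × DiffAlong f × Q.diffOpAlg

variable {hP : IsPoly P} {hQ : IsPoly Q} {f : P ⟶ Q}

namespace Triangular

noncomputable instance : AddCommGroup (Triangular hP hQ f) :=
  inferInstanceAs (AddCommGroup (P.diffOpAlg × DiffAlong f × Q.diffOpAlg))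
noncomputable instance : Module ℂ (Triangular hP hQ f) :=
  inferInstanceAs (Module ℂ (P.diffOpAlg × DiffAlong f × Q.diffOpAlg))

/-- The diagonal entry on the source. -/
noncomputable def fst : Triangular hP hQ f →ₗ[ℂ] P.diffOpAlg :=
  LinearMap.fst ℂ P.diffOpAlg (DiffAlong f × Q.diffOpAlg)

/-- The off-diagonal entry. -/
noncomputable def mid : Triangular hP hQ f →ₗ[ℂ] DiffAlong f :=
  LinearMap.fst ℂ _ _ ∘ₗ LinearMap.snd ℂ P.diffOpAlg (DiffAlong f × Q.diffOpAlg)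

/-- The diagonal entry on the target. -/
noncomputable def snd : Triangular hP hQ f →ₗ[ℂ] Q.diffOpAlg :=
  LinearMap.snd ℂ _ _ ∘ₗ LinearMap.snd ℂ P.diffOpAlg (DiffAlong f × Q.diffOpAlg)

/-- The triple with given entries. -/
noncomputable def mk (A : P.diffOpAlg) (H : DiffAlong f) (D : Q.diffOpAlg) : Triangular hP hQ f := (A, H, D)

@[simp] lemma fst_mk (A : P.diffOpAlg) (H : DiffAlong f) (D : Q.diffOpAlg) :
    fst (mk A H D : Triangular hP hQ f) = A := rfl
@[simp] lemma mid_mk (A : P.diffOpAlg) (H : DiffAlong f) (D : Q.diffOpAlg) :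
    mid (mk A H D : Triangular hP hQ f) = H := rfl
@[simp] lemma snd_mk (A : P.diffOpAlg) (H : DiffAlong f) (D : Q.diffOpAlg) :
    snd (mk A H D : Triangular hP hQ f) = D := rfl

lemma ext {x y : Triangular hP hQ f} (h1 : fst x = fst y) (h2 : mid x = mid y)
    (h3 : snd x = snd y) : x = y := Prod.ext h1 (Prod.ext h2 h3)

/-- This is multiplication of triangular matrices. The off-diagonal entry sits one degree lower,
hence the parity sign when an operator on Q passes it. -/
noncomputable instance : Mul (Triangular hP hQ f) :=
  ⟨fun x y => mk (fst x * fst y)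
    (rmul (mid x) (fst y) + lmul hP hQ.1 (Q.diffOpAlg.parity (snd x)) (mid y)) (snd x * snd y)⟩
noncomputable instance : One (Triangular hP hQ f) := ⟨mk 1 0 1⟩

@[simp] lemma fst_mul (x y : Triangular hP hQ f) : fst (x * y) = fst x * fst y := rfl
@[simp] lemma mid_mul (x y : Triangular hP hQ f) : mid (x * y) =
    rmul (mid x) (fst y) + lmul hP hQ.1 (Q.diffOpAlg.parity (snd x)) (mid y) := rfl
@[simp] lemma snd_mul (x y : Triangular hP hQ f) : snd (x * y) = snd x * snd y := rfl
@[simp] lemma fst_one : fst (1 : Triangular hP hQ f) = 1 := rfl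
@[simp] lemma mid_one : mid (1 : Triangular hP hQ f) = 0 := rfl
@[simp] lemma snd_one : snd (1 : Triangular hP hQ f) = 1 := rfl

lemma parity_one : A.parity 1 = 1 := by
  rw [parity_of_mem one_mem_grading]; simp

noncomputable instance : Ring (Triangular hP hQ f) :=
  { (inferInstance : AddCommGroup (Triangular hP hQ f)),
    (inferInstance : Mul (Triangular hP hQ f)), (inferInstance : One (Triangular hP hQ f)) with
    left_distrib := fun x y z => ext (by simp [mul_add]) (dval_ext (by
      ext; simp; abel)) (by simp [mul_add])
    right_distrib := fun x y z => ext (by simp [add_mul]) (dval_ext (by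
      ext; simp; abel)) (by simp [add_mul])
    zero_mul := fun x => ext (by simp) (dval_ext (by ext; simp)) (by simp)
    mul_zero := fun x => ext (by simp) (dval_ext (by ext; simp)) (by simp)
    mul_assoc := fun x y z => ext (by simp [mul_assoc]) (dval_ext (by
      ext; simp [parity_mul]; abel)) (by simp [mul_assoc])
    one_mul := fun x => ext (by simp) (dval_ext (by ext; simp [parity_one])) (by simp)
    mul_one := fun x => ext (by simp) (dval_ext (by ext; simp)) (by simp) }

noncomputable instance : Algebra ℂ (Triangular hP hQ f) :=
  Algebra.ofModule
    (fun c x y => ext (by simp) (dval_ext (by ext; simp)) (by simp))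
    (fun c x y => ext (by simp) (dval_ext (by ext; simp)) (by simp))

/-- The homogeneous triples. -/
noncomputable def grading (hP : IsPoly P) (hQ : IsPoly Q) (f : P ⟶ Q) (n : ℤ) :
    Submodule ℂ (Triangular hP hQ f) :=
  (P.diffOpAlg.grading n).comap fst ⊓ (diffDeg f (n - 1)).comap mid ⊓
    (Q.diffOpAlg.grading n).comap snd

lemma parity_mem {n : ℤ} {a : A} (ha : a ∈ A.grading n) : A.parity a ∈ A.grading n := by
  rw [parity_of_mem ha]; exact Submodule.smul_mem _ _ ha

lemma mk_mem {n : ℤ} {A : P.diffOpAlg} {H : DiffAlong f} {D : Q.diffOpAlg}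
    (hA : A ∈ P.diffOpAlg.grading n) (hH : H ∈ diffDeg f (n - 1))
    (hD : D ∈ Q.diffOpAlg.grading n) : (mk A H D : Triangular hP hQ f) ∈ grading hP hQ f n :=
  ⟨⟨hA, hH⟩, hD⟩

instance : SetLike.GradedMonoid (grading hP hQ f) where
  one_mem := mk_mem one_mem_grading (zero_mem _) one_mem_grading
  mul_mem k l x y hx hy := mk_mem (mul_mem_grading hx.1.1 hy.1.1) (add_mem
    (by
      have := homDeg_comp hx.1.2 (op_mem_opDeg.1 hy.1.1)
      rwa [show k - 1 + l = k + l - 1 by ring] at this)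
    (by
      have := homDeg_comp (op_mem_opDeg.1 (parity_mem hx.2)) hy.1.2
      rwa [show k + (l - 1) = k + l - 1 by ring] at this)) (mul_mem_grading hx.2 hy.2)

lemma isInternal : DirectSum.IsInternal (grading hP hQ f) := by
  let π : ℤ → Triangular hP hQ f →ₗ[ℂ] Triangular hP hQ f := fun n =>
    (P.diffOpAlg.comp n).prodMap ((diffComp f (n - 1)).prodMap (Q.diffOpAlg.comp n))
  refine isInternal_of_components _ π
    (fun n x hx => ext (comp_of_mem hx.1.1) (diffComp_of_mem hx.1.2) (comp_of_mem hx.2))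
    (fun n k x hx hk => ext (comp_of_mem_ne hx.1.1 hk) (diffComp_of_mem_ne hx.1.2 (by omega))
      (comp_of_mem_ne hx.2 hk)) (fun x => ?_)
  let l1 : P.diffOpAlg →ₗ[ℂ] Triangular hP hQ f :=
    LinearMap.inl ℂ P.diffOpAlg (DiffAlong f × Q.diffOpAlg)
  let l2 : DiffAlong f →ₗ[ℂ] Triangular hP hQ f :=
    LinearMap.inr ℂ P.diffOpAlg (DiffAlong f × Q.diffOpAlg) ∘ₗ LinearMap.inl ℂ _ _
  let l3 : Q.diffOpAlg →ₗ[ℂ] Triangular hP hQ f :=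
    LinearMap.inr ℂ P.diffOpAlg (DiffAlong f × Q.diffOpAlg) ∘ₗ LinearMap.inr ℂ _ _
  have e : x = l1 (fst x) + l2 (mid x) + l3 (snd x) := ext
    (by change _ = fst x + 0 + 0; simp) (by change _ = 0 + mid x + 0; simp)
    (by change _ = 0 + 0 + snd x; simp)
  rw [e]
  refine add_mem (add_mem (linear_induction (fun b => l1 b ∈ ⨆ m, grading hP hQ f m)
    ?_ (fun m b hb => ?_) (fun a b ha hb => ?_) _) ?_)
    (linear_induction (fun b => l3 b ∈ ⨆ m, grading hP hQ f m)
    ?_ (fun m b hb => ?_) (fun a b ha hb => ?_) _)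
  · rw [map_zero]; exact zero_mem _
  · exact Submodule.mem_iSup_of_mem m (mk_mem hb (zero_mem _) (zero_mem _))
  · rw [map_add]; exact add_mem ha hb
  · have h : ∀ T ∈ ⨆ n, diffDeg f n, l2 T ∈ ⨆ m, grading hP hQ f m := by
      intro T hT
      refine (iSup_le fun n => ?_ : ⨆ n, diffDeg f n ≤ (⨆ m, grading hP hQ f m).comap l2) hT
      intro T hT
      refine Submodule.mem_iSup_of_mem (n + 1) (mk_mem (zero_mem _) ?_ (zero_mem _))
      rw [add_sub_cancel_right]; exact hT
    exact h _ (mem_iSup_diffDeg _)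
  · rw [map_zero]; exact zero_mem _
  · exact Submodule.mem_iSup_of_mem m (mk_mem (zero_mem _) (zero_mem _) hb)
  · rw [map_add]; exact add_mem ha hb

/-- The differential of `Triangular`. -/
noncomputable def d (hP : IsPoly P) (hQ : IsPoly Q) (f : P ⟶ Q) :
    Triangular hP hQ f →ₗ[ℂ] Triangular hP hQ f :=
  (P.diffOpAlg.d ∘ₗ fst).prod
    ((diffPost f ∘ₗ fst - diffPre hP hQ.1 f ∘ₗ snd - diffD f ∘ₗ mid).prod (Q.diffOpAlg.d ∘ₗ snd))

@[simp] lemma fst_d (x : Triangular hP hQ f) : fst (d hP hQ f x) = P.diffOpAlg.d (fst x) := rfl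
@[simp] lemma mid_d (x : Triangular hP hQ f) : mid (d hP hQ f x) =
    diffPost f (fst x) - diffPre hP hQ.1 f (snd x) - diffD f (mid x) := rfl
@[simp] lemma snd_d (x : Triangular hP hQ f) : snd (d hP hQ f x) = Q.diffOpAlg.d (snd x) := rfl

end Triangular

/-- The dg algebra of triples `(A, H, D)`; `H` is a homotopy between `f ∘ A` and `D ∘ f`. -/
noncomputable def triangular (hP : IsPoly P) (hQ : IsPoly Q) (f : P ⟶ Q) : DGAlg.{u} where
  carrier := Triangular hP hQ f
  grading := Triangular.grading hP hQ f
  graded := { (inferInstance : SetLike.GradedMonoid (Triangular.grading hP hQ f)),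
    Triangular.isInternal.chooseDecomposition with }
  d := Triangular.d hP hQ f
  d_mem {n x} hx := by
    refine Triangular.mk_mem (DGAlg.d_mem _ hx.1.1) ?_ (DGAlg.d_mem _ hx.2)
    rw [add_sub_cancel_right]
    refine sub_mem (sub_mem ?_ ?_) ?_
    · have := homDeg_comp (alg_mem_homDeg f) (op_mem_opDeg.1 hx.1.1)
      rwa [zero_add] at this
    · have := homDeg_comp (op_mem_opDeg.1 hx.2) (alg_mem_homDeg f)
      rwa [add_zero] at this
    · have := homD_mem_homDeg hx.1.2
      rwa [sub_add_cancel] at this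
  d_d x := Triangular.ext (P.diffOpAlg.d_d (Triangular.fst x)) (by
    simp only [Triangular.mid_d, Triangular.fst_d, Triangular.snd_d, map_sub, diffPost_d, diffPre_d,
      diffD_diffD, map_zero]
    abel) (Q.diffOpAlg.d_d (Triangular.snd x))
  leibniz {n x} hx y := by
    refine Triangular.ext (P.diffOpAlg.leibniz hx.1.1 (Triangular.fst y)) (dval_ext ?_)
      (Q.diffOpAlg.leibniz hx.2 (Triangular.snd y))
    have h1 : homParity P Q (dval (Triangular.mid x)) = (-1 : ℂ) ^ (n - 1) • dval (Triangular.mid x) :=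
      homParity_of_mem hx.1.2
    have h2 : (-1 : ℂ) ^ (n - 1) = -(-1 : ℂ) ^ n := by
      rw [sub_eq_add_neg, neg_one_zpow_add, zpow_neg_one, show (-1 : ℂ)⁻¹ = -1 by norm_num]; ring
    have h3 := parity_of_mem (p := Triangular.snd x) hx.2
    have h4 := parity_of_mem (Q.diffOpAlg.d_mem (a := Triangular.snd x) hx.2)
    simp only [Triangular.mid_d, Triangular.mid_mul, Triangular.fst_d, Triangular.snd_d,
      Triangular.fst_mul, Triangular.snd_mul, map_sub, map_add, map_smul, dval_rmul, dval_lmul,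
      dval_diffPost, dval_diffPre, dval_diffD, homD_comp, h1, h2, h3, h4, op_mul, op_smul,
      ← op_d, ← op_parity]
    ext p
    simp only [LinearMap.sub_apply, LinearMap.add_apply, LinearMap.comp_apply, LinearMap.smul_apply,
      Module.End.mul_apply, AlgHom.toLinearMap_apply, map_sub, smul_add, smul_sub,
      smul_smul, neg_one_zpow_sq, one_smul, neg_one_zpow_add, zpow_one, mul_neg, mul_one, neg_smul]
    abel

/-- The projection to the operators on the source. -/
noncomputable def triFst (hP : IsPoly P) (hQ : IsPoly Q) (f : P ⟶ Q) :
    triangular hP hQ f ⟶ P.diffOpAlg :=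
  ofAlg (AlgHom.ofLinearMap (Triangular.fst (hP := hP) (hQ := hQ) (f := f)) rfl fun _ _ => rfl)
    (fun _ _ h => h.1.1) fun _ => rfl

/-- The projection to the operators on the target. -/
noncomputable def triSnd (hP : IsPoly P) (hQ : IsPoly Q) (f : P ⟶ Q) :
    triangular hP hQ f ⟶ Q.diffOpAlg :=
  ofAlg (AlgHom.ofLinearMap (Triangular.snd (hP := hP) (hQ := hQ) (f := f)) rfl fun _ _ => rfl)
    (fun _ _ h => h.2) fun _ => rfl

lemma triFst_surjective : Function.Surjective (alg (triFst hP hQ f)) := fun A =>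
  ⟨(Triangular.mk A 0 0 : Triangular hP hQ f), rfl⟩

/-- The kernel consists of the pairs (H, D), a shifted cone of D ↦ D ∘ f, so its acyclicity is that
of precomposition. -/
lemma quasiIso_triFst (hf : quasiIso f) : quasiIso (triFst hP hQ f) := by
  rw [quasiIso_iff]
  refine coneAcyclic_of_surjective (fun v => alg_d (triFst hP hQ f) v) (triangular hP hQ f).d_d triFst_surjective ?_
  intro x hx hdx
  have h0 : Triangular.fst x = 0 := hx
  have h1 : Q.diffOpAlg.d (Triangular.snd x) = 0 := congrArg (Triangular.snd (hP := hP) (hQ := hQ) (f := f)) hdx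
  have h2 : diffPost f (Triangular.fst x) - diffPre hP hQ.1 f (Triangular.snd x) -
    diffD f (Triangular.mid x) = 0 := congrArg (Triangular.mid (hP := hP) (hQ := hQ) (f := f)) hdx
  rw [h0, map_zero, zero_sub] at h2
  obtain ⟨D, H, h3, h4⟩ := coneAcyclic_diffPre hP hQ hf (Triangular.snd x) (-Triangular.mid x) h1
    (by rw [map_neg]; exact (neg_eq_iff_eq_neg.1 (sub_eq_zero.1 h2)))
  refine ⟨(Triangular.mk 0 H D : Triangular hP hQ f), rfl, Triangular.ext ?_ ?_ h3⟩
  · exact (map_zero P.diffOpAlg.d).trans h0.symm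
  · change diffPost f 0 - diffPre hP hQ.1 f D - diffD f H = Triangular.mid x
    rw [map_zero, zero_sub, ← neg_add', h4, neg_neg]

/-- Here the kernel is a shifted cone of A ↦ f ∘ A. -/
lemma quasiIso_triSnd (hf : quasiIso f) : quasiIso (triSnd hP hQ f) := by
  rw [quasiIso_iff]
  refine coneAcyclic_of_surjective (fun v => alg_d (triSnd hP hQ f) v) (triangular hP hQ f).d_d
    (fun D => ⟨(Triangular.mk 0 0 D : Triangular hP hQ f), rfl⟩) ?_
  intro x hx hdx
  have h0 : Triangular.snd x = 0 := hx
  have h1 : P.diffOpAlg.d (Triangular.fst x) = 0 := congrArg (Triangular.fst (hP := hP) (hQ := hQ) (f := f)) hdx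
  have h2 : diffPost f (Triangular.fst x) - diffPre hP hQ.1 f (Triangular.snd x) -
    diffD f (Triangular.mid x) = 0 := congrArg (Triangular.mid (hP := hP) (hQ := hQ) (f := f)) hdx
  rw [h0, map_zero, sub_zero] at h2
  obtain ⟨A, H, h3, h4⟩ := coneAcyclic_diffPost hP hf (Triangular.fst x) (Triangular.mid x) h1
    (sub_eq_zero.1 h2)
  refine ⟨(Triangular.mk A (-H) 0 : Triangular hP hQ f), rfl, Triangular.ext h3 ?_ ?_⟩
  · change diffPost f A - diffPre hP hQ.1 f 0 - diffD f (-H) = Triangular.mid x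
    rw [map_zero, sub_zero, map_neg, sub_neg_eq_add, h4]
  · exact (map_zero Q.diffOpAlg.d).trans h0.symm

end Triangular

end DGAlg

/-! ### Transfer of differential operators in the homotopy category. -/

namespace DGAlg

variable {A B C E M N P Q R : DGAlg.{u}}

section Transfer

/-- A morphism to `triangular hP hQ f`. -/
lemma exists_triangular_lift (hP : IsPoly P) (hQ : IsPoly Q) (f : P ⟶ Q) (s : E ⟶ P.diffOpAlg)
    (t : E ⟶ Q.diffOpAlg) (H : E →ₗ[ℂ] DiffAlong f) (h1 : H 1 = 0)
    (hmul : ∀ a b, H (a * b) = rmul (H a) (alg s b) + lmul hP hQ.1 (Q.diffOpAlg.parity (alg t a)) (H b))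
    (hdeg : ∀ n, ∀ a ∈ E.grading n, H a ∈ diffDeg f (n - 1))
    (hd : ∀ a, H (E.d a) = diffPost f (alg s a) - diffPre hP hQ.1 f (alg t a) - diffD f (H a)) :
    ∃ v : E ⟶ triangular hP hQ f, v ≫ triFst hP hQ f = s ∧ v ≫ triSnd hP hQ f = t := by
  let F : E →ₐ[ℂ] triangular hP hQ f := AlgHom.ofLinearMap
    ((alg s).toLinearMap.prod (H.prod (alg t).toLinearMap) : E →ₗ[ℂ] Triangular hP hQ f)
    (Triangular.ext (hP := hP) (hQ := hQ) (map_one (alg s)) h1 (map_one (alg t)))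
    (fun a b => Triangular.ext (hP := hP) (hQ := hQ) (map_mul (alg s) a b)
      (hmul a b) (map_mul (alg t) a b))
  exact ⟨ofAlg F (fun n a ha => Triangular.mk_mem (isGraded_alg s _ _ ha) (hdeg n a ha)
    (isGraded_alg t _ _ ha)) (fun a => Triangular.ext (hP := hP) (hQ := hQ) (alg_d s a) (hd a) (alg_d t a)), rfl, rfl⟩

/-- The isomorphism `D_P ≅ D_Q` in the homotopy category given by a quasi-isomorphism `P ⟶ Q`. -/
noncomputable def transfer (hP : IsPoly P) (hQ : IsPoly Q) {f : P ⟶ Q} (hf : quasiIso f) :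
    toHo.obj P.diffOpAlg ≅ toHo.obj Q.diffOpAlg :=
  (Localization.isoOfHom toHo quasiIso _ (quasiIso_triFst (hP := hP) (hQ := hQ) hf)).symm ≪≫
    Localization.isoOfHom toHo quasiIso _ (quasiIso_triSnd hf)

variable {hP : IsPoly P} {hQ : IsPoly Q} {hR : IsPoly R} {f : P ⟶ Q} {g : Q ⟶ R}

lemma map_triFst_transfer (hf : quasiIso f) :
    toHo.map (triFst hP hQ f) ≫ (transfer hP hQ hf).hom = toHo.map (triSnd hP hQ f) := by
  have := (Localization.isoOfHom toHo quasiIso _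
    (quasiIso_triFst (hP := hP) (hQ := hQ) hf)).hom_inv_id_assoc (toHo.map (triSnd hP hQ f))
  exact this

lemma map_transfer (hf : quasiIso f) {s : E ⟶ P.diffOpAlg} {t : E ⟶ Q.diffOpAlg}
    (h : ∃ v : E ⟶ triangular hP hQ f, v ≫ triFst hP hQ f = s ∧ v ≫ triSnd hP hQ f = t) :
    toHo.map s ≫ (transfer hP hQ hf).hom = toHo.map t := by
  obtain ⟨v, rfl, rfl⟩ := h
  rw [Functor.map_comp, Category.assoc, map_triFst_transfer, Functor.map_comp]

lemma diffPost_eq_diffPre_iff {hc : IsComm Q} {D : P.diffOpAlg} {D' : Q.diffOpAlg} :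
    diffPost f D = diffPre hP hc f D' ↔ Intertwines f D D' :=
  ⟨fun h p => LinearMap.congr_fun (congrArg dval h) p,
    fun h => dval_ext (LinearMap.ext h)⟩

/-- Operators that agree exactly along f agree with the zero homotopy. -/
lemma map_transfer_of_intertwines (hf : quasiIso f) {s : E ⟶ P.diffOpAlg} {t : E ⟶ Q.diffOpAlg}
    (h : ∀ e, Intertwines f (alg s e) (alg t e)) :
    toHo.map s ≫ (transfer hP hQ hf).hom = toHo.map t := by
  refine map_transfer hf (exists_triangular_lift hP hQ f s t 0 rfl (fun a b => ?_)
    (fun _ _ _ => zero_mem _) fun a => ?_)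
  · refine dval_ext ?_
    simp
  · rw [LinearMap.zero_apply, LinearMap.zero_apply, map_zero, sub_zero,
      diffPost_eq_diffPre_iff (hP := hP) (hc := hQ.1) |>.2 (h a), sub_self]

lemma transfer_id (h : quasiIso (𝟙 P)) : transfer hP hP h = Iso.refl _ := by
  ext
  have := map_transfer_of_intertwines (hP := hP) (hQ := hP) h (s := 𝟙 P.diffOpAlg)
    (t := 𝟙 P.diffOpAlg) fun e p => rfl
  rwa [CategoryTheory.Functor.map_id, Category.id_comp] at this

/-- `D_P` and `D_Q` are connected by a dg algebra of pairs of operators that agree along `f`. -/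
def IsStrict (f : P ⟶ Q) : Prop :=
  ∃ (E : DGAlg.{u}) (s : E ⟶ P.diffOpAlg) (t : E ⟶ Q.diffOpAlg), quasiIso s ∧
    ∀ e, Intertwines f (alg s e) (alg t e)

/-- Form the fibre product G of E and the triangular algebra of g over the operators on Q. Its map
to the operators on P is a quasi-isomorphism, so both sides may be compared on G. -/
lemma transfer_comp_of_isStrict (h : IsStrict f) (hf : quasiIso f) (hg : quasiIso g)
    (hfg : quasiIso (f ≫ g)) :
    transfer hP hR hfg = transfer hP hQ hf ≪≫ transfer hQ hR hg := by
  obtain ⟨E, s, t, hs, hst⟩ := h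
  obtain ⟨G, p, q, hpq, hG, hinj⟩ := exists_fiberProduct E (triangular hQ hR g)
    (alg t).toLinearMap (alg (triFst hQ hR g)).toLinearMap Q.diffOpAlg.d (fun n => Q.diffOpAlg.comp n)
    (fun a => alg_d t a) (fun a => alg_d (triFst hQ hR g) a) (fun n a => comp_mem_of_hom t a rfl)
    (fun n a => comp_mem_of_hom (triFst hQ hR g) a rfl)
    ((map_one (alg t)).trans (map_one (alg (triFst hQ hR g))).symm) (fun a a' b b' h h' => by
      change alg t (a * a') = alg (triFst hQ hR g) (b * b')
      rw [map_mul, map_mul]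
      exact congrArg₂ _ h h')
  have hp : quasiIso p := quasiIso_of_fiberProduct (fun a => alg_d (triFst hQ hR g) a)
    triFst_surjective ((quasiIso_iff _).1 (quasiIso_triFst hg)) hG hpq hinj
  have e1 : p ≫ t = q ≫ triFst hQ hR g := hom_ext hpq
  -- The homotopy H for g becomes the homotopy H ∘ f for f ≫ g; the identities carry over because
  -- operators from E agree exactly along f.
  have e2 : toHo.map (p ≫ s) ≫ (transfer hP hR hfg).hom = toHo.map (q ≫ triSnd hQ hR g) := by
    let m : G →ₗ[ℂ] DiffAlong g :=
      (Triangular.mid (hP := hQ) (hQ := hR) (f := g)) ∘ₗ (alg q).toLinearMap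
    have hm : ∀ x, m x = Triangular.mid (hP := hQ) (hQ := hR) (f := g) (alg q x) := fun x => rfl
    have hq1 : ∀ x, Triangular.fst (hP := hQ) (hQ := hR) (f := g) (alg q x) = alg t (alg p x) :=
      fun x => (hpq x).symm
    have hin : ∀ (x : G) (a : P), alg f (op (alg s (alg p x)) a) =
      op (alg t (alg p x)) (alg f a) := fun x a => hst (alg p x) a
    refine map_transfer hfg (exists_triangular_lift hP hR (f ≫ g) (p ≫ s) (q ≫ triSnd hQ hR g)
      (pre hP hQ.1 f rfl ∘ₗ m) ?_ (fun a b => ?_) (fun n a ha => ?_) fun a => ?_)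
    · rw [LinearMap.comp_apply, hm, map_one]
      exact map_zero _
    · refine dval_ext (LinearMap.ext fun x => ?_)
      have h1 := LinearMap.congr_fun (congrArg dval ((congrArg
        (Triangular.mid (hP := hQ) (hQ := hR) (f := g)) (map_mul (alg q) a b)).trans
        (Triangular.mid_mul _ _))) (alg f x)
      refine h1.trans ?_
      rw [hq1, map_add, dval_rmul, dval_lmul, map_add, dval_rmul, dval_lmul,
        LinearMap.add_apply, LinearMap.add_apply, LinearMap.comp_apply, ← hin]
      rfl
    · have h1 := (isGraded_alg q n a ha).1.2
      have h2 := homDeg_comp h1 (alg_mem_homDeg f)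
      rwa [add_zero] at h2
    · refine dval_ext (LinearMap.ext fun x => ?_)
      have h1 := LinearMap.congr_fun (congrArg dval ((congrArg
        (Triangular.mid (hP := hQ) (hQ := hR) (f := g)) (alg_d q a)).trans
        (Triangular.mid_d _))) (alg f x)
      refine h1.trans ?_
      rw [hq1, LinearMap.comp_apply, ← pre_diffD]
      simp only [map_sub, LinearMap.sub_apply]
      refine congrArg₂ _ (congrArg₂ _ ?_ rfl) rfl
      exact (congrArg (alg g) (hin a x)).symm
  have hps : IsIso (toHo.map (p ≫ s)) :=
    Localization.inverts toHo quasiIso _ (quasiIso_comp hp hs)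
  ext
  rw [← cancel_epi (toHo.map (p ≫ s)), e2, Iso.trans_hom, Functor.map_comp, Functor.map_comp,
    Category.assoc, reassoc_of% (map_transfer_of_intertwines (hP := hP) (hQ := hQ) hf hst), ← Functor.map_comp_assoc,
    e1, Functor.map_comp, Category.assoc, map_triFst_transfer]

/-- This is the strict fibre product over operators along f, the candidate witness for strictness.
-/
lemma exists_agreeing (hP : IsPoly P) (hQ : IsPoly Q) (f : P ⟶ Q) :
    ∃ (G : DGAlg.{u}) (p : G ⟶ P.diffOpAlg) (q : G ⟶ Q.diffOpAlg),
      (∀ g, diffPost f (alg p g) = diffPre hP hQ.1 f (alg q g)) ∧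
      (∀ a b, diffPost f a = diffPre hP hQ.1 f b → ∃ g, alg p g = a ∧ alg q g = b) ∧
      ∀ g g', alg p g = alg p g' → alg q g = alg q g' → g = g' := by
  refine exists_fiberProduct _ _ (diffPost f) (diffPre hP hQ.1 f) (diffD f) (diffComp f)
    diffPost_d (diffPre_d hP hQ.1) (fun n a => ?_) (fun n b => ?_) ?_ fun a a' b b' h h' => ?_
  · refine LinearMap.congr_fun (f := diffPost f ∘ₗ P.diffOpAlg.comp n)
      (g := diffComp f n ∘ₗ diffPost f) (linearMap_ext fun m a ha => ?_) a
    have h1 : diffPost f a ∈ diffDeg f m := by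
      have := homDeg_comp (alg_mem_homDeg f) (op_mem_opDeg.1 ha)
      rwa [zero_add] at this
    rw [LinearMap.comp_apply, LinearMap.comp_apply]
    by_cases h : n = m
    · subst h; rw [comp_of_mem ha, diffComp_of_mem h1]
    · rw [comp_of_mem_ne ha h, diffComp_of_mem_ne h1 h, map_zero]
  · refine LinearMap.congr_fun (f := diffPre hP hQ.1 f ∘ₗ Q.diffOpAlg.comp n)
      (g := diffComp f n ∘ₗ diffPre hP hQ.1 f) (linearMap_ext fun m a ha => ?_) b
    have h1 : diffPre hP hQ.1 f a ∈ diffDeg f m := by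
      have := homDeg_comp (op_mem_opDeg.1 ha) (alg_mem_homDeg f)
      rwa [add_zero] at this
    rw [LinearMap.comp_apply, LinearMap.comp_apply]
    by_cases h : n = m
    · subst h; rw [comp_of_mem ha, diffComp_of_mem h1]
    · rw [comp_of_mem_ne ha h, diffComp_of_mem_ne h1 h, map_zero]
  · exact diffPost_eq_diffPre_iff.2 fun p => rfl
  · rw [diffPost_eq_diffPre_iff] at h h' ⊢
    intro p
    rw [op_mul, op_mul, Module.End.mul_apply, Module.End.mul_apply, h, h']

lemma isStrict_of_diffPre_surjective (hP : IsPoly P) (hQ : IsPoly Q) (hf : quasiIso f)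
    (hs : Function.Surjective (diffPre hP hQ.1 f)) : IsStrict f := by
  obtain ⟨G, p, q, hpq, hG, hinj⟩ := exists_agreeing hP hQ f
  exact ⟨G, p, q, quasiIso_of_fiberProduct (diffPre_d hP hQ.1) hs (coneAcyclic_diffPre hP hQ hf)
    hG hpq hinj, fun e => diffPost_eq_diffPre_iff.1 (hpq e)⟩

/-- Surjectivity makes the projection to operators on Q a quasi-isomorphism; the one to operators on
P follows by cancellation in the commutative square. -/
lemma isStrict_of_diffPost_surjective (hP : IsPoly P) (hQ : IsPoly Q) (hf : quasiIso f)
    (hs : Function.Surjective (diffPost f)) : IsStrict f := by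
  obtain ⟨G, p, q, hpq, hG, hinj⟩ := exists_agreeing hP hQ f
  have hq : quasiIso q := quasiIso_of_fiberProduct (φ := diffPre hP hQ.1 f) diffPost_d hs
    (coneAcyclic_diffPost hP hf) (p := q) (q := p)
    (fun a b h => (hG b a h.symm).imp fun _ h => h.symm) (fun g => (hpq g).symm)
    fun g g' h h' => hinj g g' h' h
  refine ⟨G, p, q, ?_, fun e => diffPost_eq_diffPre_iff.1 (hpq e)⟩
  rw [quasiIso_iff] at hq ⊢
  refine (coneAcyclic_diffPost hP hf).of_comp_left (fun v => alg_d p v) diffPost_d ?_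
  have := hq.comp (fun v => alg_d q v) (diffPre_d hP hQ.1) (coneAcyclic_diffPre hP hQ hf)
  rwa [show diffPost f ∘ₗ (alg p).toLinearMap = diffPre hP hQ.1 f ∘ₗ (alg q).toLinearMap from
    LinearMap.ext hpq]

/-- If i is a section of f, then m · (f ∘ D) = f ∘ (i(m) · D), so every operator along f comes from
P. -/
lemma isStrict_retraction (hP : IsPoly P) (hQ : IsPoly Q) {i : Q ⟶ P} (h : i ≫ f = 𝟙 Q)
    (hf : quasiIso f) : IsStrict f := by
  refine isStrict_of_diffPost_surjective hP hQ hf fun T => ?_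
  have : dval T ∈ (LinearMap.range (diffPost f)).map dval := by
    refine diff_le_of (fun m D hD => ?_) (dval_mem T)
    obtain ⟨D', hD'⟩ := exists_op_eq (P.diffOps.mul_mem (mulLeft_mem_diffOps (alg i m)) hD)
    refine ⟨_, ⟨D', rfl⟩, LinearMap.ext fun p => ?_⟩
    have hi : alg f (alg i m) = m := AlgHom.congr_fun (congrArg alg h) m
    simp [hD', hi]
  obtain ⟨_, ⟨D, rfl⟩, hD⟩ := this
  exact ⟨D, dval_ext hD⟩

/-- If generators go to generators, D extends to an operator D' on Q, and m · (f ∘ D) = (m · D') ∘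
f. -/
lemma isStrict_inclusion (hP : IsPoly P) (hQ : IsPoly Q) (hf : quasiIso f) {κ κ' : Type}
    {deg : κ → ℤ} {y : κ → P} {deg' : κ' → ℤ} {x : κ' → Q} (hy : IsFree P deg y)
    (hx : IsFree Q deg' x) {e : κ → κ'} (he : Function.Injective e) (h1 : ∀ k, deg' (e k) = deg k)
    (h2 : ∀ k, x (e k) = alg f (y k)) : IsStrict f := by
  refine isStrict_of_diffPre_surjective hP hQ hf fun T => ?_
  have : dval T ∈ (LinearMap.range (diffPre hP hQ.1 f)).map dval := by
    refine diff_le_of (fun m D hD => ?_) (dval_mem T)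
    obtain ⟨D₁, hD₁, h⟩ := hy.exists_lift_diffOp hx hQ.1 he h1 h2 hD
    obtain ⟨D', hD'⟩ := exists_op_eq (Q.diffOps.mul_mem (mulLeft_mem_diffOps m) hD₁)
    refine ⟨_, ⟨D', rfl⟩, LinearMap.ext fun p => ?_⟩
    simp [hD', h]
  obtain ⟨_, ⟨D, rfl⟩, hD⟩ := this
  exact ⟨D, dval_ext hD⟩

/-- A quasi-isomorphism of polynomial algebras factors into strict ones. -/
lemma exists_strict_factorization (hP : IsPoly P) (hQ : IsPoly Q) (hf : quasiIso f) :
    ∃ (Z : DGAlg.{u}) (j : P ⟶ Z) (r : Z ⟶ Q), IsPoly Z ∧ j ≫ r = f ∧ quasiIso j ∧ quasiIso r ∧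
      IsStrict j ∧ IsStrict r := by
  obtain ⟨Z, i, j, r, hir, hjr, hi, κ, ι, deg, y, deg', x, hy, -, -, hx⟩ :=
    hP.exists_mappingCylinder hQ f
  have hr := quasiIso_of_retraction hir (hi.quasiIso hQ.1)
  have hj : quasiIso j := quasiIso_of_comp_left hr (hjr ▸ hf)
  exact ⟨Z, j, r, hi.isPoly, hjr, hj, hr, isStrict_inclusion hP hi.isPoly hj hy hx
    Sum.inr_injective (fun _ => rfl) (fun _ => rfl), isStrict_retraction hi.isPoly hQ hir hr⟩

/-- Factor f into strict maps j and r; peeling off j from both f and f ≫ g, and r from r ≫ g, uses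
only the strict composition law. -/
lemma transfer_comp (hf : quasiIso f) (hg : quasiIso g) (hfg : quasiIso (f ≫ g)) :
    transfer hP hR hfg = transfer hP hQ hf ≪≫ transfer hQ hR hg := by
  obtain ⟨Z, j, r, hZ, rfl, hj, hr, hj', hr'⟩ := exists_strict_factorization hP hQ hf
  have hrg := quasiIso_comp hr hg
  have e1 : transfer hP hR hfg = transfer hP hZ hj ≪≫ transfer hZ hR hrg := by
    rw [← transfer_comp_of_isStrict hj' hj hrg (by rwa [← Category.assoc])]
    congr 1
  rw [e1, transfer_comp_of_isStrict (hQ := hZ) hj' hj hr hf,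
    transfer_comp_of_isStrict (hQ := hQ) hr' hr hg hrg, Iso.trans_assoc]

/-- Both ends of the cylinder are sections of r, so both have the inverse of the transfer of r as
their transfer. -/
lemma transfer_eq_of_homotopy (c : CylinderObject P) (K : c.Z ⟶ Q) (hf : quasiIso (c.i ≫ K))
    (hg : quasiIso (c.j ≫ K)) : transfer hP hQ hf = transfer hP hQ hg := by
  have hi := c.isExtension.quasiIso hP.1
  have hZ := c.isExtension.isPoly
  have hr := quasiIso_of_retraction c.i_r hi
  have hj : quasiIso c.j := quasiIso_of_comp_left hr (c.j_r ▸ quasiIso_id P)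
  have hK := quasiIso_of_comp_right hi hf
  have e : ∀ {k : P ⟶ c.Z} (hk : quasiIso k), k ≫ c.r = 𝟙 P →
      transfer hP hZ hk = (transfer hZ hP hr).symm := fun {k} hk h => by
    have h1 := transfer_comp (hP := hP) (hQ := hZ) (hR := hP) hk hr (h ▸ quasiIso_id P)
    have h2 : ∀ {l : P ⟶ P} (hl : quasiIso l), l = 𝟙 P → transfer hP hP hl = Iso.refl _ := by
      rintro l hl rfl
      exact transfer_id hl
    rw [h2 _ h] at h1
    ext
    rw [Iso.symm_hom, ← Category.id_comp (transfer hZ hP hr).inv, Iso.eq_comp_inv]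
    exact (congrArg Iso.hom h1).symm
  rw [transfer_comp (hQ := hZ) hi hK, transfer_comp (hQ := hZ) hj hK, e hi c.i_r, e hj c.j_r]

end Transfer

end DGAlg

namespace DGAlg

lemma IsFinitePolynomial.isPoly {P : DGAlg.{u}} (h : P.IsFinitePolynomial) (hc : IsComm P) :
    IsPoly P := by
  obtain ⟨n, deg, x, hdeg, hx⟩ := h.exists_isFree hc
  exact ⟨hc, Fin n, inferInstance, deg, x, hdeg, hx⟩

lemma IsFinitePolynomial.nontrivial {P : DGAlg.{u}} (h : P.IsFinitePolynomial) : Nontrivial P := by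
  obtain ⟨n, deg, x, -, -, hi, -⟩ := h
  exact ⟨_, _, hi.ne_zero ⟨0, fun _ _ => Nat.zero_le _⟩⟩

lemma nontrivial_of_hom {A B : DGAlg.{u}} (f : A ⟶ B) [Nontrivial B] : Nontrivial A :=
  (alg f).toRingHom.domain_nontrivial

lemma IsPoly.isFinitePolynomial {P : DGAlg.{u}} (h : IsPoly P) [Nontrivial P] :
    P.IsFinitePolynomial := by
  obtain ⟨n, deg, x, hdeg, hx⟩ := h.exists_fin
  exact hx.isFinitePolynomial h.1 hdeg

end DGAlg

/-! ### The functor on isomorphisms in the homotopy category. -/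

namespace CDGAlg

open DGAlg

variable {A B C : CDGAlg.{u}}

instance (p : A.Resolution) : IsIso (toHo.map p.π) := Localization.inverts toHo quasiIso _ p.quasiIso_π

lemma Resolution.isPoly (p : A.Resolution) : IsPoly p.P.obj := p.isFinitePolynomial.isPoly (isComm _)

/-- A morphism of resolutions covers `φ` if it represents `φ` in the homotopy category. -/
def Covers (p : A.Resolution) (q : B.Resolution) (φ : toHo.obj A ≅ toHo.obj B) (f : p.P ⟶ q.P) :
    Prop :=
  toHo.map p.π ≫ φ.hom = toHo.map f ≫ toHo.map q.π

variable {p : A.Resolution} {q : B.Resolution} {r : C.Resolution}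
  {φ : toHo.obj A ≅ toHo.obj B} {ψ : toHo.obj B ≅ toHo.obj C}

lemma Covers.quasiIso {f : p.P ⟶ q.P} (h : Covers p q φ f) : DGAlg.quasiIso f.hom := by
  have h1 : IsIso (toHo.map f ≫ toHo.map q.π) := by rw [← h]; infer_instance
  have : IsIso (toHo.map f) := IsIso.of_isIso_comp_right _ (toHo.map q.π)
  exact quasiIso_of_isIso_toHo f

lemma exists_covers (p : A.Resolution) (q : B.Resolution) (φ : toHo.obj A ≅ toHo.obj B) :
    ∃ f, Covers p q φ f := by
  obtain ⟨f, hf⟩ := exists_toHo_map_eq p.isPoly (toHo.map p.π ≫ φ.hom ≫ inv (toHo.map q.π))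
  exact ⟨f, by simp [Covers, hf]⟩

lemma Covers.comp {f : p.P ⟶ q.P} {g : q.P ⟶ r.P} (hf : Covers p q φ f) (hg : Covers q r ψ g) :
    Covers p r (φ ≪≫ ψ) (f ≫ g) := by
  unfold Covers at *
  rw [Iso.trans_hom, reassoc_of% hf, hg, Functor.map_comp, Category.assoc]

lemma covers_id (p : A.Resolution) : Covers p p (Iso.refl _) (𝟙 _) := by
  simp [Covers]

/-- Two representatives of φ become equal in the homotopy category, since q is invertible there;
hence they are homotopic. -/
lemma transfer_eq_of_covers {f g : p.P ⟶ q.P} (hf : Covers p q φ f) (hg : Covers p q φ g) :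
    transfer p.isPoly q.isPoly hf.quasiIso = transfer p.isPoly q.isPoly hg.quasiIso := by
  have h : toHo.map f = toHo.map g := by
    rw [← cancel_mono (toHo.map q.π)]
    exact hf.symm.trans hg
  obtain ⟨c⟩ := p.isPoly.exists_cylinderObject
  obtain ⟨K, h1, h2⟩ := leftHomotopic_of_toHo_eq c h
  have h3 := hf.quasiIso
  have h4 := hg.quasiIso
  have key : ∀ {k l : p.P.obj ⟶ q.P.obj} (hk : DGAlg.quasiIso k) (hl : DGAlg.quasiIso l),
      c.i ≫ K = k → c.j ≫ K = l → transfer p.isPoly q.isPoly hk = transfer p.isPoly q.isPoly hl := by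
    rintro _ _ hk hl rfl rfl
    exact transfer_eq_of_homotopy c K hk hl
  exact key h3 h4 h1 h2

/-- The isomorphism `D_P ≅ D_Q` induced by an isomorphism in the homotopy category. -/
noncomputable def resTransfer (p : A.Resolution) (q : B.Resolution) (φ : toHo.obj A ≅ toHo.obj B) :
    DGAlg.toHo.obj p.P.obj.diffOpAlg ≅ DGAlg.toHo.obj q.P.obj.diffOpAlg :=
  transfer p.isPoly q.isPoly (exists_covers p q φ).choose_spec.quasiIso

lemma Covers.resTransfer_eq {f : p.P ⟶ q.P} (hf : Covers p q φ f) :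
    resTransfer p q φ = transfer p.isPoly q.isPoly hf.quasiIso :=
  transfer_eq_of_covers (exists_covers p q φ).choose_spec hf

lemma resTransfer_refl (p : A.Resolution) : resTransfer p p (Iso.refl _) = Iso.refl _ := by
  rw [(covers_id p).resTransfer_eq]
  exact transfer_id _

lemma resTransfer_trans (p : A.Resolution) (q : B.Resolution) (r : C.Resolution)
    (φ : toHo.obj A ≅ toHo.obj B) (ψ : toHo.obj B ≅ toHo.obj C) :
    resTransfer p r (φ ≪≫ ψ) = resTransfer p q φ ≪≫ resTransfer q r ψ := by
  obtain ⟨f, hf⟩ := exists_covers p q φ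
  obtain ⟨g, hg⟩ := exists_covers q r ψ
  rw [(hf.comp hg).resTransfer_eq, hf.resTransfer_eq, hg.resTransfer_eq]
  exact transfer_comp hf.quasiIso hg.quasiIso (hf.comp hg).quasiIso

/-- An isomorphism in `HoRes` as an isomorphism in the homotopy category. -/
noncomputable def isoOfCore {X Y : Core HoRes.{u}} (φ : X ⟶ Y) : toHo.obj X.of.obj ≅ toHo.obj Y.of.obj :=
  (inducedFunctor fun A : hasResolution.{u}.FullSubcategory => toHo.obj A.obj).mapIso φ.iso

/-- The chosen resolution. -/
noncomputable def res (A : hasResolution.{u}.FullSubcategory) : A.obj.Resolution :=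
  Classical.choice A.property

end CDGAlg

open CDGAlg in
/-- The functor `A ↦ D_P` defined by chosen resolutions. -/
noncomputable def chosenDiffOpFunctor : DiffOpFunctor.{u} where
  functor :=
    { obj := fun X => ⟨DGAlg.toHo.obj (res X.of).P.obj.diffOpAlg⟩
      map := fun {X Y} φ => ⟨resTransfer (res X.of) (res Y.of) (isoOfCore φ)⟩
      map_id := fun X => congrArg CoreHom.mk (resTransfer_refl (res X.of))
      map_comp := fun {X Y Z} φ ψ => congrArg CoreHom.mk
        (resTransfer_trans (res X.of) (res Y.of) (res Z.of) (isoOfCore φ) (isoOfCore ψ)) }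
  comparison A p := resTransfer (res A) p (Iso.refl _)
  transport {A B} p q φ f hf E s t hst := by
    have hc : Covers p q (isoOfCore φ) f := hf
    -- Transfers compose, so passing through the chosen resolutions gives the same isomorphism as
    -- going directly from p to q.
    have e : resTransfer p q (isoOfCore φ) = (resTransfer (res A) p (Iso.refl _)).symm ≪≫
        resTransfer (res A) (res B) (isoOfCore φ) ≪≫ resTransfer (res B) q (Iso.refl _) := by
      rw [← resTransfer_trans, Iso.trans_refl]
      have h := resTransfer_trans (res A) p q (Iso.refl _) (isoOfCore φ)
      rw [Iso.refl_trans] at h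
      rw [h, Iso.symm_self_id_assoc]
    have h := DGAlg.map_transfer_of_intertwines (hP := p.isPoly) (hQ := q.isPoly) hc.quasiIso hst
    rw [← hc.resTransfer_eq, e] at h
    exact h

/-! ### Uniqueness of the functor and its comparison isomorphisms. -/

namespace DiffOpFunctor

open CDGAlg

variable (T : DiffOpFunctor.{u}) {A B C : hasResolution.{u}.FullSubcategory}

/-- The isomorphism `D_P ≅ D_Q` given by `T` and an isomorphism in the homotopy category. -/
noncomputable def move (p : A.obj.Resolution) (q : B.obj.Resolution)
    (φ : (⟨A⟩ : Core HoRes.{u}) ⟶ ⟨B⟩) :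
    DGAlg.toHo.obj p.P.obj.diffOpAlg ≅ DGAlg.toHo.obj q.P.obj.diffOpAlg :=
  (T.comparison A p).symm ≪≫ (T.functor.map φ).iso ≪≫ T.comparison B q

lemma move_comp (p : A.obj.Resolution) (q : B.obj.Resolution) (r : C.obj.Resolution)
    (φ : (⟨A⟩ : Core HoRes.{u}) ⟶ ⟨B⟩) (ψ : (⟨B⟩ : Core HoRes.{u}) ⟶ ⟨C⟩) :
    T.move p r (φ ≫ ψ) = T.move p q φ ≪≫ T.move q r ψ := by
  ext
  simp [move]

/-- `T` acts by `transfer` on strict quasi-isomorphisms. -/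
lemma move_eq_of_isStrict {p : A.obj.Resolution} {q : B.obj.Resolution}
    {φ : (⟨A⟩ : Core HoRes.{u}) ⟶ ⟨B⟩} {f : p.P ⟶ q.P} (hf : Covers p q (isoOfCore φ) f)
    (hs : DGAlg.IsStrict f.hom) :
    T.move p q φ = DGAlg.transfer p.isPoly q.isPoly hf.quasiIso := by
  obtain ⟨E, s, t, h, hst⟩ := hs
  have : IsIso (DGAlg.toHo.map s) := Localization.inverts DGAlg.toHo DGAlg.quasiIso s h
  ext
  -- Because s is invertible in the homotopy category, the transport law for this one pair (s, t)
  -- determines the action of T.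
  rw [← cancel_epi (DGAlg.toHo.map s),
    DGAlg.map_transfer_of_intertwines (hP := p.isPoly) (hQ := q.isPoly) hf.quasiIso hst]
  exact T.transport p q φ f hf E s t hst

/-- The transport law is decisive only for strict maps, so the covering map is factored into two
strict ones, and φ is factored accordingly through the intermediate algebra. -/
lemma move_eq (p : A.obj.Resolution) (q : B.obj.Resolution) (φ : (⟨A⟩ : Core HoRes.{u}) ⟶ ⟨B⟩) :
    T.move p q φ = resTransfer p q (isoOfCore φ) := by
  obtain ⟨f, hf⟩ := exists_covers p q (isoOfCore φ)
  obtain ⟨Z, j, r, hZ, hjr, hj, hr, hjs, hrs⟩ :=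
    DGAlg.exists_strict_factorization p.isPoly q.isPoly hf.quasiIso
  have := q.isFinitePolynomial.nontrivial
  have := DGAlg.nontrivial_of_hom r
  -- The intermediate algebra is an object of the groupoid in its own right, resolved by its
  -- identity, so T can be evaluated on each factor.
  let z : (ofPoly hZ).Resolution := ⟨ofPoly hZ, hZ.isFinitePolynomial, 𝟙 _, DGAlg.quasiIso_id Z⟩
  let D : hasResolution.{u}.FullSubcategory := ⟨ofPoly hZ, ⟨z⟩⟩
  let z' : D.obj.Resolution := z
  let j' : p.P ⟶ z'.P := homMk j
  let r' : z'.P ⟶ q.P := homMk r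
  have hj' : IsIso (toHo.map j') := Localization.inverts toHo quasiIso j' hj
  let α : toHo.obj A.obj ≅ toHo.obj D.obj := (asIso (toHo.map p.π)).symm ≪≫ asIso (toHo.map j')
  let φ₁ : (⟨A⟩ : Core HoRes.{u}) ⟶ ⟨D⟩ := ⟨InducedCategory.isoMk α⟩
  let φ₂ : (⟨D⟩ : Core HoRes.{u}) ⟶ ⟨B⟩ := inv φ₁ ≫ φ
  have e : φ = φ₁ ≫ φ₂ := (IsIso.hom_inv_id_assoc φ₁ φ).symm
  have h1 : Covers p z' (isoOfCore φ₁) j' := by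
    change toHo.map p.π ≫ inv (toHo.map p.π) ≫ toHo.map j' = toHo.map j' ≫ toHo.map (𝟙 _)
    simp
  have e1 : j' ≫ r' = f := InducedCategory.hom_ext hjr
  have h2 : Covers z' q (isoOfCore φ₂) r' := by
    have h3 : isoOfCore φ = isoOfCore φ₁ ≪≫ isoOfCore φ₂ := by
      conv_lhs => rw [e]
      rfl
    have h4 : toHo.map p.π ≫ (isoOfCore φ).hom = toHo.map f ≫ toHo.map q.π := hf
    rw [h3, Iso.trans_hom, ← Category.assoc, h1, ← e1, Functor.map_comp, Category.assoc,
      Category.assoc, cancel_epi] at h4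
    exact h4
  rw [e, T.move_comp p z' q, T.move_eq_of_isStrict h1 hjs, T.move_eq_of_isStrict h2 hrs]
  have h3 := (h1.comp h2).resTransfer_eq
  refine Eq.trans ?_ h3.symm
  exact (DGAlg.transfer_comp h1.quasiIso h2.quasiIso (h1.comp h2).quasiIso).symm

/-- The change of resolution inside any such functor is the action of an identity, which does not
depend on the functor; hence the comparison of two functors does not depend on the resolution. -/
lemma comparison_trans (T' : DiffOpFunctor.{u}) (A : hasResolution.{u}.FullSubcategory)
    (p q : A.obj.Resolution) :
    (T.comparison A p).hom ≫ (T'.comparison A p).inv =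
      (T.comparison A q).hom ≫ (T'.comparison A q).inv := by
  have h : ∀ T : DiffOpFunctor.{u},
      (T.comparison A p).inv ≫ (T.comparison A q).hom = (resTransfer p q (isoOfCore (𝟙 _))).hom :=
    fun T => by
      rw [← T.move_eq]
      simp [move]
  rw [← Iso.cancel_iso_inv_left (T.comparison A p), Iso.inv_hom_id_assoc,
    ← Iso.cancel_iso_hom_right _ _ (T'.comparison A q), Category.assoc, Category.assoc,
    Iso.inv_hom_id, Category.comp_id, h, h]

/-- The isomorphism of two functors compatible with the comparison isomorphisms. -/
noncomputable def isoOfComparison (T' : DiffOpFunctor.{u}) : T.functor ≅ T'.functor :=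
  NatIso.ofComponents
    (fun X => Groupoid.isoEquivHom _ _ |>.symm
      ⟨T.comparison X.of (res X.of) ≪≫ (T'.comparison X.of (res X.of)).symm⟩)
    (fun {X Y} φ => by
      have h : T.move (res X.of) (res Y.of) φ = T'.move (res X.of) (res Y.of) φ :=
        (T.move_eq _ _ φ).trans (T'.move_eq _ _ φ).symm
      have h' := congrArg Iso.hom h
      simp only [move, Iso.trans_hom, Iso.symm_hom] at h'
      refine CoreHom.ext (Iso.ext ?_)
      change (T.functor.map φ).iso.hom ≫ (T.comparison Y.of (res Y.of)).hom ≫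
        (T'.comparison Y.of (res Y.of)).inv = ((T.comparison X.of (res X.of)).hom ≫
        (T'.comparison X.of (res X.of)).inv) ≫ (T'.functor.map φ).iso.hom
      rw [Iso.inv_comp_eq] at h'
      rw [← Category.assoc, Iso.comp_inv_eq, h']
      simp)

lemma isoOfComparison_comparison (T' : DiffOpFunctor.{u}) (A : hasResolution.{u}.FullSubcategory)
    (p : A.obj.Resolution) :
    ((T.isoOfComparison T').hom.app ⟨A⟩).iso.hom ≫ (T'.comparison A p).hom =
      (T.comparison A p).hom := by
  change ((T.comparison A (res A)).hom ≫ (T'.comparison A (res A)).inv) ≫ _ = _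
  rw [T.comparison_trans T' A (res A) p, Category.assoc, Iso.inv_hom_id, Category.comp_id]

end DiffOpFunctor
theorem mainTheorem9 :
    (∃ T : DiffOpFunctor.{u}, ∀ T' : DiffOpFunctor.{u}, ∃! η : T.functor ≅ T'.functor,
      ∀ (A : CDGAlg.hasResolution.{u}.FullSubcategory) (p : A.obj.Resolution),
        (η.hom.app ⟨A⟩).iso.hom ≫ (T'.comparison A p).hom = (T.comparison A p).hom) ∧
    ∀ (A : CDGAlg.{u}) (p q : A.Resolution),
      Relation.EqvGen (fun X Y : DGAlg.{u} => ∃ f : X ⟶ Y, DGAlg.quasiIso f)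
        p.P.obj.diffOpAlg q.P.obj.diffOpAlg := by
  refine ⟨⟨chosenDiffOpFunctor, fun T' => ⟨chosenDiffOpFunctor.isoOfComparison T',
    chosenDiffOpFunctor.isoOfComparison_comparison T', fun η hη => ?_⟩⟩, fun A p q => ?_⟩
  · ext X
    -- Compatibility at one resolution already determines each component, since the comparison map
    -- is invertible.
    have h1 := hη X.of (CDGAlg.res X.of)
    rw [← chosenDiffOpFunctor.isoOfComparison_comparison T'] at h1
    exact (cancel_mono _).1 h1
  · obtain ⟨f, hf⟩ := CDGAlg.exists_covers p q (Iso.refl _)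
    exact .trans _ (DGAlg.triangular p.isPoly q.isPoly f.hom) _
      (.symm _ _ (.rel _ _ ⟨_, DGAlg.quasiIso_triFst hf.quasiIso⟩))
      (.rel _ _ ⟨_, DGAlg.quasiIso_triSnd hf.quasiIso⟩)
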